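/- Let $k$ be a field of characteristic $0$, $B$ a commutative $k$-algebra, and $A$ an associative unital $k$-algebra with a central algebra embedding $B\hookrightarrow A$ such that $A/B$ is a free $B$-module. Notation. For a commutative ring $R$ and an $R$-algebra $A$, $\Omega_R A$ is the DG algebra of noncommutative differential forms over $R$ (generated by $A$ and symbols $da$, $R$-linear in $a$, with $d(ab)=a\,db+da\,b$). Let $\imath_\Delta:\Omega^n_RA\to\Omega^{n-1}_RA$ be the reduced contraction $$\imath_\Delta(a_0\,da_1\cdots da_n)=\sum_{j=1}^n(-1)^{(j-1)(n-j+1)}\,[a_j,\ da_{j+1}\cdots da_n\,a_0\,da_1\cdots da_{j-1}].$$ Put $\Omega A=\Omega_kA$, $\Omega^BA=\Omega A/\langle\!\langle[\Omega A,\Omega B]\rangle\!\rangle$ (super-commutators), let $F^i$ be the $i$-th power of the ideal $\langle\!\langle dB\rangle\!\rangle$ of $\Omega^BA$, and put $\Omega(A;B)=\Omega^BA/F^1=\Omega_BA$. Let $\bar\Omega^BA$ and $\bar\Omega(A;B)$ be the reduced versions, obtained by dividing out the image of $\Omega B$ (that is, $B$ in the case of $\Omega(A;B)$). For a graded space $M=\bigoplus_{p\ge0}M^p$,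 the degree $n$ part of $M\hat\otimes k[t,t^{-1}]$ is $\prod_i t^iM^{n-2i}$, with $|t|=2$. Let $HP^B_\bullet(A)$ be the reduced periodic cyclic homology of $A$ over the ground ring $B$, i.e. the homology of the product total complex, with differential $b+\mathsf B$, of the reduced normalised chains $A\otimes_B(A/B)^{\otimes_B p}$ ($p\ge1$), $A/B$ ($p=0$). Then: (1) There are $B$-linear isomorphisms $\Phi: H^{-n}\big(\bar\Omega(A;B)\hat\otimes k[t,t^{-1}],\,d+t\,\imath_\Delta\big)\cong HP^B_n(A)$, $n\in\mathbb Z$. They are characterised by $\Phi[(f_p)_p]=[((-1)^{\lfloor p/2\rfloor}\,p!\,f_p)_p]$ whenever $(f_p)_p$, $f_p\in\bar\Omega^p(A;B)$, is a cocycle and the right-hand family, read as a family of chains through $a_0\,da_1\cdots da_p\leftrightarrow a_0\otimes\cdots\otimes a_p$, is a cycle for $b+\mathsf B$. (2) $HP^B_\bullet(A)$ carries a canonical flat (Gauss–Manin) connection, given by the first differential of the spectral sequence of the filtration $F^\bullet$ on $\big(\bar\Omega^BA\hat\otimes k[t,t^{-1}],\,d+t\,\imath_\Delta\big)$ that starts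 on the classes of $\mathrm{gr}^0_F$. Precisely: (a) For every $k$-derivation $\theta$ of $B$ and every $n$ there is an additive operator $\nabla_\theta$ on $HP^B_n(A)$ with $\nabla_{b\theta+\eta}=b\nabla_\theta+\nabla_\eta$, $\nabla_\theta(bx)=b\nabla_\theta x+\theta(b)x$ and $\nabla_{[\theta,\eta]}=[\nabla_\theta,\nabla_\eta]$. The family $(\nabla_\theta)$ is unique with the property: if $\alpha$ is a lift to $\bar\Omega^BA\hat\otimes k[t,t^{-1}]$ of a cocycle $\bar\alpha$ of $\bar\Omega(A;B)\hat\otimes k[t,t^{-1}]$, and the contraction of the class of $(d+t\,\imath_\Delta)\alpha$ in $\mathrm{gr}^1_F$ with $\theta$ ($db\cdot\gamma\mapsto\theta(b)\bar\gamma$) is a cocycle $\bar\beta$, then $\nabla_\theta\Phi[\bar\alpha]=\Phi[\bar\beta]$. (b) If the module of Kähler differentials $\Omega^1_{\mathrm{comm}}B=\Omega^1_{B/k}$ is finitely generated and projective (e.g. $B$ is regular and finitely generated over $k$), there are additive maps $$\nabla_{GM}:HP^B_n(A)\to HP^B_n(A)\otimes_B\Omega^1_{\mathrm{comm}}B,\qquad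 n\in\mathbb Z,$$ with $\nabla_{GM}(bx)=b\nabla_{GM}(x)+x\otimes db$ that are flat: $\nabla_1\circ\nabla_{GM}=0$ for $\nabla_1(x\otimes\omega)=\nabla_{GM}(x)\wedge\omega+x\otimes d\omega$. The family $\nabla_{GM}$ is unique with the property: if $\alpha$ lifts a cocycle $\bar\alpha$ and $(d+t\,\imath_\Delta)\alpha\equiv\sum_j db_j\cdot\gamma_j$ modulo $F^2$, a finite sum in which $\gamma_j$ lifts a cocycle $\bar\gamma_j$, then $\nabla_{GM}\Phi[\bar\alpha]=\sum_j\Phi[\bar\gamma_j]\otimes db_j$. -/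

import Mathlib

open scoped TensorProduct

noncomputable section

namespace NCGM

/-! ## Noncommutative differential forms over a commutative ground ring -/

section Forms

/-- Relations of the algebra of noncommutative forms: in the free algebra on symbols
`a = ι (a, 0)` and `da = ι (0, a)` (both linear in `a`), `a ↦ ι (a, 0)` is a unital algebra map
and `a ↦ ι (0, a)` is a derivation. -/
inductive FormsRel (R A : Type*) [CommRing R] [Ring A] [Algebra R A] :
    TensorAlgebra R (A × A) → TensorAlgebra R (A × A) → Prop
  | one : FormsRel R A (TensorAlgebra.ι R ((1 : A), (0 : A))) 1
  | mul (a b : A) : FormsRel R A (TensorAlgebra.ι R (a * b, (0 : A)))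
      (TensorAlgebra.ι R (a, (0 : A)) * TensorAlgebra.ι R (b, (0 : A)))
  | leibniz (a b : A) : FormsRel R A (TensorAlgebra.ι R ((0 : A), a * b))
      (TensorAlgebra.ι R (a, (0 : A)) * TensorAlgebra.ι R ((0 : A), b) +
        TensorAlgebra.ι R ((0 : A), a) * TensorAlgebra.ι R (b, (0 : A)))

/-- `Ω_R A`, the algebra of noncommutative differential forms of the `R`-algebra `A`
relative to the ground ring `R`. -/
def Forms (R A : Type*) [CommRing R] [Ring A] [Algebra R A] : Type _ := RingQuot (FormsRel R A)

variable (R : Type*) {A : Type*} [CommRing R] [Ring A] [Algebra R A]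

instance : Ring (Forms R A) := inferInstanceAs (Ring (RingQuot (FormsRel R A)))

instance {S : Type*} [CommRing S] [Algebra S R] [Algebra S A] [IsScalarTower S R A] :
    Algebra S (Forms R A) := inferInstanceAs (Algebra S (RingQuot (FormsRel R A)))

instance {S : Type*} [CommRing S] [Algebra S R] [Algebra S A] [IsScalarTower S R A] :
    IsScalarTower S R (Forms R A) :=
  inferInstanceAs (IsScalarTower S R (RingQuot (FormsRel R A)))

/-- The quotient map from the free algebra on the symbols `a`, `da`. -/
def Forms.mk : TensorAlgebra R (A × A) →ₐ[R] Forms R A := RingQuot.mkAlgHom R (FormsRel R A)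

/-- The map `A → Ω_R A` identifying `A` with the forms of degree zero. -/
def incl : A →ₗ[R] Forms R A :=
  (Forms.mk R).toLinearMap ∘ₗ TensorAlgebra.ι R ∘ₗ LinearMap.inl R A A

/-- The universal derivation `a ↦ da`. -/
def der : A →ₗ[R] Forms R A :=
  (Forms.mk R).toLinearMap ∘ₗ TensorAlgebra.ι R ∘ₗ LinearMap.inr R A A

theorem incl_one : incl R (1 : A) = 1 := by
  have h : Forms.mk R _ = Forms.mk R _ :=
    RingQuot.mkAlgHom_rel R (FormsRel.one (R := R) (A := A))
  rwa [map_one] at h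

theorem incl_mul (a b : A) : incl R (a * b) = incl R a * incl R b := by
  have h : Forms.mk R _ = Forms.mk R _ :=
    RingQuot.mkAlgHom_rel R (FormsRel.mul (R := R) a b)
  rwa [map_mul] at h

theorem der_mul (a b : A) : der R (a * b) = incl R a * der R b + der R a * incl R b := by
  have h : Forms.mk R _ = Forms.mk R _ :=
    RingQuot.mkAlgHom_rel R (FormsRel.leibniz (R := R) a b)
  rwa [map_add, map_mul, map_mul] at h

theorem der_one : der R (1 : A) = 0 := by
  have := der_mul R (1 : A) 1
  simpa [incl_one] using this

/-- The universal property of `Ω_R A` as an algebra: an algebra map `f` on `A` together with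
an `f`-derivation `δ` extends to `Ω_R A`. -/
def liftForms {T : Type*} [Ring T] [Algebra R T] (f δ : A →ₗ[R] T) (h1 : f 1 = 1)
    (hm : ∀ a b, f (a * b) = f a * f b) (hd : ∀ a b, δ (a * b) = f a * δ b + δ a * f b) :
    Forms R A →ₐ[R] T :=
  RingQuot.liftAlgHom R ⟨TensorAlgebra.lift R (f.coprod δ), by
    rintro _ _ (_ | ⟨a, b⟩ | ⟨a, b⟩)
    · simp [h1]
    · simp [hm]
    · simp [hd]⟩

theorem liftForms_incl {T : Type*} [Ring T] [Algebra R T] (f δ : A →ₗ[R] T) (h1 : f 1 = 1)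
    (hm : ∀ a b, f (a * b) = f a * f b) (hd : ∀ a b, δ (a * b) = f a * δ b + δ a * f b) (a : A) :
    liftForms R f δ h1 hm hd (incl R a) = f a := by
  refine (RingQuot.liftAlgHom_mkAlgHom_apply R _ _ (TensorAlgebra.ι R (a, (0 : A)))).trans ?_
  simp

theorem liftForms_der {T : Type*} [Ring T] [Algebra R T] (f δ : A →ₗ[R] T) (h1 : f 1 = 1)
    (hm : ∀ a b, f (a * b) = f a * f b) (hd : ∀ a b, δ (a * b) = f a * δ b + δ a * f b) (a : A) :
    liftForms R f δ h1 hm hd (der R a) = δ a := by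
  refine (RingQuot.liftAlgHom_mkAlgHom_apply R _ _ (TensorAlgebra.ι R ((0 : A), a))).trans ?_
  simp

variable (A)

/-- The automorphism `ω ↦ (-1)^{|ω|} ω` of `Ω_R A`. -/
def parity : Forms R A →ₐ[R] Forms R A :=
  liftForms R (incl R) (-der R) (incl_one R) (incl_mul R) (fun a b => by
    simp only [LinearMap.neg_apply, der_mul]; noncomm_ring)

/-- The algebra map `ω ↦ ((-1)^{|ω|} ω, dω; 0, ω)`, where `d` is the graded derivation with
`d(a) = da` and `d(da) = 0`. -/
def deRhamMatrix : Forms R A →ₐ[R] Matrix (Fin 2) (Fin 2) (Forms R A) :=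
  liftForms R
    { toFun := fun a => !![incl R a, der R a; 0, incl R a]
      map_add' := fun a b => by ext i j; fin_cases i <;> fin_cases j <;> simp
      map_smul' := fun r a => by ext i j; fin_cases i <;> fin_cases j <;> simp }
    { toFun := fun a => !![-der R a, 0; 0, der R a]
      map_add' := fun a b => by ext i j; fin_cases i <;> fin_cases j <;> simp [add_comm]
      map_smul' := fun r a => by ext i j; fin_cases i <;> fin_cases j <;> simp }
    (by ext i j; fin_cases i <;> fin_cases j <;> simp [incl_one, der_one])
    (fun a b => by
      ext i j; fin_cases i <;> fin_cases j <;>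
        simp [incl_mul, der_mul])
    (fun a b => by
      ext i j; fin_cases i <;> fin_cases j <;>
        simp [der_mul, add_comm])

/-- The de Rham differential `d : Ω_R A → Ω_R A`, the graded derivation of degree one with
`d(a) = da`, `d(da) = 0`. -/
def deRham : Forms R A →ₗ[R] Forms R A :=
  { toFun := fun w => deRhamMatrix R A w 0 1
    map_add' := fun x y => by simp
    map_smul' := fun r x => by simp }

/-- The left `Ω_R A`-module structure on `(Ω_R A ⊗ Ω_R A) × Ω_R A` for which `ω` acts by
`(w, y) ↦ ((-1)^{|ω|} (ω ⊗ 1) w + 𝐢(ω) (1 ⊗ y), ω y)`, where `𝐢` is the double contraction. -/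
def contractionAction :
    Forms R A →ₐ[R] Module.End R ((Forms R A ⊗[R] Forms R A) × Forms R A) :=
  liftForms R
    (LinearMap.mk₂ R
      (fun (a : A) (z : (Forms R A ⊗[R] Forms R A) × Forms R A) =>
        ((incl R a ⊗ₜ[R] (1 : Forms R A)) * z.1, incl R a * z.2))
      (fun a b z => by simp [TensorProduct.add_tmul, add_mul])
      (fun r a z => by simp [← TensorProduct.smul_tmul'])
      (fun a z z' => by simp [mul_add])
      (fun r a z => by simp))
    (LinearMap.mk₂ R
      (fun (a : A) (z : (Forms R A ⊗[R] Forms R A) × Forms R A) =>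
        (-((der R a ⊗ₜ[R] (1 : Forms R A)) * z.1) +
          ((1 : Forms R A) ⊗ₜ[R] (incl R a * z.2) - incl R a ⊗ₜ[R] z.2), der R a * z.2))
      (fun a b z => by
        ext1
        · simp [TensorProduct.add_tmul, TensorProduct.tmul_add, add_mul]; abel
        · simp [add_mul])
      (fun r a z => by
        simp [← TensorProduct.smul_tmul', smul_add, smul_sub])
      (fun a z z' => by
        ext1
        · simp [TensorProduct.tmul_add, mul_add]; abel
        · simp [mul_add])
      (fun r a z => by simp [smul_add, smul_sub]))
    (by refine LinearMap.ext fun z => ?_; simp [incl_one, ← Algebra.TensorProduct.one_def])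
    (fun a b => by
      refine LinearMap.ext fun z => ?_
      simp [incl_mul, ← mul_assoc])
    (fun a b => by
      refine LinearMap.ext fun z => ?_
      ext1
      · simp [incl_mul, der_mul, TensorProduct.add_tmul, add_mul, ← mul_assoc, mul_add, mul_sub]
        abel
      · simp [der_mul, add_mul, ← mul_assoc])

/-- The double contraction `𝐢 : Ω_R A → Ω_R A ⊗ Ω_R A`, the graded double derivation of degree `-1`
attached to `Δ(a) = 1 ⊗ a - a ⊗ 1`: `𝐢(a) = 0`, `𝐢(da) = 1 ⊗ a - a ⊗ 1` and
`𝐢(ω η) = 𝐢(ω) (1 ⊗ η) + (-1)^{|ω|} (ω ⊗ 1) 𝐢(η)`. -/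
def doubleContraction : Forms R A →ₗ[R] Forms R A ⊗[R] Forms R A :=
  { toFun := fun w => (contractionAction R A w (0, 1)).1
    map_add' := fun x y => by simp
    map_smul' := fun r x => by simp }

/-- The reduced contraction `ı_Δ` on forms of degree `n`: the composite of `𝐢` with
`u ⊗ v ↦ (-1)^{|u||v|} v u`. As `|u| + |v| = n - 1`, the sign is `(-1)^{n|u|}`. -/
def redContraction (n : ℕ) : Forms R A →ₗ[R] Forms R A :=
  TensorProduct.lift ((LinearMap.mul R (Forms R A)).flip ∘ₗ ((parity R A) ^ n).toLinearMap) ∘ₗ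
    doubleContraction R A

variable {A}

/-- The span of the forms `a₀ da₁ ⋯ daₚ` with all `aᵢ` in the set `S`. -/
def formsOn (S : Set A) (p : ℕ) : Submodule R (Forms R A) :=
  Submodule.span R {w | ∃ (a₀ : A) (a : Fin p → A), a₀ ∈ S ∧ (∀ i, a i ∈ S) ∧
    w = incl R a₀ * (List.ofFn fun i => der R (a i)).prod}

variable (A)

/-- `Ωᵖ_R A`, the forms of degree `p`. -/
def formsDeg (p : ℕ) : Submodule R (Forms R A) := formsOn R (Set.univ : Set A) p

end Forms

/-! ## Homology of periodic complexes

For graded modules `C = ⊕ₚ C p`, an element of degree `-n` of `C ⊗̂ k[t, t⁻¹]` is a family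
`f` with `f p ∈ C p` for `p ≡ n mod 2` and `f p = 0` otherwise; `f p` is the coefficient of
`t ^ ((-n - p) / 2)`, so that the power of `t` need not be recorded. -/

section Periodic

variable {R : Type*} [CommRing R] {M : ℕ → Type*} [∀ p, AddCommGroup (M p)] [∀ p, Module R (M p)]

/-- The total differential `u + t v` of a map `u` raising and a map `v` lowering the degree by
one. -/
def total (u : ∀ p, M p →ₗ[R] M (p + 1)) (v : ∀ p, M (p + 1) →ₗ[R] M p) :
    (∀ p, M p) →ₗ[R] (∀ p, M p) :=
  LinearMap.pi fun p =>
    (match p with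
      | 0 => 0
      | q + 1 => u q ∘ₗ LinearMap.proj q) + v p ∘ₗ LinearMap.proj (p + 1)

/-- Families with `p`-th member in `G p` for `p ≡ n mod 2` and zero otherwise. -/
def families (G : ∀ p, Submodule R (M p)) (n : ℤ) : Submodule R (∀ p, M p) :=
  Submodule.pi Set.univ fun p => if Even (n - (p : ℤ)) then G p else ⊥

/-- Families in `G` of degree `n` which are cycles for `D` modulo `N`. -/
def cycles (G N : ∀ p, Submodule R (M p)) (D : (∀ p, M p) →ₗ[R] (∀ p, M p)) (n : ℤ) :
    Submodule R (∀ p, M p) :=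
  families G n ⊓ (Submodule.pi Set.univ N).comap D

/-- Families of degree `n` which are boundaries for `D` modulo `N`. -/
def boundaries (G N : ∀ p, Submodule R (M p)) (D : (∀ p, M p) →ₗ[R] (∀ p, M p)) (n : ℤ) :
    Submodule R (∀ p, M p) :=
  (families G (n + 1)).map D ⊔ families (fun p => G p ⊓ N p) n

/-- The homology in degree `n` of the periodic complex of the graded module `G / (G ∩ N)` with the
differential induced by `D`. -/
def PerHomology (G N : ∀ p, Submodule R (M p)) (D : (∀ p, M p) →ₗ[R] (∀ p, M p)) (n : ℤ) :
    Type _ :=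
  cycles G N D n ⧸ (boundaries G N D n).submoduleOf (cycles G N D n)

instance (G N : ∀ p, Submodule R (M p)) (D : (∀ p, M p) →ₗ[R] (∀ p, M p)) (n : ℤ) :
    AddCommGroup (PerHomology G N D n) :=
  inferInstanceAs (AddCommGroup
    (cycles G N D n ⧸ (boundaries G N D n).submoduleOf (cycles G N D n)))

instance (G N : ∀ p, Submodule R (M p)) (D : (∀ p, M p) →ₗ[R] (∀ p, M p)) (n : ℤ) :
    Module R (PerHomology G N D n) :=
  inferInstanceAs (Module R
    (cycles G N D n ⧸ (boundaries G N D n).submoduleOf (cycles G N D n)))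

/-- The homology class of a cycle. -/
def PerHomology.mk {G N : ∀ p, Submodule R (M p)} {D : (∀ p, M p) →ₗ[R] (∀ p, M p)} {n : ℤ}
    (f : ∀ p, M p) (hf : f ∈ cycles G N D n) : PerHomology G N D n :=
  Submodule.Quotient.mk (p := (boundaries G N D n).submoduleOf (cycles G N D n)) ⟨f, hf⟩

end Periodic

/-! ## Relative periodic cyclic homology -/

section Cyclic

variable (B A : Type*) [CommRing B] [Ring A] [Algebra B A]

/-- `A ⊗_B ⋯ ⊗_B A` with `p + 1` factors. -/
abbrev Chains (p : ℕ) : Type _ := ⨂[B] (_ : Fin (p + 1)), A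

/-- `a₀ ⊗ ⋯ ⊗ aₚ ↦ aₚ ⊗ a₀ ⊗ ⋯ ⊗ aₚ₋₁`. -/
def rotate (p : ℕ) : Chains B A p ≃ₗ[B] Chains B A p :=
  PiTensorProduct.reindex B (fun _ => A) (finRotate (p + 1))

/-- `a₀ ⊗ a₁ ⊗ a₂ ⊗ ⋯ ⊗ aₚ₊₁ ↦ a₀ a₁ ⊗ a₂ ⊗ ⋯ ⊗ aₚ₊₁`. -/
def face₀ (p : ℕ) : Chains B A (p + 1) →ₗ[B] Chains B A p :=
  PiTensorProduct.lift (LinearMap.uncurryLeft (M := fun _ : Fin (p + 2) => A)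
    ((multilinearCurryLeftEquiv B (fun _ : Fin (p + 1) => A) (Chains B A p)).symm.toLinearMap ∘ₗ
      LinearMap.llcomp B A A _ (PiTensorProduct.tprod B (s := fun _ : Fin (p + 1) => A)).curryLeft
        ∘ₗ LinearMap.mul B A))

/-- The face `dᵢ`: for `i ≤ p` it multiplies the neighbours `aᵢ aᵢ₊₁`, and `dₚ₊₁` sends
`a₀ ⊗ ⋯ ⊗ aₚ₊₁` to `aₚ₊₁ a₀ ⊗ a₁ ⊗ ⋯ ⊗ aₚ`. -/
def face (p i : ℕ) : Chains B A (p + 1) →ₗ[B] Chains B A p :=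
  if i ≤ p then
    ((rotate B A p).toLinearMap ^ i) ∘ₗ face₀ B A p ∘ₗ ((rotate B A (p + 1)).symm.toLinearMap ^ i)
  else face₀ B A p ∘ₗ (rotate B A (p + 1)).toLinearMap

/-- The Hochschild boundary `b = ∑ᵢ (-1)ⁱ dᵢ`. -/
def hochschildB (p : ℕ) : Chains B A (p + 1) →ₗ[B] Chains B A p :=
  ∑ i ∈ Finset.range (p + 2), (-1 : ℤ) ^ i • face B A p i

/-- `a₀ ⊗ ⋯ ⊗ aₚ ↦ 1 ⊗ a₀ ⊗ ⋯ ⊗ aₚ`. -/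
def insertOne (p : ℕ) : Chains B A p →ₗ[B] Chains B A (p + 1) :=
  PiTensorProduct.lift ((PiTensorProduct.tprod B (s := fun _ : Fin (p + 2) => A)).curryLeft 1)

/-- Connes' operator on normalised chains,
`a₀ ⊗ ⋯ ⊗ aₚ ↦ ∑ᵢ (-1)^{p i} 1 ⊗ aᵢ ⊗ ⋯ ⊗ aₚ ⊗ a₀ ⊗ ⋯ ⊗ aᵢ₋₁`. -/
def connesB (p : ℕ) : Chains B A p →ₗ[B] Chains B A (p + 1) :=
  insertOne B A p ∘ₗ ∑ i ∈ Finset.range (p + 1),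
    (-1 : ℤ) ^ (p * i) • ((rotate B A p).symm.toLinearMap ^ i)

/-- The chains that vanish in the reduced normalised complex, which is
`A ⊗_B (A/B)^{⊗ p}` for `p ≥ 1` and `A/B` for `p = 0`. -/
def degenerate (p : ℕ) : Submodule B (Chains B A p) :=
  Submodule.span B {x | ∃ a : Fin (p + 1) → A,
    (∃ i, (i ≠ 0 ∨ p = 0) ∧ a i ∈ Set.range (algebraMap B A)) ∧ x = PiTensorProduct.tprod B a}

/-- The differential `B + b` of the periodic cyclic complex. -/
def cyclicDiff : (∀ p, Chains B A p) →ₗ[B] (∀ p, Chains B A p) :=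
  total (connesB B A) (hochschildB B A)

/-- The periodic cyclic cycles of degree `n` (in the reduced normalised complex). -/
def cyclicCycles (n : ℤ) : Submodule B (∀ p, Chains B A p) :=
  cycles (fun _ => ⊤) (degenerate B A) (cyclicDiff B A) n

/-- `HPᴮₙ(A)`: the reduced periodic cyclic homology of `A` over the ground ring `B`. -/
abbrev HP (n : ℤ) : Type _ :=
  PerHomology (fun _ => ⊤) (degenerate B A) (cyclicDiff B A) n

end Cyclic

/-! ## The equivariant differential on forms -/

section Equivariant

variable (R A : Type*) [CommRing R] [Ring A] [Algebra R A]

/-- The differential `d + t ı_Δ`. -/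
def equivDiff : (ℕ → Forms R A) →ₗ[R] (ℕ → Forms R A) :=
  total (M := fun _ => Forms R A) (fun _ => deRham R A) (fun p => redContraction R A (p + 1))

/-- The forms that vanish in the reduced complex `Ω̄`, where `Ω̄⁰ = A / R` and `Ω̄ᵖ = Ωᵖ` for
`p ≥ 1`. -/
def groundForms : ℕ → Submodule R (Forms R A)
  | 0 => Submodule.span R {1}
  | _ + 1 => ⊥

/-- Cycles of degree `-n` of `Ω̄ ⊗̂ k[t, t⁻¹]` with the differential `d + t ı_Δ`. -/
def formCycles (n : ℤ) : Submodule R (ℕ → Forms R A) :=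
  cycles (formsDeg R A) (groundForms R A) (equivDiff R A) n

/-- `H^{-n}(Ω̄ ⊗̂ k[t, t⁻¹], d + t ı_Δ)`, for forms relative to the ground ring `R`. -/
abbrev FormHomology (n : ℤ) : Type _ :=
  PerHomology (M := fun _ => Forms R A) (formsDeg R A) (groundForms R A) (equivDiff R A) n

/-- `a₀ ⊗ ⋯ ⊗ aₚ ↦ a₀ da₁ ⋯ daₚ`. -/
def chainToForm (p : ℕ) : Chains R A p →ₗ[R] Forms R A :=
  PiTensorProduct.lift ((MultilinearMap.mkPiAlgebraFin R (p + 1) (Forms R A)).compLinearMap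
    (Fin.cons (incl R) fun _ => der R))

variable {R A} in
/-- The comparison of `d + t ı_Δ` with `B + b`. A cycle `f` for `d + t ı_Δ`, rescaled by `p!` in
degree `p` and by `t ↦ -t`, represents the same class as soon as it is a cycle for `B + b`. -/
def IsComparison (Φ : ∀ n, FormHomology R A n ≃ₗ[R] HP R A n) : Prop :=
  ∀ (n : ℤ) (f : ℕ → Forms R A) (hf : f ∈ formCycles R A n)
    (c : ∀ p, Chains R A p) (hc : c ∈ cyclicCycles R A n),
    (∀ p, chainToForm R A p (c p) - ((-1 : ℤ) ^ (p / 2) * (p.factorial : ℤ)) • f p ∈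
      groundForms R A p) →
    Φ n (PerHomology.mk f hf) = PerHomology.mk c hc

end Equivariant

/-! ## The filtration -/

section Filtration

variable (k B A : Type*) [CommRing k] [CommRing B] [Ring A] [Algebra k B] [Algebra k A]
  [Algebra B A] [IsScalarTower k B A]

/-- The projection `Ω A = Ω_k A → Ω(A; B) = Ω_B A`, `a ↦ a`, `da ↦ da`. -/
def toRelative : Forms k A →ₐ[k] Forms B A :=
  liftForms k ((incl B).restrictScalars k) ((der B).restrictScalars k) (incl_one B) (incl_mul B)
    (der_mul B)

/-- The image of `Ω B` in `Ω A`. -/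
def baseForms : Submodule k (Forms k A) :=
  ⨆ q, formsOn k (Set.range (algebraMap B A)) q

/-- The two-sided ideal `⟪[Ω A, Ω B]⟫` of `Ω A` generated by super-commutators; the quotient of
`Ω A` by it is `Ωᴮ A`. -/
def commIdeal : Submodule k (Forms k A) :=
  ⊤ * Submodule.span k {x | ∃ (p q : ℕ) (w e : Forms k A), w ∈ formsDeg k A p ∧
    e ∈ formsOn k (Set.range (algebraMap B A)) q ∧ x = w * e - (-1 : ℤ) ^ (p * q) • (e * w)} * ⊤

/-- The two-sided ideal `⟪dB⟫` of `Ω A`. -/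
def diffIdeal : Submodule k (Forms k A) :=
  ⊤ * Submodule.span k (Set.range fun b : B => der k (algebraMap B A b)) * ⊤

/-- The inverse image in `Ω A` of `Fⁱ(Ωᴮ A)`, the `i`-th power of the ideal `⟪dB⟫` of `Ωᴮ A`. -/
def filtration : ℕ → Submodule k (Forms k A)
  | 0 => ⊤
  | i + 1 => commIdeal k B A ⊔ diffIdeal k B A ^ (i + 1)

/-- The inverse image in `Ω A` of `Fⁱ` of the reduced quotient `Ω̄ᴮ A` of `Ωᴮ A` by the image of
`Ω B`. -/
def redFiltration (i : ℕ) : Submodule k (Forms k A) :=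
  filtration k B A i ⊔ baseForms k B A

/-- A family in `Ω A` representing an element of degree `-n` of `Ω̄ᴮ A ⊗̂ k[t, t⁻¹]` whose image
in `Ω̄(A; B) ⊗̂ k[t, t⁻¹]` is a cycle for `d + t ı_Δ`. -/
structure IsLift (n : ℤ) (f : ℕ → Forms k A) : Prop where
  mem : f ∈ families (M := fun _ => Forms k A) (formsDeg k A) n
  cycle : (fun p => toRelative k B A (f p)) ∈ formCycles B A n

variable {k B A} in
/-- The class in `H^{-n}(Ω̄(A; B) ⊗̂ k[t, t⁻¹])` of a lift of a cycle. -/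
def IsLift.cls {n : ℤ} {f : ℕ → Forms k A} (hf : IsLift k B A n f) : FormHomology B A n :=
  PerHomology.mk _ hf.cycle

/-- The pairs `(x, y)` such that `y`, modulo `F¹`, is the contraction of the class of `x` in
`F¹ / F²` with `θ`, where `db · y` is contracted to `θ(b) y`. -/
def contractionRel (θ : Derivation k B B) : Submodule k (Forms k A × Forms k A) :=
  Submodule.span k {z | ∃ (b : B) (y : Forms k A),
      z = (der k (algebraMap B A b) * y, incl k (algebraMap B A (θ b)) * y)} ⊔
    (redFiltration k B A 2).prod (redFiltration k B A 1)

end Filtration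

/-! ## Connections -/

section Connections

variable (k B : Type*) [CommRing k] [CommRing B] [Algebra k B]

/-- `η ↦ η ∧ ω`, from Kähler differentials to Kähler two-forms. -/
def wedgeRight (ω : Ω[B⁄k]) : Ω[B⁄k] →ₗ[B] ⋀[B]^2 Ω[B⁄k] :=
  (exteriorPower.ιMulti B 2 (M := Ω[B⁄k])).toMultilinearMap.toLinearMap ![0, ω] 0

variable {k B}

/-- A flat connection on the `B`-module `H`: an additive map `∇ : H → H ⊗_B Ω¹` with the Leibniz
rule whose extension `∇₁(x ⊗ ω) = ∇x ∧ ω + x ⊗ dω` to `H ⊗_B Ω¹ → H ⊗_B Ω²` satisfies `∇₁ ∇ = 0`. -/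
structure IsFlatConnection {H : Type*} [AddCommGroup H] [Module B H]
    (nabla : H →+ H ⊗[B] Ω[B⁄k]) : Prop where
  leibniz : ∀ (b : B) (x : H), nabla (b • x) = b • nabla x + x ⊗ₜ[B] KaehlerDifferential.D k B b
  flat : ∃ nabla₁ : H ⊗[B] Ω[B⁄k] →+ H ⊗[B] (⋀[B]^2 Ω[B⁄k]),
    (∀ (x : H) (b c : B), nabla₁ (x ⊗ₜ[B] (b • KaehlerDifferential.D k B c)) =
      (wedgeRight k B (b • KaehlerDifferential.D k B c)).lTensor H (nabla x) +
        x ⊗ₜ[B] wedgeRight k B (KaehlerDifferential.D k B c) (KaehlerDifferential.D k B b)) ∧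
    ∀ x : H, nabla₁ (nabla x) = 0

/-- A flat connection on the `B`-module `H` in the sense of covariant derivatives: every
`k`-derivation `θ` of `B` acts on `H` by an additive operator `∇_θ` with the Leibniz rule,
`B`-linearly in `θ`, and `∇_[θ, η] = [∇_θ, ∇_η]`. -/
structure IsFlatAction {H : Type*} [AddCommGroup H] [Module B H]
    (nabla : Derivation k B B → H →+ H) : Prop where
  add : ∀ (θ η : Derivation k B B) (x : H), nabla (θ + η) x = nabla θ x + nabla η x
  smul : ∀ (b : B) (θ : Derivation k B B) (x : H), nabla (b • θ) x = b • nabla θ x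
  leibniz : ∀ (θ : Derivation k B B) (b : B) (x : H),
    nabla θ (b • x) = b • nabla θ x + θ b • x
  flat : ∀ (θ η : Derivation k B B) (x : H),
    nabla ⁅θ, η⁆ x = nabla θ (nabla η x) - nabla η (nabla θ x)

variable {A : Type*} [Ring A] [Algebra k A] [Algebra B A] [IsScalarTower k B A]

/-- The Gauss–Manin connection: if `f` lifts a cycle and
`(d + t ı_Δ) f = ∑ⱼ dbⱼ · gⱼ` modulo `F²`, where the `gⱼ` lift cycles, then
`∇ [f] = ∑ⱼ [gⱼ] ⊗ dbⱼ`. Classes are transported to `HP` along `Φ`. -/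
def IsGaussManin (Φ : ∀ n, FormHomology B A n ≃ₗ[B] HP B A n)
    (nabla : ∀ n, HP B A n →+ HP B A n ⊗[B] Ω[B⁄k]) : Prop :=
  ∀ (n : ℤ) (f : ℕ → Forms k A) (hf : IsLift k B A n f)
    (m : ℕ) (b : Fin m → B) (g : Fin m → ℕ → Forms k A) (hg : ∀ j, IsLift k B A n (g j)),
    (∀ p, equivDiff k A f (p + 1) - ∑ j, der k (algebraMap B A (b j)) * g j p ∈
      redFiltration k B A 2) →
    nabla n (Φ n hf.cls) = ∑ j, Φ n (hg j).cls ⊗ₜ[B] KaehlerDifferential.D k B (b j)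

/-- The Gauss–Manin covariant derivatives: if `f` lifts a cycle, and the lift `g` of a cycle is
the contraction with `θ` of the class of `(d + t ı_Δ) f` in `F¹ / F²`, then `∇_θ [f] = [g]`.
Classes are transported to `HP` along `Φ`. -/
def IsGaussManinAction (Φ : ∀ n, FormHomology B A n ≃ₗ[B] HP B A n)
    (nabla : ∀ n, Derivation k B B → HP B A n →+ HP B A n) : Prop :=
  ∀ (n : ℤ) (θ : Derivation k B B) (f g : ℕ → Forms k A)
    (hf : IsLift k B A n f) (hg : IsLift k B A n g),
    (∀ p, (equivDiff k A f (p + 1), g p) ∈ contractionRel k B A θ) →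
    nabla n θ (Φ n hf.cls) = Φ n hg.cls

end Connections

end NCGM

/-!
Two mechanisms carry the theorem: harmonic theory for the Karoubi operator, which compares forms
with cyclic chains, and contraction of `Ωᴮ A` with derivations of the base, which gives the
connection.

**The comparison.** The Hochschild boundary `b` acts on noncommutative forms, and the Karoubi
operator `κ = 1 - (bd + db)` rotates words, `κ(w da) = ± da w`. On forms of degree `n` the reduced
contraction is `ı_Δ = -b (1 + κ + ⋯ + κⁿ⁻¹)` (`redContraction_of_mem`), while Connes'
operator on forms of degree `n` is `B = (1 + κ + ⋯ + κⁿ) d`. Thus `d + t ı_Δ` and `B + b` are built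
from the same two operators, with the averaging moved from `b` to `d`. In characteristic zero there
is a polynomial `g` in `κ` with `(1 - κ) g` equal to `1` minus the average, and the harmonic
operator `P = 1 - (d g b + g b d)` is homotopic to the identity for both differentials
(`sub_harmonic_equivDiff`, `sub_harmonic_formCyclicDiff`). After `P` the sums over powers of `κ`
in the two differentials reduce to integer factors, so that `P` followed by multiplication with
`(-1)^⌊p/2⌋ p!` in degree `p` intertwines the two differentials, and likewise backwards
(`formCyclicDiff_scaledHarmonic`, `equivDiff_scaledHarmonic`). Since forms embed into `A ⊗ T(A /
R)` and `A → A / R` has a linear section, chains modulo degenerate chains are reduced forms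
(`chainToForm_mem_ground_iff`). The composite is `comparison`. It is the only one with the stated
normalisation, because each class has a harmonic representative, to which the normalisation
applies (`IsComparison.eq_comparison`).

**The filtration.** The ideal divided out in `Ωᴮ A` is generated by the supercommutators of `da`
with `b` and with `db` (`commIdeal_induction`), and it is stable under `d` and under `ı_Δ`. Modulo
this ideal the elements of `F¹` are sums `∑ db · y`, and `F¹` is the kernel of the projection to
relative forms (`toRelative_eq_zero_iff`). If `f` lifts a cycle, then `(d + t ı_Δ) f` lies in `F¹`
up to forms on the base.

**Covariant derivatives.** The map `∑ db · y ↦ ∑ θ(b) y` has to be shown well defined. Relative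
forms are projective over `B` and so carry a covariant derivative `L` along `θ`. Letting `da` act by
`da` plus the commutator of `L` with `a`, in the manner of a superconnection, one obtains an action
of `Ω A` that factors through `Ωᴮ A` (`superAction`). Its off-diagonal part is a map `C_θ` on all of
`Ωᴮ A` with `C_θ(db · y) = θ(b) y` (`exists_contractions`), which vanishes on `F²` and anticommutes
with `d + t ı_Δ` on `F¹`. Therefore `∇_θ [f] = [C_θ((d + t ı_Δ) f)]` is well defined on homology.
Two covariant derivatives at once give the contraction with a pair of derivations. Applied to
`(d + t ı_Δ)² f = 0` it yields `∇_[θ, η] = [∇_θ, ∇_η]` (`contraction_equivDiff_sub`,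
`gaussManin_lie`).

**The global connection.** If the Kähler differentials are finitely generated and projective, there
are derivations `θⱼ` and elements `bⱼ` with `dc = ∑ θⱼ(c) dbⱼ` (`exists_isCoordinates`), and the
connection is `∇ x = ∑ ∇_θⱼ x ⊗ dbⱼ`. Its curvature vanishes by the flatness of the `∇_θⱼ` and by
`∑ dθⱼ(c) ∧ dbⱼ = d(dc) = 0` for the exterior derivative of Kähler differentials
(`exteriorDerivative`, `isFlatConnection_connectionOfAction`).
-/

namespace NCGM

set_option linter.unusedSectionVars false

/-! ### Words and the grading of noncommutative forms -/

section Words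

variable {R A : Type*} [CommRing R] [Ring A] [Algebra R A]

theorem incl_algebraMap (r : R) : incl R (algebraMap R A r) = algebraMap R (Forms R A) r := by
  rw [Algebra.algebraMap_eq_smul_one, map_smul, incl_one, Algebra.algebraMap_eq_smul_one]

theorem der_algebraMap (r : R) : der R (algebraMap R A r) = 0 := by
  rw [Algebra.algebraMap_eq_smul_one, map_smul, der_one, smul_zero]

theorem Forms.induction {P : Forms R A → Prop} (hincl : ∀ a, P (incl R a))
    (hder : ∀ a, P (der R a)) (hmul : ∀ x y, P x → P y → P (x * y))
    (hadd : ∀ x y, P x → P y → P (x + y)) (w : Forms R A) : P w := by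
  obtain ⟨t, rfl⟩ := RingQuot.mkAlgHom_surjective R (FormsRel R A) w
  change P (Forms.mk R t)
  induction t using TensorAlgebra.induction with
  | algebraMap r =>
    rw [AlgHom.commutes, ← incl_algebraMap]
    exact hincl _
  | ι x =>
    have hx : x = LinearMap.inl R A A x.1 + LinearMap.inr R A A x.2 := by ext <;> simp
    rw [hx, map_add, map_add]
    exact hadd _ _ (hincl x.1) (hder x.2)
  | mul x y hx hy => rw [map_mul]; exact hmul _ _ hx hy
  | add x y hx hy => rw [map_add]; exact hadd _ _ hx hy

variable (R) in
/-- The product `da₁ ⋯ daₙ` of the differentials of a list of elements. -/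
def derProd (l : List A) : Forms R A := (l.map (der R)).prod

@[simp] theorem derProd_nil : derProd R ([] : List A) = 1 := rfl

@[simp] theorem derProd_cons (a : A) (l : List A) :
    derProd R (a :: l) = der R a * derProd R l := by
  simp [derProd]

@[simp] theorem derProd_append (l l' : List A) :
    derProd R (l ++ l') = derProd R l * derProd R l' := by
  simp [derProd]

theorem der_mul_word (a a₀ : A) (l : List A) :
    der R a * (incl R a₀ * derProd R l) =
      incl R 1 * derProd R ((a * a₀) :: l) - incl R a * derProd R (a₀ :: l) := by
  rw [incl_one, derProd_cons, derProd_cons, der_mul]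
  noncomm_ring

theorem Forms.word_induction {P : Forms R A → Prop}
    (word : ∀ (a : A) (l : List A), P (incl R a * derProd R l))
    (add : ∀ x y, P x → P y → P (x + y)) (w : Forms R A) : P w := by
  let S : AddSubgroup (Forms R A) :=
    AddSubgroup.closure {x | ∃ (a : A) (l : List A), x = incl R a * derProd R l}
  have hS : ∀ w, ∀ x ∈ S, w * x ∈ S := by
    intro w
    induction w using Forms.induction with
    | hincl a =>
      intro x hx
      induction hx using AddSubgroup.closure_induction with
      | mem x h =>
        obtain ⟨a₀, l, rfl⟩ := h
        rw [← mul_assoc, ← incl_mul]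
        exact AddSubgroup.subset_closure ⟨_, _, rfl⟩
      | zero => rw [mul_zero]; exact S.zero_mem
      | add x y _ _ hx hy => rw [mul_add]; exact S.add_mem hx hy
      | neg x _ hx => rw [mul_neg]; exact S.neg_mem hx
    | hder a =>
      intro x hx
      induction hx using AddSubgroup.closure_induction with
      | mem x h =>
        obtain ⟨a₀, l, rfl⟩ := h
        rw [der_mul_word]
        exact S.sub_mem (AddSubgroup.subset_closure ⟨_, _, rfl⟩)
          (AddSubgroup.subset_closure ⟨_, _, rfl⟩)
      | zero => rw [mul_zero]; exact S.zero_mem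
      | add x y _ _ hx hy => rw [mul_add]; exact S.add_mem hx hy
      | neg x _ hx => rw [mul_neg]; exact S.neg_mem hx
    | hmul v w hv hw => intro x hx; rw [mul_assoc]; exact hv _ (hw _ hx)
    | hadd v w hv hw => intro x hx; rw [add_mul]; exact S.add_mem (hv _ hx) (hw _ hx)
  have h1 : (1 : Forms R A) ∈ S :=
    AddSubgroup.subset_closure ⟨1, [], by rw [incl_one, derProd_nil, mul_one]⟩
  have hw := hS w 1 h1
  rw [mul_one] at hw
  have hneg : ∀ (a : A) (l : List A), -(incl R a * derProd R l) = incl R (-a) * derProd R l := by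
    intro a l; rw [map_neg, neg_mul]
  refine (AddSubgroup.closure_induction (p := fun x _ => P x ∧ P (-x)) ?_ ?_ ?_ ?_ hw).1
  · rintro _ ⟨a, l, rfl⟩
    exact ⟨word a l, hneg a l ▸ word (-a) l⟩
  · have : P 0 := by simpa using word 0 []
    exact ⟨this, by rwa [neg_zero]⟩
  · rintro x y _ _ ⟨hx, hx'⟩ ⟨hy, hy'⟩
    exact ⟨add _ _ hx hy, by rw [neg_add]; exact add _ _ hx' hy'⟩
  · rintro x _ ⟨hx, hx'⟩
    exact ⟨hx', by rwa [neg_neg]⟩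

/-- Every form is a sum of functions and of forms `ω da`. -/
theorem Forms.right_induction {P : Forms R A → Prop} (hincl : ∀ a, P (incl R a))
    (mul_der : ∀ w a, P (w * der R a)) (add : ∀ x y, P x → P y → P (x + y))
    (w : Forms R A) : P w := by
  induction w using Forms.word_induction with
  | word a l =>
    rcases List.eq_nil_or_concat l with rfl | ⟨l, b, rfl⟩
    · rw [derProd_nil, mul_one]; exact hincl a
    · rw [List.concat_eq_append, derProd_append, derProd_cons, derProd_nil, mul_one, ← mul_assoc]
      exact mul_der _ _
  | add x y hx hy => exact add _ _ hx hy

theorem word_mem_formsDeg (a : A) (l : List A) :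
    incl R a * derProd R l ∈ formsDeg R A l.length := by
  refine Submodule.subset_span ⟨a, l.get, trivial, fun _ => trivial, ?_⟩
  rw [derProd, ← List.ofFn_get (l.map (der R))]
  congr 2
  · refine List.ext_get ?_ ?_ <;> simp

theorem formsDeg_induction {n : ℕ} {P : ∀ w : Forms R A, w ∈ formsDeg R A n → Prop}
    (word : ∀ (a : A) (l : List A) (h : l.length = n),
      P (incl R a * derProd R l) (h ▸ word_mem_formsDeg a l))
    (add : ∀ x y hx hy, P x hx → P y hy → P (x + y) (add_mem hx hy)) {w : Forms R A}
    (hw : w ∈ formsDeg R A n) : P w hw := by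
  have key : ∀ r : R, ∃ h, P (r • w) h := by
    refine Submodule.span_induction (p := fun x _ => ∀ r : R, ∃ h, P (r • x) h) ?_ ?_ ?_ ?_ hw
    · rintro _ ⟨a₀, a, -, -, rfl⟩ r
      have : (List.ofFn fun i => der R (a i)) = (List.ofFn a).map (der R) := by
        rw [List.map_ofFn]; rfl
      rw [this, ← smul_mul_assoc, ← map_smul]
      exact ⟨_, word _ _ (List.length_ofFn)⟩
    · intro r
      rw [smul_zero]
      have h := word 0 (List.replicate n 0) (by simp)
      simp only [map_zero, zero_mul] at h
      exact ⟨_, h⟩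
    · intro x y _ _ hx hy r
      rw [smul_add]
      obtain ⟨hx', hx⟩ := hx r
      obtain ⟨hy', hy⟩ := hy r
      exact ⟨_, add _ _ _ _ hx hy⟩
    · intro s x _ hx r
      rw [smul_smul]; exact hx _
  obtain ⟨h, h'⟩ := key 1
  simpa only [one_smul] using h'

variable (R A) in
/-- The algebra map `ω ↦ ω X ^ |ω|`, which encodes the grading. -/
def gradeHom : Forms R A →ₐ[R] Polynomial (Forms R A) :=
  liftForms R
    { toFun := fun a => Polynomial.C (incl R a)
      map_add' := fun a b => by simp
      map_smul' := fun r a => by simp [Polynomial.smul_C] }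
    { toFun := fun a => Polynomial.monomial 1 (der R a)
      map_add' := fun a b => by simp
      map_smul' := fun r a => by
        rw [map_smul, RingHom.id_apply, Polynomial.smul_monomial] }
    (by simp [incl_one]) (fun a b => by simp [incl_mul])
    (fun a b => by
      simp only [LinearMap.coe_mk, AddHom.coe_mk, der_mul, Polynomial.C_mul_monomial,
        Polynomial.monomial_mul_C, map_add])

theorem gradeHom_incl (a : A) : gradeHom R A (incl R a) = Polynomial.C (incl R a) :=
  liftForms_incl R _ _ _ _ _ a

theorem gradeHom_der (a : A) : gradeHom R A (der R a) = Polynomial.monomial 1 (der R a) :=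
  liftForms_der R _ _ _ _ _ a

variable (R A) in
/-- The projection of `Ω_R A` onto the forms of degree `n`. -/
def projDeg (n : ℕ) : Forms R A →ₗ[R] Forms R A where
  toFun w := (gradeHom R A w).coeff n
  map_add' := by simp
  map_smul' := by simp

theorem gradeHom_derProd (l : List A) :
    gradeHom R A (derProd R l) = Polynomial.monomial l.length (derProd R l) := by
  induction l with
  | nil => simp
  | cons a l ih =>
    rw [derProd_cons, map_mul, ih, gradeHom_der, Polynomial.monomial_mul_monomial,
      List.length_cons, add_comm]

theorem gradeHom_word (a : A) (l : List A) : gradeHom R A (incl R a * derProd R l) =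
    Polynomial.monomial l.length (incl R a * derProd R l) := by
  rw [map_mul, gradeHom_incl, gradeHom_derProd, Polynomial.C_mul_monomial]

theorem gradeHom_of_mem {n : ℕ} {w : Forms R A} (hw : w ∈ formsDeg R A n) :
    gradeHom R A w = Polynomial.monomial n w := by
  induction hw using formsDeg_induction with
  | word a l h => rw [gradeHom_word, h]
  | add x y _ _ hx hy => rw [map_add, hx, hy, map_add]

theorem projDeg_mem (n : ℕ) (w : Forms R A) : projDeg R A n w ∈ formsDeg R A n := by
  induction w using Forms.word_induction with
  | word a l =>
    change (gradeHom R A _).coeff n ∈ _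
    rw [gradeHom_word, Polynomial.coeff_monomial]
    split_ifs with h
    · exact h ▸ word_mem_formsDeg a l
    · exact zero_mem _
  | add x y hx hy => rw [map_add]; exact add_mem hx hy

theorem projDeg_of_mem {n : ℕ} {w : Forms R A} (hw : w ∈ formsDeg R A n) (m : ℕ) :
    projDeg R A m w = if n = m then w else 0 := by
  change (gradeHom R A _).coeff m = _
  rw [gradeHom_of_mem hw, Polynomial.coeff_monomial]

theorem projDeg_self {n : ℕ} {w : Forms R A} (hw : w ∈ formsDeg R A n) :
    projDeg R A n w = w := by
  rw [projDeg_of_mem hw, if_pos rfl]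

theorem mem_formsDeg_iff {n : ℕ} {w : Forms R A} :
    w ∈ formsDeg R A n ↔ gradeHom R A w = Polynomial.monomial n w := by
  refine ⟨gradeHom_of_mem, fun h => ?_⟩
  have : projDeg R A n w = w := by
    change (gradeHom R A _).coeff n = _
    rw [h, Polynomial.coeff_monomial_same]
  exact this ▸ projDeg_mem n w

theorem mul_mem_formsDeg {p q : ℕ} {x y : Forms R A} (hx : x ∈ formsDeg R A p)
    (hy : y ∈ formsDeg R A q) : x * y ∈ formsDeg R A (p + q) := by
  rw [mem_formsDeg_iff] at *
  rw [map_mul, hx, hy, Polynomial.monomial_mul_monomial]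

theorem incl_mem_formsDeg (a : A) : incl R a ∈ formsDeg R A 0 := by
  rw [mem_formsDeg_iff, gradeHom_incl]; rfl

theorem one_mem_formsDeg : (1 : Forms R A) ∈ formsDeg R A 0 :=
  incl_one (A := A) R ▸ incl_mem_formsDeg 1

theorem der_mem_formsDeg (a : A) : der R a ∈ formsDeg R A 1 := by
  rw [mem_formsDeg_iff, gradeHom_der]

theorem derProd_mem_formsDeg (l : List A) : derProd R l ∈ formsDeg R A l.length := by
  rw [mem_formsDeg_iff, gradeHom_derProd]

theorem formsDeg_zero {w : Forms R A} (hw : w ∈ formsDeg R A 0) : ∃ a, w = incl R a := by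
  induction hw using formsDeg_induction with
  | word a l h =>
    obtain rfl := List.length_eq_zero_iff.1 h
    exact ⟨a, by simp⟩
  | add x y _ _ hx hy =>
    obtain ⟨a, rfl⟩ := hx
    obtain ⟨b, rfl⟩ := hy
    exact ⟨a + b, by rw [map_add]⟩

/-- A property stable under addition that holds on homogeneous forms holds on all forms. -/
theorem Forms.homogeneous_induction {P : Forms R A → Prop}
    (hom : ∀ n, ∀ w ∈ formsDeg R A n, P w)
    (add : ∀ x y, P x → P y → P (x + y)) (w : Forms R A) : P w := by
  induction w using Forms.word_induction with
  | word a l => exact hom _ _ (word_mem_formsDeg a l)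
  | add x y hx hy => exact add _ _ hx hy

theorem projDeg_mul_of_mem {p : ℕ} {x : Forms R A} (hx : x ∈ formsDeg R A p) (n : ℕ)
    (y : Forms R A) : projDeg R A (p + n) (x * y) = x * projDeg R A n y := by
  induction y using Forms.homogeneous_induction with
  | hom q y hy =>
    rw [projDeg_of_mem (mul_mem_formsDeg hx hy), projDeg_of_mem hy]
    simp [mul_ite]
  | add y z hy hz => rw [mul_add, map_add, map_add, mul_add, hy, hz]

theorem projDeg_zero_mul_der (y : Forms R A) (a : A) :
    projDeg R A 0 (y * der R a) = 0 := by
  induction y using Forms.homogeneous_induction with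
  | hom q y hy => rw [projDeg_of_mem (mul_mem_formsDeg hy (der_mem_formsDeg a)), if_neg (by simp)]
  | add y z hy hz => rw [add_mul, map_add, hy, hz, add_zero]

end Words

/-! ### The parity, the de Rham differential and the double contraction on products -/

section Operators

variable {R A : Type*} [CommRing R] [Ring A] [Algebra R A]

@[simp] theorem parity_incl (a : A) : parity R A (incl R a) = incl R a :=
  liftForms_incl R _ _ _ _ _ a

@[simp] theorem parity_der (a : A) : parity R A (der R a) = -der R a :=
  liftForms_der R _ _ _ _ _ a

theorem parity_of_mem {n : ℕ} {w : Forms R A} (hw : w ∈ formsDeg R A n) :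
    parity R A w = (-1 : ℤ) ^ n • w := by
  induction hw using formsDeg_induction with
  | word a l h =>
    subst h
    rw [map_mul, parity_incl, ← mul_smul_comm]
    congr 1
    induction l with
    | nil => simp
    | cons b l ih =>
      rw [derProd_cons, map_mul, ih, parity_der, List.length_cons, pow_succ', mul_smul_comm,
        neg_mul, smul_neg, neg_mul, one_mul, neg_smul]
  | add x y _ _ hx hy => rw [map_add, hx, hy, smul_add]

@[simp] theorem parity_parity (w : Forms R A) : parity R A (parity R A w) = w := by
  induction w using Forms.homogeneous_induction with
  | hom n w hw => rw [parity_of_mem hw, map_zsmul, parity_of_mem hw, smul_smul, ← mul_pow]; simp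
  | add x y hx hy => rw [map_add, map_add, hx, hy]

theorem deRhamMatrix_eq (w : Forms R A) :
    deRhamMatrix R A w = !![parity R A w, deRham R A w; 0, w] := by
  have h : (∀ w : Forms R A, deRhamMatrix R A w 0 0 = parity R A w ∧
      deRhamMatrix R A w 1 0 = 0 ∧ deRhamMatrix R A w 1 1 = w) := by
    intro w
    induction w using Forms.induction with
    | hincl a => simp [deRhamMatrix, liftForms_incl]
    | hder a => simp [deRhamMatrix, liftForms_der]
    | hmul x y hx hy => simp [Matrix.mul_apply, hx, hy]
    | hadd x y hx hy => simp [hx, hy]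
  obtain ⟨h1, h2, h3⟩ := h w
  ext i j
  fin_cases i <;> fin_cases j
  · exact h1
  · rfl
  · exact h2
  · exact h3

theorem deRham_mul (x y : Forms R A) :
    deRham R A (x * y) = deRham R A x * y + parity R A x * deRham R A y := by
  have := congrFun (congrFun (map_mul (deRhamMatrix R A) x y) 0) 1
  rw [deRhamMatrix_eq, deRhamMatrix_eq, deRhamMatrix_eq] at this
  simpa [Matrix.mul_apply, add_comm] using this

@[simp] theorem deRham_incl (a : A) : deRham R A (incl R a) = der R a := by
  simp [deRham, deRhamMatrix, liftForms_incl]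

@[simp] theorem deRham_der (a : A) : deRham R A (der R a) = 0 := by
  simp [deRham, deRhamMatrix, liftForms_der]

@[simp] theorem deRham_one : deRham R A 1 = 0 := by
  rw [← incl_one, deRham_incl, der_one]

@[simp] theorem deRham_derProd (l : List A) : deRham R A (derProd R l) = 0 := by
  induction l with
  | nil => simp
  | cons a l ih => rw [derProd_cons, deRham_mul, ih]; simp

theorem deRham_word (a : A) (l : List A) :
    deRham R A (incl R a * derProd R l) = derProd R (a :: l) := by
  rw [deRham_mul]; simp

theorem deRham_mul_der (w : Forms R A) (a : A) :
    deRham R A (w * der R a) = deRham R A w * der R a := by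
  rw [deRham_mul]; simp

theorem deRham_deRham (w : Forms R A) : deRham R A (deRham R A w) = 0 := by
  induction w using Forms.word_induction with
  | word a l => rw [deRham_word, deRham_derProd]
  | add x y hx hy => rw [map_add, map_add, hx, hy, add_zero]

theorem deRham_mem_formsDeg {n : ℕ} {w : Forms R A} (hw : w ∈ formsDeg R A n) :
    deRham R A w ∈ formsDeg R A (n + 1) := by
  induction hw using formsDeg_induction with
  | word a l h => rw [deRham_word, ← h]; exact derProd_mem_formsDeg (a :: l)
  | add x y _ _ hx hy => rw [map_add]; exact add_mem hx hy

theorem parity_deRham (w : Forms R A) :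
    parity R A (deRham R A w) = -deRham R A (parity R A w) := by
  induction w using Forms.homogeneous_induction with
  | hom n w hw =>
    rw [parity_of_mem hw, parity_of_mem (deRham_mem_formsDeg hw), map_zsmul, pow_succ]
    simp
  | add x y hx hy => simp only [map_add, hx, hy, neg_add]

theorem contractionAction_eq (w : Forms R A) (z : (Forms R A ⊗[R] Forms R A) × Forms R A) :
    contractionAction R A w z =
      ((parity R A w ⊗ₜ[R] (1 : Forms R A)) * z.1 +
        doubleContraction R A w * ((1 : Forms R A) ⊗ₜ[R] z.2), w * z.2) := by
  induction w using Forms.induction generalizing z with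
  | hincl a =>
    simp [doubleContraction, contractionAction, liftForms_incl]
  | hder a =>
    simp [doubleContraction, contractionAction, liftForms_der, TensorProduct.neg_tmul,
      sub_mul]
  | hmul x y hx hy =>
    have h : doubleContraction R A (x * y) =
        (parity R A x ⊗ₜ[R] (1 : Forms R A)) * doubleContraction R A y +
          doubleContraction R A x * ((1 : Forms R A) ⊗ₜ[R] y) := by
      change (contractionAction R A (x * y) (0, 1)).1 = _
      rw [map_mul, Module.End.mul_apply, hy, hx]
      simp [← Algebra.TensorProduct.one_def]
    rw [map_mul, Module.End.mul_apply, hy, hx, h]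
    ext1
    · simp only [mul_add, add_mul, map_mul, ← mul_assoc, Algebra.TensorProduct.tmul_mul_tmul,
        mul_one]
      rw [mul_assoc (doubleContraction R A x), Algebra.TensorProduct.tmul_mul_tmul, one_mul]
      abel
    · simp [mul_assoc]
  | hadd x y hx hy =>
    rw [map_add, LinearMap.add_apply, hx, hy, map_add, map_add]
    ext1
    · simp only [Prod.mk_add_mk, TensorProduct.add_tmul, add_mul]; abel
    · simp [add_mul]

theorem doubleContraction_mul (x y : Forms R A) : doubleContraction R A (x * y) =
    doubleContraction R A x * ((1 : Forms R A) ⊗ₜ[R] y) +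
      (parity R A x ⊗ₜ[R] (1 : Forms R A)) * doubleContraction R A y := by
  change (contractionAction R A (x * y) (0, 1)).1 = _
  rw [map_mul, Module.End.mul_apply, contractionAction_eq y, contractionAction_eq x]
  simp [← Algebra.TensorProduct.one_def, add_comm]

@[simp] theorem doubleContraction_incl (a : A) : doubleContraction R A (incl R a) = 0 := by
  simp [doubleContraction, contractionAction, liftForms_incl]

@[simp] theorem doubleContraction_der (a : A) : doubleContraction R A (der R a) =
    (1 : Forms R A) ⊗ₜ[R] incl R a - incl R a ⊗ₜ[R] (1 : Forms R A) := by
  simp [doubleContraction, contractionAction, liftForms_der]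

variable (R A) in
/-- The map `u ⊗ v ↦ (-1)^{n |u|} v u`. -/
def flipMul (n : ℕ) : Forms R A ⊗[R] Forms R A →ₗ[R] Forms R A :=
  TensorProduct.lift ((LinearMap.mul R (Forms R A)).flip ∘ₗ ((parity R A) ^ n).toLinearMap)

theorem flipMul_tmul (n : ℕ) (u v : Forms R A) :
    flipMul R A n (u ⊗ₜ[R] v) = v * ((parity R A) ^ n) u := by
  simp [flipMul]

theorem flipMul_tmul_of_mem (n : ℕ) {p : ℕ} {u : Forms R A} (hu : u ∈ formsDeg R A p)
    (v : Forms R A) : flipMul R A n (u ⊗ₜ[R] v) = (-1 : ℤ) ^ (n * p) • (v * u) := by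
  rw [flipMul_tmul]
  have : ((parity R A) ^ n) u = (-1 : ℤ) ^ (n * p) • u := by
    induction n with
    | zero => simp
    | succ n ih =>
      rw [pow_succ', AlgHom.mul_apply, ih, map_zsmul, parity_of_mem hu, smul_smul, ← pow_add]
      congr 2; ring
  rw [this, mul_smul_comm]

theorem redContraction_apply (n : ℕ) (w : Forms R A) :
    redContraction R A n w = flipMul R A n (doubleContraction R A w) := rfl

end Operators

/-! ### The Hochschild boundary and the Karoubi operator on forms -/

section Karoubi

variable (R A : Type*) [CommRing R] [Ring A] [Algebra R A]

/-- The Hochschild boundary on forms, `b(ω da) = (-1)^{|ω|} (ω a - a ω)`. It is minus the part of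
the reduced contraction that comes from the last differential, which is isolated by projecting the
right factor of the double contraction to degree zero. -/
def formB : Module.End R (Forms R A) :=
  -(flipMul R A 0 ∘ₗ (projDeg R A 0).lTensor (Forms R A) ∘ₗ doubleContraction R A)

/-- The Karoubi operator `κ = 1 - (b d + d b)`, for which `κ(ω da) = (-1)^{|ω|} da ω`. -/
def karoubi : Module.End R (Forms R A) :=
  1 - (formB R A * deRham R A + deRham R A * formB R A)

/-- The operator `1 + κ + ⋯ + κⁿ⁻¹`. -/
def karoubiSum (n : ℕ) : Module.End R (Forms R A) :=
  ∑ j ∈ Finset.range n, karoubi R A ^ j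

variable {R A}

@[simp] theorem formB_incl (a : A) : formB R A (incl R a) = 0 := by
  simp [formB]

@[simp] theorem formB_one : formB R A 1 = 0 := by
  rw [← incl_one, formB_incl]

theorem formB_mul_der (w : Forms R A) (a : A) : formB R A (w * der R a) =
    parity R A w * incl R a - incl R a * parity R A w := by
  have h : ∀ x : Forms R A ⊗[R] Forms R A,
      flipMul R A 0 ((projDeg R A 0).lTensor (Forms R A)
        (x * ((1 : Forms R A) ⊗ₜ[R] der R a))) = 0 := by
    intro x
    induction x with
    | zero => simp
    | tmul u v =>
      rw [Algebra.TensorProduct.tmul_mul_tmul, LinearMap.lTensor_tmul, projDeg_zero_mul_der]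
      simp
    | add x y hx hy => rw [add_mul, map_add, map_add, hx, hy, add_zero]
  rw [formB, LinearMap.neg_apply, LinearMap.comp_apply, LinearMap.comp_apply,
    doubleContraction_mul, map_add, map_add, h, zero_add, doubleContraction_der, mul_sub,
    Algebra.TensorProduct.tmul_mul_tmul, Algebra.TensorProduct.tmul_mul_tmul, map_sub,
    LinearMap.lTensor_tmul, LinearMap.lTensor_tmul, one_mul, one_mul, mul_one,
    projDeg_self (incl_mem_formsDeg a), projDeg_self one_mem_formsDeg, map_sub, flipMul_tmul,
    flipMul_tmul]
  simp

theorem formB_formB (w : Forms R A) : formB R A (formB R A w) = 0 := by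
  induction w using Forms.right_induction with
  | hincl a => simp
  | mul_der w a =>
    induction w using Forms.right_induction with
    | hincl c => rw [formB_mul_der, parity_incl, ← incl_mul, ← incl_mul, ← map_sub, formB_incl]
    | mul_der u c =>
      have h : parity R A (u * der R c) * incl R a - incl R a * parity R A (u * der R c) =
          -(parity R A u * der R (c * a)) + parity R A u * incl R c * der R a +
            incl R a * parity R A u * der R c := by
        rw [map_mul, parity_der, der_mul]; noncomm_ring
      rw [formB_mul_der, h, map_add, map_add, map_neg, formB_mul_der, formB_mul_der,
        formB_mul_der]
      simp only [map_mul, parity_parity, parity_incl, incl_mul]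
      noncomm_ring
    | add x y hx hy => rw [add_mul, map_add, map_add, hx, hy, add_zero]
  | add x y hx hy => rw [map_add, map_add, hx, hy, add_zero]

theorem formB_mul_formB : formB R A * formB R A = 0 := LinearMap.ext formB_formB

theorem deRham_mul_deRham : (deRham R A * deRham R A : Module.End R (Forms R A)) = 0 :=
  LinearMap.ext deRham_deRham

theorem formB_deRham_add (w : Forms R A) :
    formB R A (deRham R A w) + deRham R A (formB R A w) = w - karoubi R A w := by
  simp [karoubi]

theorem commute_karoubi_formB : Commute (karoubi R A) (formB R A) := by
  have h := formB_mul_formB (R := R) (A := A)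
  simp only [commute_iff_eq, karoubi, sub_mul, mul_sub, add_mul, mul_add, one_mul, mul_one]
  rw [mul_assoc (deRham R A), h, mul_zero, ← mul_assoc (formB R A) (formB R A), h, zero_mul,
    add_zero, zero_add, mul_assoc]

theorem commute_karoubi_deRham : Commute (karoubi R A) (deRham R A) := by
  have h := deRham_mul_deRham (R := R) (A := A)
  simp only [commute_iff_eq, karoubi, sub_mul, mul_sub, add_mul, mul_add, one_mul, mul_one]
  rw [mul_assoc (formB R A), h, mul_zero, ← mul_assoc (deRham R A) (deRham R A), h, zero_mul,
    add_zero, zero_add, mul_assoc]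

theorem karoubi_mul_der (w : Forms R A) (a : A) :
    karoubi R A (w * der R a) = der R a * parity R A w := by
  have h := formB_deRham_add (w * der R a)
  rw [deRham_mul_der, formB_mul_der, formB_mul_der, map_sub, deRham_mul, deRham_mul,
    parity_deRham, parity_parity, deRham_incl, parity_incl] at h
  rw [← sub_sub_cancel (w * der R a) (karoubi R A _), ← h]
  noncomm_ring

theorem formB_mem_formsDeg {n : ℕ} {w : Forms R A} (hw : w ∈ formsDeg R A (n + 1)) :
    formB R A w ∈ formsDeg R A n := by
  induction hw using formsDeg_induction with
  | word a l h =>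
    obtain ⟨l, c, rfl⟩ : ∃ l' c, l = l' ++ [c] := by
      rcases List.eq_nil_or_concat l with rfl | ⟨l, b, rfl⟩
      · simp at h
      · exact ⟨l, b, List.concat_eq_append⟩
    rw [List.length_append, List.length_singleton, Nat.add_right_cancel_iff] at h
    have hm := word_mem_formsDeg (R := R) a l
    rw [h] at hm
    rw [derProd_append, derProd_cons, derProd_nil, mul_one, ← mul_assoc, formB_mul_der,
      parity_of_mem hm]
    have hc := incl_mem_formsDeg (R := R) c
    rw [smul_mul_assoc, mul_smul_comm]
    refine sub_mem (zsmul_mem ?_ _) (zsmul_mem ?_ _)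
    · have h' := mul_mem_formsDeg hm hc
      rwa [add_zero] at h'
    · have h' := mul_mem_formsDeg hc hm
      rwa [zero_add] at h'
  | add x y _ _ hx hy => rw [map_add]; exact add_mem hx hy

theorem formB_of_mem_zero {w : Forms R A} (hw : w ∈ formsDeg R A 0) : formB R A w = 0 := by
  obtain ⟨a, rfl⟩ := formsDeg_zero hw
  exact formB_incl a

theorem karoubi_mem_formsDeg {n : ℕ} {w : Forms R A} (hw : w ∈ formsDeg R A n) :
    karoubi R A w ∈ formsDeg R A n := by
  rw [← sub_sub_cancel w (karoubi R A w), ← formB_deRham_add]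
  refine sub_mem hw (add_mem (formB_mem_formsDeg (deRham_mem_formsDeg hw)) ?_)
  cases n with
  | zero => rw [formB_of_mem_zero hw, map_zero]; exact zero_mem _
  | succ n => exact deRham_mem_formsDeg (formB_mem_formsDeg hw)

theorem karoubi_pow_mem_formsDeg {n : ℕ} {w : Forms R A} (hw : w ∈ formsDeg R A n) (m : ℕ) :
    (karoubi R A ^ m) w ∈ formsDeg R A n := by
  induction m with
  | zero => exact hw
  | succ m ih => rw [pow_succ']; exact karoubi_mem_formsDeg ih

theorem karoubiSum_mem_formsDeg {n : ℕ} {w : Forms R A} (hw : w ∈ formsDeg R A n) (m : ℕ) :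
    karoubiSum R A m w ∈ formsDeg R A n := by
  rw [karoubiSum, LinearMap.sum_apply]
  exact sum_mem fun j _ => karoubi_pow_mem_formsDeg hw j

theorem commute_karoubiSum_formB (n : ℕ) : Commute (karoubiSum R A n) (formB R A) :=
  Commute.sum_left _ _ _ fun _ _ => commute_karoubi_formB.pow_left _

theorem commute_karoubiSum_deRham (n : ℕ) : Commute (karoubiSum R A n) (deRham R A) :=
  Commute.sum_left _ _ _ fun _ _ => commute_karoubi_deRham.pow_left _

/-- Powers of the Karoubi operator rotate words. The exponent stands for `m (q + m - 1)`. -/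
theorem karoubi_pow_mul_derProd {q : ℕ} {w : Forms R A} (hw : w ∈ formsDeg R A q) (l : List A) :
    (karoubi R A ^ l.length) (w * derProd R l) =
      (-1 : ℤ) ^ (l.length * (q + l.length + 1)) • (derProd R l * w) := by
  induction l generalizing q w with
  | nil => simp
  | cons a l ih =>
    have hw' := mul_mem_formsDeg hw (der_mem_formsDeg (R := R) a)
    rw [derProd_cons, ← mul_assoc, List.length_cons, pow_succ', Module.End.mul_apply, ih hw',
      map_zsmul, ← mul_assoc, karoubi_mul_der, map_mul, parity_of_mem hw,
      parity_of_mem (derProd_mem_formsDeg l), smul_mul_smul_comm, mul_smul_comm, smul_smul,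
      mul_assoc, ← pow_add, ← pow_add]
    congr 1
    rw [neg_one_pow_congr]
    simp only [parity_simps]
    tauto

theorem karoubi_pow_of_mem {n : ℕ} {w : Forms R A} (hw : w ∈ formsDeg R A n) :
    (karoubi R A ^ n) w = w + formB R A ((karoubi R A ^ n) (deRham R A w)) := by
  induction hw using formsDeg_induction with
  | word a l h =>
    subst h
    have h1 := karoubi_pow_mul_derProd (incl_mem_formsDeg (R := R) a) l
    have h2 := karoubi_pow_mul_derProd (der_mem_formsDeg (R := R) a) l
    have e1 : Even (l.length * (0 + l.length + 1)) := by
      simp only [parity_simps]; tauto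
    rw [e1.neg_one_pow, one_smul] at h1
    rw [deRham_word, derProd_cons, h1, h2, map_zsmul, formB_mul_der,
      parity_of_mem (derProd_mem_formsDeg l), smul_mul_assoc, mul_smul_comm, ← smul_sub,
      smul_smul, ← pow_add]
    have e2 : Even (l.length * (1 + l.length + 1) + l.length) := by
      simp only [parity_simps]; tauto
    rw [e2.neg_one_pow, one_smul, add_sub_cancel]
  | add x y _ _ hx hy => simp only [map_add, hx, hy]; abel

theorem karoubi_pow_deRham {n : ℕ} {w : Forms R A} (hw : w ∈ formsDeg R A n) :
    (karoubi R A ^ (n + 1)) (deRham R A w) = deRham R A w := by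
  induction hw using formsDeg_induction with
  | word a l h =>
    subst h
    have h1 := karoubi_pow_mul_derProd (one_mem_formsDeg (R := R) (A := A)) (a :: l)
    have e1 : Even ((a :: l).length * (0 + (a :: l).length + 1)) := by
      simp only [parity_simps]; tauto
    rw [e1.neg_one_pow, one_smul, one_mul, mul_one] at h1
    rw [deRham_word]
    exact h1
  | add x y _ _ hx hy => simp only [map_add, hx, hy]

theorem karoubi_pow_formB {n : ℕ} {w : Forms R A} (hw : w ∈ formsDeg R A n) :
    (karoubi R A ^ n) (formB R A w) = formB R A w := by
  have h := congrArg (formB R A) (karoubi_pow_of_mem hw)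
  rw [map_add, formB_formB, add_zero] at h
  exact (LinearMap.congr_fun (commute_karoubi_formB.pow_left n).eq w).trans h

theorem sub_karoubi_karoubiSum (n : ℕ) (w : Forms R A) :
    karoubiSum R A n w - karoubi R A (karoubiSum R A n w) = w - (karoubi R A ^ n) w := by
  have h := LinearMap.congr_fun (mul_neg_geom_sum (karoubi R A) n) w
  simpa [sub_mul, karoubiSum] using h

end Karoubi

/-! ### The reduced contraction through the Karoubi operator -/

section Contraction

variable {R A : Type*} [CommRing R] [Ring A] [Algebra R A]

/-- The reduced contraction of `w da₁ ⋯ daₘ` splits into the part that contracts inside `w` and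
`-b (1 + κ + ⋯ + κᵐ⁻¹)`: each contraction of some `daⱼ` is `b` after a rotation. -/
theorem flipMul_mul_derProd {q : ℕ} {w : Forms R A} (hw : w ∈ formsDeg R A q) (l : List A) :
    redContraction R A (q + l.length) (w * derProd R l) =
      flipMul R A (q + l.length) (doubleContraction R A w * (1 ⊗ₜ[R] derProd R l)) -
        formB R A (karoubiSum R A l.length (w * derProd R l)) := by
  induction l generalizing q w with
  | nil => simp [redContraction_apply, karoubiSum, ← Algebra.TensorProduct.one_def]
  | cons a l ih =>
    have hwa := mul_mem_formsDeg hw (der_mem_formsDeg (R := R) a)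
    have e : q + (a :: l).length = q + 1 + l.length := by rw [List.length_cons]; ring
    have hs : karoubiSum R A (a :: l).length =
        karoubiSum R A l.length + karoubi R A ^ l.length := by
      rw [List.length_cons, karoubiSum, Finset.sum_range_succ, karoubiSum]
    rw [derProd_cons, ← mul_assoc, e, ih hwa, hs, LinearMap.add_apply, map_add,
      ← sub_sub, sub_right_comm, sub_left_inj, karoubi_pow_mul_derProd hwa, ← mul_assoc,
      map_zsmul, formB_mul_der, doubleContraction_mul, add_mul, map_add,
      mul_assoc (doubleContraction R A w), Algebra.TensorProduct.tmul_mul_tmul, one_mul,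
      sub_eq_add_neg, add_right_inj, doubleContraction_der, mul_sub, sub_mul]
    simp only [Algebra.TensorProduct.tmul_mul_tmul, one_mul, mul_one, map_sub]
    have hwi := mul_mem_formsDeg hw (incl_mem_formsDeg (R := R) a)
    rw [parity_of_mem hw, map_mul, parity_of_mem hw, parity_of_mem (derProd_mem_formsDeg l),
      smul_mul_assoc, ← TensorProduct.smul_tmul', ← TensorProduct.smul_tmul', map_zsmul, map_zsmul,
      flipMul_tmul_of_mem _ hw, flipMul_tmul_of_mem _ hwi, add_zero, smul_mul_smul_comm,
      smul_mul_assoc, mul_smul_comm, ← smul_sub, ← smul_sub, ← smul_sub, smul_smul, smul_smul,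
      ← pow_add, ← pow_add, ← pow_add, ← smul_neg, neg_sub]
    simp only [mul_assoc]
    congr 1
    rw [neg_one_pow_congr]
    simp only [parity_simps]
    tauto

/-- On forms of degree `n` the reduced contraction is `- b (1 + κ + ⋯ + κⁿ⁻¹)`. -/
theorem redContraction_of_mem {n : ℕ} {w : Forms R A} (hw : w ∈ formsDeg R A n) :
    redContraction R A n w = -formB R A (karoubiSum R A n w) := by
  induction hw using formsDeg_induction with
  | word a l h =>
    subst h
    have h := flipMul_mul_derProd (incl_mem_formsDeg (R := R) a) l
    rwa [doubleContraction_incl, zero_mul, map_zero, zero_sub, zero_add] at h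
  | add x y _ _ hx hy => simp only [map_add, hx, hy, neg_add]

theorem redContraction_mem_formsDeg {n : ℕ} {w : Forms R A} (hw : w ∈ formsDeg R A (n + 1)) :
    redContraction R A (n + 1) w ∈ formsDeg R A n := by
  rw [redContraction_of_mem hw]
  exact neg_mem (formB_mem_formsDeg (karoubiSum_mem_formsDeg hw _))

theorem redContraction_redContraction {n : ℕ} {w : Forms R A}
    (hw : w ∈ formsDeg R A (n + 2)) :
    redContraction R A (n + 1) (redContraction R A (n + 2) w) = 0 := by
  rw [redContraction_of_mem (redContraction_mem_formsDeg hw), redContraction_of_mem hw]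
  have h := LinearMap.congr_fun (commute_karoubiSum_formB (R := R) (A := A) (n + 1)).eq
  simp only [Module.End.mul_apply] at h
  rw [map_neg, map_neg, h, formB_formB]
  simp

theorem deRham_redContraction_add {n : ℕ} {w : Forms R A} (hw : w ∈ formsDeg R A n) :
    deRham R A (redContraction R A n w) + redContraction R A (n + 1) (deRham R A w) = 0 := by
  rw [redContraction_of_mem hw, redContraction_of_mem (deRham_mem_formsDeg hw)]
  have h1 := formB_deRham_add (karoubiSum R A n w)
  rw [sub_karoubi_karoubiSum, karoubi_pow_of_mem hw] at h1
  have h2 := LinearMap.congr_fun (commute_karoubiSum_deRham (R := R) (A := A) n).eq w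
  simp only [Module.End.mul_apply] at h2
  have h3 : karoubiSum R A (n + 1) = karoubiSum R A n + karoubi R A ^ n := by
    rw [karoubiSum, Finset.sum_range_succ, karoubiSum]
  rw [h3, LinearMap.add_apply, h2, map_add, map_neg, ← neg_add, neg_eq_zero]
  rw [← add_assoc, add_comm (deRham R A _), h1]
  abel

end Contraction

section EquivDiff

variable {R A : Type*} [CommRing R] [Ring A] [Algebra R A]

theorem equivDiff_zero (f : ℕ → Forms R A) :
    equivDiff R A f 0 = redContraction R A 1 (f 1) := by
  simp [equivDiff, total]

theorem equivDiff_succ (f : ℕ → Forms R A) (p : ℕ) : equivDiff R A f (p + 1) =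
    deRham R A (f p) + redContraction R A (p + 2) (f (p + 2)) := by
  simp [equivDiff, total]

theorem equivDiff_equivDiff {f : ℕ → Forms R A} (hf : ∀ p, f p ∈ formsDeg R A p) :
    equivDiff R A (equivDiff R A f) = 0 := by
  funext p
  rcases p with _ | _ | p
  · rw [equivDiff_zero, equivDiff_succ, map_add, redContraction_redContraction (hf 2), add_zero]
    have h := deRham_redContraction_add (hf 0)
    obtain ⟨a, ha⟩ := formsDeg_zero (hf 0)
    rwa [redContraction_apply, ha, doubleContraction_incl, map_zero, map_zero, zero_add,
      ← ha] at h
  · rw [equivDiff_succ, equivDiff_zero, equivDiff_succ, map_add, ← add_assoc,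
      redContraction_redContraction (hf 3), add_zero, deRham_redContraction_add (hf 1)]
    rfl
  · rw [equivDiff_succ, equivDiff_succ, equivDiff_succ, map_add, map_add, deRham_deRham,
      redContraction_redContraction (hf _), zero_add, add_zero, deRham_redContraction_add (hf _)]
    rfl

end EquivDiff

/-! ### Forms as a retract of `A ⊗ T(A / R)` -/

section Model

variable (R A : Type*) [CommRing R] [Ring A] [Algebra R A]

/-- The quotient `A / R`. -/
abbrev BarQuot : Type _ := A ⧸ LinearMap.range (Algebra.linearMap R A)

/-- The module `A ⊗ T(A / R)`, in which `a₀ ⊗ ā₁ ⋯ āₚ` stands for `a₀ da₁ ⋯ daₚ`. -/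
abbrev WordModule : Type _ := A ⊗[R] TensorAlgebra R (BarQuot R A)

/-- The image `ι(ā)` of `a` in the tensor algebra of `A / R`. -/
def barι : A →ₗ[R] TensorAlgebra R (BarQuot R A) :=
  TensorAlgebra.ι R ∘ₗ Submodule.mkQ _

theorem barι_algebraMap (r : R) : barι R A (algebraMap R A r) = 0 := by
  have : (Submodule.mkQ (LinearMap.range (Algebra.linearMap R A))) (algebraMap R A r) = 0 :=
    (Submodule.Quotient.mk_eq_zero _).2 ⟨r, rfl⟩
  rw [barι, LinearMap.comp_apply, this, map_zero]

/-- `a₀ ⊗ t ↦ ā₀ t`. -/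
def wordTail : WordModule R A →ₗ[R] TensorAlgebra R (BarQuot R A) :=
  TensorProduct.lift (LinearMap.mul R _ ∘ₗ barι R A)

theorem wordTail_tmul (a : A) (t : TensorAlgebra R (BarQuot R A)) :
    wordTail R A (a ⊗ₜ t) = barι R A a * t := rfl

/-- The action of forms on `A ⊗ T(A / R)` that corresponds to left multiplication. -/
def wordAction : Forms R A →ₐ[R] Module.End R (WordModule R A) :=
  liftForms R (LinearMap.rTensorHom _ ∘ₗ LinearMap.mul R A)
    (LinearMap.mk₂ R
      (fun (a : A) (z : WordModule R A) => (1 : A) ⊗ₜ[R]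
        wordTail R A ((LinearMap.mul R A a).rTensor _ z) - a ⊗ₜ[R] wordTail R A z)
      (fun a b z => by
        simp only [map_add, LinearMap.rTensor_add, LinearMap.add_apply, TensorProduct.tmul_add,
          TensorProduct.add_tmul]
        abel)
      (fun r a z => by
        simp only [map_smul, LinearMap.rTensor_smul, LinearMap.smul_apply,
          TensorProduct.tmul_smul, ← TensorProduct.smul_tmul', smul_sub])
      (fun a z z' => by
        simp only [map_add, TensorProduct.tmul_add]
        abel)
      (fun r a z => by
        simp only [map_smul, TensorProduct.tmul_smul, smul_sub]))
    (by
      refine LinearMap.ext fun z => ?_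
      change LinearMap.rTensor _ (LinearMap.mul R A 1) z = z
      have : LinearMap.mul R A 1 = LinearMap.id := by ext; simp
      rw [this, LinearMap.rTensor_id, LinearMap.id_apply])
    (fun a b => by
      refine LinearMap.ext fun z => ?_
      change LinearMap.rTensor _ (LinearMap.mul R A (a * b)) z =
        LinearMap.rTensor _ (LinearMap.mul R A a) (LinearMap.rTensor _ (LinearMap.mul R A b) z)
      rw [← LinearMap.comp_apply, ← LinearMap.rTensor_comp]
      congr 2; ext; simp [mul_assoc])
    (fun a b => by
      refine LinearMap.ext fun z => ?_
      change (1 : A) ⊗ₜ[R] wordTail R A ((LinearMap.mul R A (a * b)).rTensor _ z) -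
          (a * b) ⊗ₜ[R] wordTail R A z =
        (LinearMap.mul R A a).rTensor _ ((1 : A) ⊗ₜ[R]
            wordTail R A ((LinearMap.mul R A b).rTensor _ z) - b ⊗ₜ[R] wordTail R A z) +
          ((1 : A) ⊗ₜ[R] wordTail R A ((LinearMap.mul R A a).rTensor _
            ((LinearMap.mul R A b).rTensor _ z)) -
              a ⊗ₜ[R] wordTail R A ((LinearMap.mul R A b).rTensor _ z))
      have : LinearMap.rTensor (TensorAlgebra R (BarQuot R A)) (LinearMap.mul R A (a * b)) z =
        LinearMap.rTensor _ (LinearMap.mul R A a)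
          (LinearMap.rTensor _ (LinearMap.mul R A b) z) := by
        rw [← LinearMap.comp_apply, ← LinearMap.rTensor_comp]
        congr 2; ext; simp [mul_assoc]
      rw [this, map_sub, LinearMap.rTensor_tmul, LinearMap.rTensor_tmul]
      simp only [LinearMap.mul_apply', mul_one]
      abel)

/-- A form as an element of `A ⊗ T(A / R)`. -/
def toWords : Forms R A →ₗ[R] WordModule R A :=
  (LinearMap.applyₗ ((1 : A) ⊗ₜ[R] (1 : TensorAlgebra R (BarQuot R A)))) ∘ₗ
    (wordAction R A).toLinearMap

variable {R A}

theorem toWords_word (a : A) (l : List A) : toWords R A (incl R a * derProd R l) =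
    a ⊗ₜ (l.map (barι R A)).prod := by
  have h : wordAction R A (derProd R l) (1 ⊗ₜ 1) = 1 ⊗ₜ (l.map (barι R A)).prod := by
    induction l with
    | nil => simp
    | cons b l ih =>
      rw [derProd_cons, map_mul, Module.End.mul_apply, ih, wordAction, liftForms_der]
      have h1 := barι_algebraMap R A 1
      rw [map_one] at h1
      simp [wordTail_tmul, h1]
  change wordAction R A _ (1 ⊗ₜ 1) = _
  rw [map_mul, Module.End.mul_apply, h, wordAction, liftForms_incl]
  simp

variable (R A) in
/-- The map `a₀ ⊗ ā₁ ⋯ āₚ ↦ a₀ da₁ ⋯ daₚ`. -/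
def ofWords : WordModule R A →ₗ[R] Forms R A :=
  TensorProduct.lift ((LinearMap.mul R (Forms R A)).compl₁₂ (incl R)
    (TensorAlgebra.lift R ((LinearMap.range (Algebra.linearMap R A)).liftQ (der R) (by
      rintro _ ⟨r, rfl⟩
      exact der_algebraMap r))).toLinearMap)

theorem ofWords_toWords (w : Forms R A) : ofWords R A (toWords R A w) = w := by
  induction w using Forms.word_induction with
  | word a l =>
    rw [toWords_word]
    simp only [ofWords, TensorProduct.lift.tmul, LinearMap.compl₁₂_apply, LinearMap.mul_apply',
      AlgHom.toLinearMap_apply, map_list_prod, List.map_map]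
    congr 2
    refine congrArg (fun f => List.map f l) (funext fun b => ?_)
    simp [barι]
  | add x y hx hy => rw [map_add, map_add, hx, hy]

end Model

section Projective

variable {R A : Type*} [CommRing R] [Ring A] [Algebra R A]

theorem projective_of_barQuot (hinj : Function.Injective (algebraMap R A))
    [Module.Projective R (BarQuot R A)] : Module.Projective R A := by
  obtain ⟨σ, hσ⟩ := Module.projective_lifting_property
    (Submodule.mkQ (LinearMap.range (Algebra.linearMap R A))) LinearMap.id
    (Submodule.mkQ_surjective _)
  let e := LinearEquiv.ofInjective (Algebra.linearMap R A) hinj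
  have hmem : ∀ a : A, (LinearMap.id - σ ∘ₗ Submodule.mkQ _ : A →ₗ[R] A) a ∈
      LinearMap.range (Algebra.linearMap R A) := by
    intro a
    refine (Submodule.Quotient.mk_eq_zero _).1 ?_
    change Submodule.mkQ _ _ = 0
    have := LinearMap.congr_fun hσ (Submodule.mkQ _ a)
    simp only [LinearMap.comp_apply, LinearMap.id_apply] at this
    simp only [LinearMap.sub_apply, LinearMap.id_apply, LinearMap.comp_apply, map_sub]
    rw [this, sub_self]
  refine Module.Projective.of_split (P := A) (M := R × BarQuot R A)
    ((e.symm.toLinearMap ∘ₗ LinearMap.codRestrict _ _ hmem).prod (Submodule.mkQ _))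
    ((Algebra.linearMap R A).coprod σ) (LinearMap.ext fun a => ?_)
  have h : ∀ y, Algebra.linearMap R A (e.symm y) = y := fun y =>
    congrArg Subtype.val (e.apply_symm_apply y)
  change Algebra.linearMap R A (e.symm ⟨_, hmem a⟩) + σ (Submodule.Quotient.mk a) = a
  rw [h]
  simp

theorem projective_forms (hinj : Function.Injective (algebraMap R A))
    [Module.Free R (BarQuot R A)] : Module.Projective R (Forms R A) :=
  have := projective_of_barQuot hinj
  Module.Projective.of_split (toWords R A) (ofWords R A) (LinearMap.ext ofWords_toWords)

end Projective

/-! ### Chains and forms -/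

section ChainsForms

variable {R A : Type*} [CommRing R] [Ring A] [Algebra R A]

theorem chainToForm_tprod {p : ℕ} (a : Fin (p + 1) → A) :
    chainToForm R A p (PiTensorProduct.tprod R a) =
      incl R (a 0) * derProd R (List.ofFn fun i : Fin p => a i.succ) := by
  simp only [chainToForm, PiTensorProduct.lift.tprod, MultilinearMap.compLinearMap_apply,
    MultilinearMap.mkPiAlgebraFin_apply, List.ofFn_succ, List.prod_cons, Fin.cons_zero,
    Fin.cons_succ, derProd, List.map_ofFn]
  rfl

theorem chainToForm_mem {p : ℕ} (c : Chains R A p) : chainToForm R A p c ∈ formsDeg R A p := by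
  induction c using PiTensorProduct.induction_on with
  | smul_tprod r a =>
    rw [map_smul, chainToForm_tprod]
    refine Submodule.smul_mem _ _ ?_
    have := word_mem_formsDeg (R := R) (a 0) (List.ofFn fun i : Fin p => a i.succ)
    rwa [List.length_ofFn] at this
  | add x y hx hy => rw [map_add]; exact add_mem hx hy

theorem exists_chainToForm_eq {p : ℕ} {w : Forms R A} (hw : w ∈ formsDeg R A p) :
    ∃ c, chainToForm R A p c = w := by
  induction hw using formsDeg_induction with
  | word a l h =>
    subst h
    refine ⟨PiTensorProduct.tprod R (Fin.cons a l.get : Fin (l.length + 1) → A), ?_⟩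
    rw [chainToForm_tprod]
    simp
  | add x y _ _ hx hy =>
    obtain ⟨c, rfl⟩ := hx
    obtain ⟨c', rfl⟩ := hy
    exact ⟨c + c', map_add _ _ _⟩

theorem derProd_eq_zero {l : List A} {a : A} (ha : a ∈ l)
    (h : a ∈ Set.range (algebraMap R A)) : derProd R l = 0 := by
  obtain ⟨s, t, rfl⟩ := List.append_of_mem ha
  obtain ⟨r, rfl⟩ := h
  simp [der_algebraMap]

theorem chainToForm_degenerate {p : ℕ} {c : Chains R A p} (hc : c ∈ degenerate R A p) :
    chainToForm R A p c ∈ groundForms R A p := by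
  induction hc using Submodule.span_induction with
  | mem x h =>
    obtain ⟨a, ⟨i, hi, h⟩, rfl⟩ := h
    rw [chainToForm_tprod]
    cases p with
    | zero =>
      obtain rfl : i = 0 := Fin.ext (by omega)
      obtain ⟨r, hr⟩ := h
      rw [← hr, incl_algebraMap]
      simp only [List.ofFn_zero, derProd_nil, mul_one, Algebra.algebraMap_eq_smul_one]
      exact Submodule.smul_mem _ _ (Submodule.mem_span_singleton_self 1)
    | succ p =>
      obtain ⟨j, rfl⟩ := Fin.exists_succ_eq.2 (hi.resolve_right (Nat.succ_ne_zero p))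
      rw [derProd_eq_zero ((List.mem_ofFn' _ _).2 ⟨j, rfl⟩) h, mul_zero]
      exact zero_mem _
  | zero => rw [map_zero]; exact zero_mem _
  | add x y _ _ hx hy => rw [map_add]; exact add_mem hx hy
  | smul r x _ hx => rw [map_smul]; exact Submodule.smul_mem _ _ hx

theorem tprod_sub_tprod_mem_degenerate {p : ℕ} (a a' : Fin (p + 1) → A) (h0 : a' 0 = a 0)
    (h : ∀ i, a i - a' i ∈ Set.range (algebraMap R A)) :
    PiTensorProduct.tprod R a - PiTensorProduct.tprod R a' ∈ degenerate R A p := by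
  have key : ∀ s : Finset (Fin (p + 1)),
      PiTensorProduct.tprod R a - PiTensorProduct.tprod R (s.piecewise a' a) ∈
        degenerate R A p := by
    intro s
    induction s using Finset.induction_on with
    | empty => simp
    | insert j s hj ih =>
      rw [Finset.piecewise_insert]
      by_cases hj0 : j = 0
      · subst hj0
        rwa [h0, show a 0 = s.piecewise a' a 0 by simp [hj], Function.update_eq_self]
      rw [← sub_add_sub_cancel _ (PiTensorProduct.tprod R (s.piecewise a' a))]
      refine add_mem ih ?_
      have e : s.piecewise a' a = Function.update (s.piecewise a' a) j (a j) := by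
        rw [eq_comm, Function.update_eq_self_iff]; simp [hj]
      rw [show PiTensorProduct.tprod R (s.piecewise a' a) = _ from congrArg _ e]
      rw [← MultilinearMap.map_update_sub]
      refine Submodule.subset_span ⟨_, ⟨j, Or.inl hj0, ?_⟩, rfl⟩
      simpa using h j
  simpa using key Finset.univ

/-- The chain `a₀ ⊗ σ(ā₁) ⊗ ⋯ ⊗ σ(āₚ)` attached to a word, for a section `σ` of `A → A / R`. -/
def wordsToChain (σ : BarQuot R A →ₗ[R] A) (p : ℕ) : WordModule R A →ₗ[R] Chains R A p :=
  TensorProduct.lift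
    ((LinearMap.lcomp R (Chains R A p)
      (PiTensorProduct.map (fun _ : Fin p => σ) ∘ₗ
        DirectSum.component R ℕ (fun n => ⨂[R]^n (BarQuot R A)) p ∘ₗ
        (TensorAlgebra.toDirectSum (R := R) (M := BarQuot R A)).toLinearMap)) ∘ₗ
      (PiTensorProduct.lift (R := R) (s := fun _ : Fin p => A)
        (E := Chains R A p)).toLinearMap ∘ₗ
      (PiTensorProduct.tprod R (s := fun _ : Fin (p + 1) => A)).curryLeft)

theorem wordsToChain_chainToForm (σ : BarQuot R A →ₗ[R] A) {p : ℕ} (a : Fin (p + 1) → A) :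
    wordsToChain σ p (toWords R A (chainToForm R A p (PiTensorProduct.tprod R a))) =
      PiTensorProduct.tprod R (Fin.cons (a 0)
        fun i : Fin p => σ (Submodule.Quotient.mk (a i.succ))) := by
  rw [chainToForm_tprod, toWords_word]
  have h : ((List.ofFn fun i : Fin p => a i.succ).map (barι R A)).prod =
      TensorAlgebra.tprod R (BarQuot R A) p
        (fun i => Submodule.Quotient.mk (a i.succ)) := by
    rw [TensorAlgebra.tprod_apply, List.map_ofFn]
    rfl
  rw [h, wordsToChain, TensorProduct.lift.tmul]
  simp only [LinearMap.comp_apply, LinearMap.lcomp_apply, AlgHom.toLinearMap_apply,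
    TensorAlgebra.toDirectSum_tensorPower_tprod, LinearEquiv.coe_coe]
  rw [← DirectSum.apply_eq_component, DirectSum.of_eq_same]
  simp only [PiTensorProduct.map_tprod, PiTensorProduct.lift.tprod]
  rfl

/-- Changing the arguments `a₁, …, aₚ` of a chain by elements of `R` changes it by a degenerate
chain. -/
theorem sub_wordsToChain_mem {σ : BarQuot R A →ₗ[R] A}
    (hσ : ∀ x, (Submodule.Quotient.mk (σ x) : BarQuot R A) = x) {p : ℕ} (c : Chains R A p) :
    c - wordsToChain σ p (toWords R A (chainToForm R A p c)) ∈ degenerate R A p := by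
  induction c using PiTensorProduct.induction_on with
  | smul_tprod r a =>
    simp only [map_smul]
    rw [← smul_sub, wordsToChain_chainToForm]
    refine Submodule.smul_mem _ _ (tprod_sub_tprod_mem_degenerate _ _ rfl fun i => ?_)
    refine Fin.cases ?_ (fun i => ?_) i
    · exact ⟨0, by simp⟩
    · rw [Fin.cons_succ]
      exact (Submodule.Quotient.eq _).1 (hσ _).symm
  | add x y hx hy => simp only [map_add, add_sub_add_comm]; exact add_mem hx hy

/-- A chain is degenerate exactly when its form vanishes in the reduced complex. -/
theorem chainToForm_mem_ground_iff [Module.Projective R (BarQuot R A)] {p : ℕ}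
    (c : Chains R A p) :
    chainToForm R A p c ∈ groundForms R A p ↔ c ∈ degenerate R A p := by
  refine ⟨fun h => ?_, chainToForm_degenerate⟩
  obtain ⟨σ, hσ⟩ := Module.projective_lifting_property
    (Submodule.mkQ (LinearMap.range (Algebra.linearMap R A))) LinearMap.id
    (Submodule.mkQ_surjective _)
  have hσ' : ∀ x, (Submodule.Quotient.mk (σ x) : BarQuot R A) = x := LinearMap.congr_fun hσ
  have key := sub_wordsToChain_mem hσ' c
  cases p with
  | zero =>
    obtain ⟨r, hr⟩ := Submodule.mem_span_singleton.1 h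
    have h1 : chainToForm R A 0 (PiTensorProduct.tprod R fun _ => 1) = 1 := by
      rw [chainToForm_tprod]; simp [incl_one]
    rw [← hr, ← h1, map_smul, map_smul, wordsToChain_chainToForm] at key
    refine (Submodule.sub_mem_iff_left _ (Submodule.smul_mem _ _ ?_)).1 key
    exact Submodule.subset_span ⟨_, ⟨0, Or.inr rfl, 1, by simp⟩, rfl⟩
  | succ p =>
    have h' : chainToForm R A (p + 1) c = 0 := h
    rwa [h', map_zero, map_zero, sub_zero] at key

end ChainsForms

/-! ### The cyclic operators on chains and on forms -/

section CyclicOperators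

variable {R A : Type*} [CommRing R] [Ring A] [Algebra R A]

theorem zsmul_apply {M N : Type*} [AddCommGroup M] [Module R M] [AddCommGroup N] [Module R N]
    (n : ℤ) (f : M →ₗ[R] N) (x : M) : (n • f) x = n • f x := rfl

theorem rotate_tprod {p : ℕ} (a : Fin (p + 1) → A) :
    rotate R A p (PiTensorProduct.tprod R a) =
      PiTensorProduct.tprod R fun i => a ((finRotate (p + 1)).symm i) :=
  PiTensorProduct.reindex_tprod _ _

theorem rotate_symm_tprod {p : ℕ} (a : Fin (p + 1) → A) :
    (rotate R A p).symm (PiTensorProduct.tprod R a) =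
      PiTensorProduct.tprod R fun i => a (finRotate (p + 1) i) := by
  rw [LinearEquiv.symm_apply_eq, rotate_tprod]
  simp

theorem rotate_symm_pow_tprod {p : ℕ} (a : Fin (p + 1) → A) (i : ℕ) :
    ((rotate R A p).symm.toLinearMap ^ i) (PiTensorProduct.tprod R a) =
      PiTensorProduct.tprod R fun l : Fin (p + 1) =>
        a ⟨(l + i) % (p + 1), Nat.mod_lt _ (Nat.succ_pos p)⟩ := by
  induction i with
  | zero =>
    rw [pow_zero, Module.End.one_apply]
    refine congrArg _ (funext fun l => congrArg a (Fin.ext ?_))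
    exact (Nat.mod_eq_of_lt l.2).symm
  | succ i ih =>
    rw [pow_succ', Module.End.mul_apply, ih, LinearEquiv.coe_coe, rotate_symm_tprod]
    refine congrArg _ (funext fun l => congrArg a (Fin.ext ?_))
    simp only [finRotate_apply, Fin.val_add, Fin.val_one', Nat.add_mod_mod, Nat.mod_add_mod]
    rw [add_assoc, add_comm 1 i]

theorem rotate_pow_rotate_symm_pow {p : ℕ} (i : ℕ) (c : Chains R A p) :
    ((rotate R A p).toLinearMap ^ i) (((rotate R A p).symm.toLinearMap ^ i) c) = c := by
  induction i with
  | zero => rfl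
  | succ i ih =>
    rw [pow_succ, pow_succ', Module.End.mul_apply, Module.End.mul_apply]
    simpa using ih

theorem face₀_tprod {p : ℕ} (a : Fin (p + 2) → A) :
    face₀ R A p (PiTensorProduct.tprod R a) =
      PiTensorProduct.tprod R (Fin.cons (a 0 * a 1) fun i : Fin p => a i.succ.succ) := by
  simp only [face₀, PiTensorProduct.lift.tprod]
  rfl

/-- The tuple in which the neighbours `aᵢ`, `aᵢ₊₁` are replaced by their product. -/
def mulNeighbours {p : ℕ} (a : Fin (p + 2) → A) (i : ℕ) (l : Fin (p + 1)) : A :=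
  if (l : ℕ) < i then a l.castSucc
  else if (l : ℕ) = i then a l.castSucc * a l.succ else a l.succ

theorem face_tprod {p i : ℕ} (hi : i ≤ p) (a : Fin (p + 2) → A) :
    face R A p i (PiTensorProduct.tprod R a) = PiTensorProduct.tprod R (mulNeighbours a i) := by
  rw [face, if_pos hi, LinearMap.comp_apply, LinearMap.comp_apply,
    ← rotate_pow_rotate_symm_pow i (PiTensorProduct.tprod R (mulNeighbours a i)),
    rotate_symm_pow_tprod, rotate_symm_pow_tprod, face₀_tprod]
  refine congrArg _ (congrArg _ (funext fun l => ?_))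
  refine Fin.cases ?_ (fun l => ?_) l
  · have h1 : i % (p + 1) = i := Nat.mod_eq_of_lt (by omega)
    have h2 : i % (p + 1 + 1) = i := Nat.mod_eq_of_lt (by omega)
    have h3 : (1 + i) % (p + 1 + 1) = i + 1 := by
      rw [add_comm]; exact Nat.mod_eq_of_lt (by omega)
    simp [mulNeighbours, h1, h2, h3]
  · have hl := l.2
    simp only [Fin.cons_succ, Fin.val_succ]
    by_cases h : (l : ℕ) + 1 + i < p + 1
    · have h1 : ((l : ℕ) + 1 + i) % (p + 1) = l + 1 + i := Nat.mod_eq_of_lt h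
      have h2 : ((l : ℕ) + 1 + 1 + i) % (p + 1 + 1) = l + 1 + i + 1 := by
        rw [Nat.mod_eq_of_lt (by omega)]; ring
      have h3 : ¬ ((l : ℕ) + 1 + i < i) := by omega
      have h4 : ¬ ((l : ℕ) + 1 + i = i) := by omega
      simp only [mulNeighbours, h1, h2, h3, h4, if_false, Fin.succ_mk]
    · have h1 : ((l : ℕ) + 1 + i) % (p + 1) = l + i - p := by
        rw [Nat.mod_eq_sub_mod (by omega), Nat.mod_eq_of_lt (by omega)]; omega
      have h2 : ((l : ℕ) + 1 + 1 + i) % (p + 1 + 1) = l + i - p := by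
        rw [Nat.mod_eq_sub_mod (by omega), Nat.mod_eq_of_lt (by omega)]; omega
      have h3 : (l : ℕ) + i - p < i := by omega
      simp only [mulNeighbours, h1, h2, h3, if_true, Fin.castSucc_mk]

theorem face_last_tprod {p : ℕ} (a : Fin (p + 2) → A) :
    face R A p (p + 1) (PiTensorProduct.tprod R a) =
      PiTensorProduct.tprod R (Fin.cons (a (Fin.last _) * a 0)
        fun i : Fin p => a i.succ.castSucc) := by
  rw [face, if_neg (by omega), LinearMap.comp_apply, LinearEquiv.coe_coe, rotate_tprod,
    face₀_tprod]
  have h0 : (finRotate (p + 1 + 1)).symm 0 = Fin.last _ := by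
    rw [Equiv.symm_apply_eq]; simp
  have hs : ∀ i : Fin (p + 1), (finRotate (p + 1 + 1)).symm i.succ = i.castSucc := by
    intro i
    rw [Equiv.symm_apply_eq]; simp
  rw [h0]
  have h1 : (1 : Fin (p + 2)) = Fin.succ 0 := rfl
  rw [h1, hs]
  simp only [hs]
  rfl

theorem ofFn_mulNeighbours_succ {p : ℕ} (a : Fin (p + 3) → A) (i : ℕ) :
    List.ofFn (mulNeighbours a (i + 1)) =
      a 0 :: List.ofFn (mulNeighbours (fun l => a l.succ) i) := by
  rw [List.ofFn_succ]
  simp [mulNeighbours]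

theorem ofFn_mulNeighbours_zero {p : ℕ} (a : Fin (p + 2) → A) :
    List.ofFn (mulNeighbours a 0) = (a 0 * a 1) :: List.ofFn fun l : Fin p => a l.succ.succ := by
  rw [List.ofFn_succ]
  simp [mulNeighbours]

theorem sum_derProd_mulNeighbours {p : ℕ} (a : Fin (p + 2) → A) :
    ∑ i ∈ Finset.range (p + 1), (-1 : ℤ) ^ i • derProd R (List.ofFn (mulNeighbours a i)) =
      incl R (a 0) * derProd R (List.ofFn fun i => a i.succ) +
        (-1 : ℤ) ^ p • (derProd R (List.ofFn fun i : Fin (p + 1) => a i.castSucc) *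
          incl R (a (Fin.last _))) := by
  induction p with
  | zero =>
    rw [show Finset.range (0 + 1) = {0} from rfl, Finset.sum_singleton, pow_zero, one_smul,
      one_smul, ofFn_mulNeighbours_zero]
    simp [der_mul]
  | succ p ih =>
    rw [Finset.sum_range_succ']
    simp only [ofFn_mulNeighbours_succ, derProd_cons, pow_succ', neg_mul, one_mul, neg_smul,
      Finset.sum_neg_distrib, ← mul_smul_comm, ← Finset.mul_sum]
    rw [ih, ofFn_mulNeighbours_zero, List.ofFn_succ (f := fun i : Fin (p + 2) => a i.succ),
      List.ofFn_succ (f := fun i : Fin (p + 2) => a i.castSucc)]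
    simp only [derProd_cons, pow_zero, one_smul, der_mul, Fin.succ_zero_eq_one, Fin.castSucc_zero,
      Fin.succ_last, Fin.castSucc_succ]
    noncomm_ring

theorem chainToForm_hochschildB {p : ℕ} (c : Chains R A (p + 1)) :
    chainToForm R A p (hochschildB R A p c) = formB R A (chainToForm R A (p + 1) c) := by
  induction c using PiTensorProduct.induction_on with
  | smul_tprod r a =>
    simp only [map_smul]
    congr 1
    have hw : incl R (a 0) * derProd R (List.ofFn fun i : Fin p => a i.succ.castSucc) ∈
        formsDeg R A p := by
      have := word_mem_formsDeg (R := R) (a 0) (List.ofFn fun i : Fin p => a i.succ.castSucc)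
      rwa [List.length_ofFn] at this
    have hR : chainToForm R A (p + 1) (PiTensorProduct.tprod R a) =
        incl R (a 0) * derProd R (List.ofFn fun i : Fin p => a i.succ.castSucc) *
          der R (a (Fin.last _)) := by
      rw [chainToForm_tprod, List.ofFn_succ', List.concat_eq_append, derProd_append,
        derProd_cons, derProd_nil, mul_one, mul_assoc]
      rfl
    rw [hR, formB_mul_der, parity_of_mem hw, hochschildB, LinearMap.sum_apply,
      Finset.sum_range_succ, map_add, map_sum]
    have h1 : ∑ i ∈ Finset.range (p + 1), chainToForm R A p
        (((-1 : ℤ) ^ i • face R A p i) (PiTensorProduct.tprod R a)) =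
        ∑ i ∈ Finset.range (p + 1), (-1 : ℤ) ^ i • (incl R (mulNeighbours a i 0) *
          derProd R (List.ofFn fun l : Fin p => mulNeighbours a i l.succ)) := by
      refine Finset.sum_congr rfl fun i hi => ?_
      rw [zsmul_apply, map_zsmul,
        face_tprod (Nat.lt_succ_iff.1 (Finset.mem_range.1 hi)), chainToForm_tprod]
    rw [h1, zsmul_apply, map_zsmul, face_last_tprod, chainToForm_tprod]
    simp only [Fin.cons_zero, Fin.cons_succ, incl_mul]
    have h2 : ∑ i ∈ Finset.range (p + 1), (-1 : ℤ) ^ i • (incl R (mulNeighbours a i 0) *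
          derProd R (List.ofFn fun l : Fin p => mulNeighbours a i l.succ)) =
        (-1 : ℤ) ^ p • (incl R (a 0) * derProd R (List.ofFn fun i : Fin p => a i.succ.castSucc) *
          incl R (a (Fin.last _))) := by
      cases p with
      | zero => simp [mulNeighbours, incl_mul]
      | succ p =>
        rw [Finset.sum_range_succ']
        have h3 := sum_derProd_mulNeighbours (R := R) fun l : Fin (p + 2) => a l.succ
        simp only [Fin.succ_zero_eq_one, Fin.succ_last] at h3
        have h4 : ∀ i, List.ofFn (fun l : Fin (p + 1) => mulNeighbours a (i + 1) l.succ) =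
            List.ofFn (mulNeighbours (fun l => a l.succ) i) := by
          intro i; simp [mulNeighbours]
        have h5 : ∀ i, mulNeighbours a (i + 1) 0 = a 0 := by
          intro i; simp [mulNeighbours]
        simp only [h4, h5, pow_succ', neg_mul, one_mul, neg_smul,
          Finset.sum_neg_distrib, ← mul_smul_comm, ← Finset.mul_sum]
        rw [h3]
        simp only [mulNeighbours, Fin.val_zero, lt_self_iff_false, if_false, if_true,
          Fin.castSucc_zero, Fin.succ_zero_eq_one, Fin.val_succ, Nat.not_lt_zero,
          Nat.succ_ne_zero, incl_mul, pow_zero, one_smul, Fin.castSucc_succ]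
        noncomm_ring
    rw [h2, pow_succ', neg_mul, one_mul, neg_smul, smul_mul_assoc, mul_smul_comm, mul_assoc]
    simp only [mul_assoc]
    rw [sub_eq_add_neg]
  | add x y hx hy => simp only [map_add, hx, hy]

theorem chainToForm_insertOne {p : ℕ} (c : Chains R A p) :
    chainToForm R A (p + 1) (insertOne R A p c) = deRham R A (chainToForm R A p c) := by
  induction c using PiTensorProduct.induction_on with
  | smul_tprod r a =>
    simp only [map_smul]
    congr 1
    have h : insertOne R A p (PiTensorProduct.tprod R a) =
        PiTensorProduct.tprod R (Fin.cons 1 a : Fin (p + 2) → A) := by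
      simp only [insertOne, PiTensorProduct.lift.tprod]
      rfl
    rw [h, chainToForm_tprod, chainToForm_tprod, deRham_word]
    simp [incl_one]
  | add x y hx hy => simp only [map_add, hx, hy]

theorem karoubi_deRham_rotate_symm {p : ℕ} (c : Chains R A p) :
    karoubi R A (deRham R A (chainToForm R A p ((rotate R A p).symm c))) =
      (-1 : ℤ) ^ p • deRham R A (chainToForm R A p c) := by
  induction c using PiTensorProduct.induction_on with
  | smul_tprod r a =>
    simp only [map_smul]
    rw [smul_comm]
    congr 1
    have h : ∀ b : Fin (p + 1) → A,
        deRham R A (chainToForm R A p (PiTensorProduct.tprod R b)) =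
          derProd R (List.ofFn b) := by
      intro b
      rw [chainToForm_tprod, deRham_word, List.ofFn_succ]
    have hl : finRotate (p + 1) (Fin.last p) = 0 := by simp
    have hc : ∀ i : Fin p, finRotate (p + 1) i.castSucc = i.succ := fun i => by simp
    rw [rotate_symm_tprod, h, h, List.ofFn_succ', List.concat_eq_append, derProd_append,
      derProd_cons, derProd_nil, mul_one, karoubi_mul_der,
      parity_of_mem (derProd_mem_formsDeg _), List.length_ofFn, mul_smul_comm, List.ofFn_succ,
      derProd_cons, hl]
    rw [show (fun i : Fin p => a (finRotate (p + 1) i.castSucc)) = fun i => a i.succ from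
      funext fun i => congrArg a (hc i)]
  | add x y hx hy => simp only [map_add, hx, hy, smul_add]

theorem chainToForm_connesB {p : ℕ} (c : Chains R A p) :
    chainToForm R A (p + 1) (connesB R A p c) =
      karoubiSum R A (p + 1) (deRham R A (chainToForm R A p c)) := by
  set w := deRham R A (chainToForm R A p c) with hw
  have hper : ∀ c' : Chains R A p, (karoubi R A ^ (p + 1)) (deRham R A (chainToForm R A p c')) =
      deRham R A (chainToForm R A p c') := fun c' => karoubi_pow_deRham (chainToForm_mem c')
  have hrot : ∀ i, (karoubi R A ^ i) ((-1 : ℤ) ^ (p * i) • deRham R A (chainToForm R A p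
      (((rotate R A p).symm.toLinearMap ^ i) c))) = w := by
    intro i
    induction i with
    | zero => simp [hw]
    | succ i ih =>
      rw [pow_succ, Module.End.mul_apply, map_zsmul, pow_succ', Module.End.mul_apply,
        LinearEquiv.coe_coe, karoubi_deRham_rotate_symm, smul_smul, ← pow_add]
      have : (-1 : ℤ) ^ (p * (i + 1) + p) = (-1 : ℤ) ^ (p * i) := by
        rw [neg_one_pow_congr]; simp only [parity_simps]; tauto
      rw [this, ih]
  have hterm : ∀ i ∈ Finset.range (p + 1), (-1 : ℤ) ^ (p * i) • deRham R A (chainToForm R A p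
      (((rotate R A p).symm.toLinearMap ^ i) c)) = (karoubi R A ^ (p + 1 - 1 - i + 1)) w := by
    intro i hi
    have hi' := Finset.mem_range.1 hi
    rw [← hrot i, ← Module.End.mul_apply, ← pow_add,
      show p + 1 - 1 - i + 1 + i = p + 1 by omega, map_zsmul, hper]
  have hsum : chainToForm R A (p + 1) (connesB R A p c) =
      ∑ i ∈ Finset.range (p + 1), (-1 : ℤ) ^ (p * i) • deRham R A (chainToForm R A p
        (((rotate R A p).symm.toLinearMap ^ i) c)) := by
    rw [connesB, LinearMap.comp_apply, chainToForm_insertOne, LinearMap.sum_apply, map_sum,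
      map_sum]
    refine Finset.sum_congr rfl fun i _ => ?_
    rw [zsmul_apply, map_zsmul, map_zsmul]
  rw [hsum, Finset.sum_congr rfl hterm,
    Finset.sum_range_reflect (fun j => (karoubi R A ^ (j + 1)) w), karoubiSum,
    LinearMap.sum_apply, Finset.sum_range_succ, Finset.sum_range_succ', hper, pow_zero,
    Module.End.one_apply]

end CyclicOperators

/-! ### Maps between homologies of periodic complexes -/

section PeriodicMaps

variable {R : Type*} [CommRing R] {M : ℕ → Type*} [∀ p, AddCommGroup (M p)] [∀ p, Module R (M p)]
  {M' : ℕ → Type*} [∀ p, AddCommGroup (M' p)] [∀ p, Module R (M' p)]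

theorem mem_families_iff {G : ∀ p, Submodule R (M p)} {n : ℤ} {f : ∀ p, M p} :
    f ∈ families G n ↔ ∀ p : ℕ, 
      (Even (n - (p : ℤ)) → f p ∈ G p) ∧ (¬Even (n - (p : ℤ)) → f p = 0) := by
  rw [families, Submodule.mem_pi]
  refine forall_congr' fun p => ?_
  by_cases h : Even (n - (p : ℤ)) <;> simp [h]

theorem mem_of_mem_families {G : ∀ p, Submodule R (M p)} {n : ℤ} {f : ∀ p, M p}
    (hf : f ∈ families G n) (p : ℕ) : f p ∈ G p := by
  by_cases h : Even (n - (p : ℤ))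
  · exact (mem_families_iff.1 hf p).1 h
  · rw [(mem_families_iff.1 hf p).2 h]; exact zero_mem _

theorem families_mono {G G' : ∀ p, Submodule R (M p)} {n : ℤ} {f : ∀ p, M p}
    (hf : f ∈ families G n) (h : ∀ p, f p ∈ G' p) : f ∈ families G' n :=
  mem_families_iff.2 fun p => ⟨fun _ => h p, (mem_families_iff.1 hf p).2⟩

/-- A degreewise map sends families to families. -/
theorem map_mem_families {G : ∀ p, Submodule R (M p)} {G' : ∀ p, Submodule R (M' p)} {n : ℤ}
    {f : ∀ p, M p} (hf : f ∈ families G n) {g : ∀ p, M' p} (h0 : ∀ p, f p = 0 → g p = 0)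
    (h : ∀ p, f p ∈ G p → g p ∈ G' p) : g ∈ families G' n :=
  mem_families_iff.2 fun p =>
    ⟨fun hp => h p ((mem_families_iff.1 hf p).1 hp), fun hp => h0 p ((mem_families_iff.1 hf p).2 hp)⟩

theorem even_sub_succ {n : ℤ} {p : ℕ} : Even (n - ((p + 1 : ℕ) : ℤ)) ↔ ¬Even (n - (p : ℤ)) := by
  push_cast
  simp only [parity_simps]
  tauto

theorem even_succ_sub {n : ℤ} {p : ℕ} : Even (n + 1 - (p : ℤ)) ↔ ¬Even (n - (p : ℤ)) := by
  simp only [parity_simps]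
  tauto

@[simp] theorem total_zero (u : ∀ p, M p →ₗ[R] M (p + 1)) (v : ∀ p, M (p + 1) →ₗ[R] M p)
    (f : ∀ p, M p) : total u v f 0 = v 0 (f 1) := by
  simp [total]

@[simp] theorem total_succ (u : ∀ p, M p →ₗ[R] M (p + 1)) (v : ∀ p, M (p + 1) →ₗ[R] M p)
    (f : ∀ p, M p) (p : ℕ) : total u v f (p + 1) = u p (f p) + v (p + 1) (f (p + 2)) := by
  simp [total]

theorem total_eq_zero {u : ∀ p, M p →ₗ[R] M (p + 1)} {v : ∀ p, M (p + 1) →ₗ[R] M p}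
    {G : ∀ p, Submodule R (M p)} {n : ℤ} {f : ∀ p, M p} (hf : f ∈ families G (n + 1)) (p : ℕ)
    (hp : ¬Even (n - (p : ℤ))) : total u v f p = 0 := by
  have h1 : f (p + 1) = 0 := (mem_families_iff.1 hf (p + 1)).2 fun h => by
    rw [even_succ_sub, even_sub_succ] at h; tauto
  cases p with
  | zero => rw [total_zero, h1, map_zero]
  | succ p =>
    have h2 : f p = 0 := (mem_families_iff.1 hf p).2 fun h => by
      rw [even_succ_sub] at h; rw [even_sub_succ] at hp; tauto
    rw [total_succ, h1, h2, map_zero, map_zero, add_zero]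

theorem total_mem_families {u : ∀ p, M p →ₗ[R] M (p + 1)} {v : ∀ p, M (p + 1) →ₗ[R] M p}
    {G G' : ∀ p, Submodule R (M p)} {n : ℤ} {f : ∀ p, M p} (hf : f ∈ families G (n + 1))
    (h : ∀ p, total u v f p ∈ G' p) : total u v f ∈ families G' n :=
  mem_families_iff.2 fun p => ⟨fun _ => h p, total_eq_zero hf p⟩

variable {G N : ∀ p, Submodule R (M p)} {D : (∀ p, M p) →ₗ[R] (∀ p, M p)} {n : ℤ}
  {G' N' : ∀ p, Submodule R (M' p)} {D' : (∀ p, M' p) →ₗ[R] (∀ p, M' p)}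

theorem mem_cycles_iff {f : ∀ p, M p} :
    f ∈ cycles G N D n ↔ f ∈ families G n ∧ ∀ p, D f p ∈ N p := by
  simp [cycles, Submodule.mem_pi]

theorem mem_boundaries_iff {f : ∀ p, M p} : f ∈ boundaries G N D n ↔
    ∃ h ∈ families G (n + 1), ∃ z ∈ families (fun p => G p ⊓ N p) n, D h + z = f := by
  simp only [boundaries, Submodule.mem_sup, Submodule.mem_map, exists_exists_and_eq_and]

theorem PerHomology.ind {P : PerHomology G N D n → Prop}
    (h : ∀ f hf, P (PerHomology.mk f hf)) (x : PerHomology G N D n) : P x := by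
  obtain ⟨⟨f, hf⟩, rfl⟩ := Submodule.Quotient.mk_surjective _ x
  exact h f hf

theorem PerHomology.mk_eq_iff {f g : ∀ p, M p} (hf : f ∈ cycles G N D n)
    (hg : g ∈ cycles G N D n) :
    (PerHomology.mk f hf : PerHomology G N D n) = PerHomology.mk g hg ↔
      f - g ∈ boundaries G N D n :=
  Submodule.Quotient.eq _

theorem PerHomology.mk_eq_zero_iff {f : ∀ p, M p} (hf : f ∈ cycles G N D n) :
    (PerHomology.mk f hf : PerHomology G N D n) = 0 ↔ f ∈ boundaries G N D n :=
  Submodule.Quotient.mk_eq_zero _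

theorem PerHomology.mk_add {f g : ∀ p, M p} (hf : f ∈ cycles G N D n)
    (hg : g ∈ cycles G N D n) : (PerHomology.mk (f + g) (add_mem hf hg) : PerHomology G N D n) =
      PerHomology.mk f hf + PerHomology.mk g hg := rfl

theorem PerHomology.mk_smul {f : ∀ p, M p} (hf : f ∈ cycles G N D n) (r : R) :
    (PerHomology.mk (r • f) (Submodule.smul_mem _ r hf) : PerHomology G N D n) =
      r • PerHomology.mk f hf := rfl

theorem PerHomology.mk_sub {f g : ∀ p, M p} (hf : f ∈ cycles G N D n)
    (hg : g ∈ cycles G N D n) : (PerHomology.mk (f - g) (sub_mem hf hg) : PerHomology G N D n) =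
      PerHomology.mk f hf - PerHomology.mk g hg := rfl

theorem PerHomology.mk_congr {f g : ∀ p, M p} (h : f = g) (hf : f ∈ cycles G N D n)
    (hg : g ∈ cycles G N D n) :
    (PerHomology.mk f hf : PerHomology G N D n) = PerHomology.mk g hg := by
  subst h; rfl

/-- The map on homology induced by a map that preserves cycles and boundaries. -/
def PerHomology.map (F : (∀ p, M p) →ₗ[R] (∀ p, M' p))
    (hc : ∀ f ∈ cycles G N D n, F f ∈ cycles G' N' D' n)
    (hb : ∀ f ∈ boundaries G N D n, F f ∈ boundaries G' N' D' n) :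
    PerHomology G N D n →ₗ[R] PerHomology G' N' D' n :=
  Submodule.mapQ _ _ (F.restrict hc) fun f hf => hb f.1 hf

theorem PerHomology.map_mk (F : (∀ p, M p) →ₗ[R] (∀ p, M' p))
    (hc : ∀ f ∈ cycles G N D n, F f ∈ cycles G' N' D' n)
    (hb : ∀ f ∈ boundaries G N D n, F f ∈ boundaries G' N' D' n) (f : ∀ p, M p)
    (hf : f ∈ cycles G N D n) :
    PerHomology.map F hc hb (PerHomology.mk f hf) = PerHomology.mk (F f) (hc f hf) := rfl

end PeriodicMaps

/-! ### Harmonic projection -/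

section Harmonic

variable (k R A : Type*) [Field k] [CommRing R] [Algebra k R] [Ring A] [Algebra R A]

/-- The inverse of a positive integer in a `k`-algebra. -/
def natInv (n : ℕ) : R := algebraMap k R (n : k)⁻¹

/-- The average `(1 + κ + ⋯ + κⁿ⁻¹) / n`. -/
def karoubiMean (n : ℕ) : Module.End R (Forms R A) := natInv k R n • karoubiSum R A n

/-- The polynomial `g` in `κ` with `(1 - κ) g = 1 - (1 + κ + ⋯ + κⁿ⁻¹) / n`. -/
def karoubiGreen (n : ℕ) : Module.End R (Forms R A) :=
  natInv k R n • ∑ j ∈ Finset.range n, karoubiSum R A j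

/-- The harmonic operator on forms of degree `n`. It differs from the identity by the commutator
of `d` with the homotopy `g b`. -/
def harmonic (n : ℕ) : Module.End R (Forms R A) :=
  1 - (deRham R A * karoubiGreen k R A n * formB R A +
    karoubiGreen k R A (n + 1) * formB R A * deRham R A)

variable {k R A}

theorem natInv_mul [CharZero k] {n : ℕ} (hn : n ≠ 0) : natInv k R n * n = 1 := by
  rw [natInv, ← map_natCast (algebraMap k R), ← map_mul,
    inv_mul_cancel₀ (Nat.cast_ne_zero.2 hn), map_one]

theorem karoubiSum_apply (n : ℕ) (w : Forms R A) :
    karoubiSum R A n w = ∑ j ∈ Finset.range n, (karoubi R A ^ j) w := by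
  rw [karoubiSum, LinearMap.sum_apply]

theorem karoubiGreen_zero : karoubiGreen k R A 0 = 0 := by
  simp [karoubiGreen]

theorem commute_karoubiMean_formB (n : ℕ) : Commute (karoubiMean k R A n) (formB R A) :=
  (commute_karoubiSum_formB n).smul_left _

theorem commute_karoubiMean_deRham (n : ℕ) : Commute (karoubiMean k R A n) (deRham R A) :=
  (commute_karoubiSum_deRham n).smul_left _

theorem karoubiMean_formB (n : ℕ) (w : Forms R A) :
    karoubiMean k R A n (formB R A w) = formB R A (karoubiMean k R A n w) :=
  LinearMap.congr_fun (commute_karoubiMean_formB n).eq w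

theorem karoubiMean_deRham (n : ℕ) (w : Forms R A) :
    karoubiMean k R A n (deRham R A w) = deRham R A (karoubiMean k R A n w) :=
  LinearMap.congr_fun (commute_karoubiMean_deRham n).eq w

theorem commute_karoubiGreen_formB (n : ℕ) : Commute (karoubiGreen k R A n) (formB R A) :=
  (Commute.sum_left _ _ _ fun j _ => commute_karoubiSum_formB j).smul_left _

theorem commute_karoubiGreen_deRham (n : ℕ) : Commute (karoubiGreen k R A n) (deRham R A) :=
  (Commute.sum_left _ _ _ fun j _ => commute_karoubiSum_deRham j).smul_left _

theorem karoubiSum_eq [CharZero k] {n : ℕ} (hn : n ≠ 0) (w : Forms R A) :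
    karoubiSum R A n w = (n : R) • karoubiMean k R A n w := by
  rw [karoubiMean, LinearMap.smul_apply, smul_smul, mul_comm, natInv_mul hn, one_smul]

theorem karoubiGreen_mul [CharZero k] {n : ℕ} (hn : n ≠ 0) :
    karoubiGreen k R A n * (1 - karoubi R A) = 1 - karoubiMean k R A n := by
  have h : ∀ j, karoubiSum R A j * (1 - karoubi R A) = 1 - karoubi R A ^ j := fun j =>
    geom_sum_mul_neg _ j
  have h1 : natInv k R n • (1 : Module.End R (Forms R A)) * (n : Module.End R (Forms R A)) = 1 := by
    rw [smul_mul_assoc, one_mul, ← Nat.smul_one_eq_cast, ← Nat.cast_smul_eq_nsmul R, smul_smul,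
      natInv_mul hn, one_smul]
  rw [karoubiGreen, smul_mul_assoc, Finset.sum_mul, Finset.sum_congr rfl fun j _ => h j,
    Finset.sum_sub_distrib, smul_sub, karoubiMean, karoubiSum]
  congr 1
  simpa [smul_mul_assoc] using h1

theorem deRham_mul_formB_mul_deRham :
    (deRham R A * formB R A * deRham R A : Module.End R (Forms R A)) =
      (1 - karoubi R A) * deRham R A := by
  rw [karoubi, sub_sub_cancel, add_mul, mul_assoc (formB R A), deRham_mul_deRham, mul_zero,
    zero_add]

theorem formB_mul_deRham_mul_formB :
    (formB R A * deRham R A * formB R A : Module.End R (Forms R A)) =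
      (1 - karoubi R A) * formB R A := by
  rw [karoubi, sub_sub_cancel, add_mul, mul_assoc (deRham R A), formB_mul_formB, mul_zero,
    add_zero]

theorem harmonic_mul_deRham [CharZero k] {n : ℕ} (hn : n ≠ 0) :
    harmonic k R A n * deRham R A = karoubiMean k R A n * deRham R A := by
  rw [harmonic, sub_mul, add_mul, mul_assoc _ (deRham R A) (deRham R A), deRham_mul_deRham,
    mul_zero, add_zero, one_mul, ← (commute_karoubiGreen_deRham n).eq, mul_assoc, mul_assoc,
    ← mul_assoc (deRham R A), deRham_mul_formB_mul_deRham, ← mul_assoc, karoubiGreen_mul hn]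
  rw [sub_mul, one_mul, sub_sub_cancel]

theorem deRham_mul_harmonic [CharZero k] (n : ℕ) :
    deRham R A * harmonic k R A n = karoubiMean k R A (n + 1) * deRham R A := by
  rw [harmonic, mul_sub, mul_add, ← mul_assoc, ← mul_assoc, deRham_mul_deRham, zero_mul, zero_mul,
    zero_add, mul_one, ← mul_assoc, ← mul_assoc, ← (commute_karoubiGreen_deRham (n + 1)).eq,
    mul_assoc, mul_assoc, ← mul_assoc (deRham R A), deRham_mul_formB_mul_deRham, ← mul_assoc,
    karoubiGreen_mul n.succ_ne_zero]
  rw [sub_mul, one_mul, sub_sub_cancel]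

theorem formB_mul_harmonic [CharZero k] {n : ℕ} (hn : n ≠ 0) :
    formB R A * harmonic k R A n = karoubiMean k R A n * formB R A := by
  have h : formB R A * (karoubiGreen k R A (n + 1) * formB R A * deRham R A) = 0 := by
    rw [mul_assoc, ← mul_assoc (formB R A), ← (commute_karoubiGreen_formB (n + 1)).eq,
      mul_assoc, ← mul_assoc (formB R A), formB_mul_formB, zero_mul, mul_zero]
  rw [harmonic, mul_sub, mul_add, h, add_zero, mul_one, ← (commute_karoubiGreen_deRham n).eq,
    ← mul_assoc, ← mul_assoc, ← (commute_karoubiGreen_formB n).eq, mul_assoc, mul_assoc,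
    ← mul_assoc (formB R A), formB_mul_deRham_mul_formB, ← mul_assoc,
    karoubiGreen_mul hn]
  rw [sub_mul, one_mul, sub_sub_cancel]

theorem harmonic_mul_formB [CharZero k] (n : ℕ) :
    harmonic k R A n * formB R A = karoubiMean k R A (n + 1) * formB R A := by
  rw [harmonic, sub_mul, add_mul, mul_assoc _ (formB R A) (formB R A), formB_mul_formB,
    mul_zero, zero_add, one_mul, mul_assoc, mul_assoc, ← mul_assoc (formB R A),
    formB_mul_deRham_mul_formB, ← mul_assoc, karoubiGreen_mul n.succ_ne_zero]
  rw [sub_mul, one_mul, sub_sub_cancel]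

theorem karoubiMean_karoubiMean [CharZero k] {n : ℕ} (hn : n ≠ 0) {w : Forms R A}
    (hw : (karoubi R A ^ n) w = w) :
    karoubiMean k R A n (karoubiMean k R A n w) = karoubiMean k R A n w := by
  have h1 : karoubi R A (karoubiSum R A n w) = karoubiSum R A n w := by
    have h := sub_karoubi_karoubiSum n w
    rw [hw, sub_self, sub_eq_zero] at h
    exact h.symm
  have h2 : ∀ j, (karoubi R A ^ j) (karoubiSum R A n w) = karoubiSum R A n w := by
    intro j
    induction j with
    | zero => rfl
    | succ j ih => rw [pow_succ, Module.End.mul_apply, h1, ih]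
  have h3 : karoubiSum R A n (karoubiSum R A n w) = (n : R) • karoubiSum R A n w := by
    rw [karoubiSum_apply n (karoubiSum R A n w), Finset.sum_congr rfl fun j _ => h2 j,
      Finset.sum_const, Finset.card_range,
      Nat.cast_smul_eq_nsmul]
  simp only [karoubiMean, LinearMap.smul_apply, map_smul]
  rw [h3, smul_smul _ (n : R), natInv_mul hn, one_smul]

theorem karoubiGreen_mem_formsDeg {n : ℕ} {w : Forms R A} (hw : w ∈ formsDeg R A n) (m : ℕ) :
    karoubiGreen k R A m w ∈ formsDeg R A n := by
  rw [karoubiGreen, LinearMap.smul_apply, LinearMap.sum_apply]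
  exact Submodule.smul_mem _ _ (sum_mem fun j _ => karoubiSum_mem_formsDeg hw j)

theorem harmonic_apply (n : ℕ) (w : Forms R A) : harmonic k R A n w =
    w - (deRham R A (karoubiGreen k R A n (formB R A w)) +
      karoubiGreen k R A (n + 1) (formB R A (deRham R A w))) := rfl

theorem harmonic_mem_formsDeg {n : ℕ} {w : Forms R A} (hw : w ∈ formsDeg R A n) :
    harmonic k R A n w ∈ formsDeg R A n := by
  rw [harmonic_apply]
  refine sub_mem hw (add_mem ?_
    (karoubiGreen_mem_formsDeg (formB_mem_formsDeg (deRham_mem_formsDeg hw)) _))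
  cases n with
  | zero => rw [formB_of_mem_zero hw, map_zero, map_zero]; exact zero_mem _
  | succ n => exact deRham_mem_formsDeg (karoubiGreen_mem_formsDeg (formB_mem_formsDeg hw) _)

theorem harmonic_mem_groundForms {p : ℕ} {w : Forms R A} (hw : w ∈ groundForms R A p) :
    harmonic k R A p w ∈ groundForms R A p := by
  cases p with
  | zero =>
    obtain ⟨r, rfl⟩ := Submodule.mem_span_singleton.1 hw
    rw [map_smul, harmonic_apply]
    simpa using hw
  | succ p =>
    obtain rfl : w = 0 := hw
    rw [map_zero]; exact zero_mem _

variable (R A) in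
/-- The differential `B + b` on forms: `B = (1 + κ + ⋯ + κᵖ) d` on forms of degree `p`. -/
def formCyclicDiff : (ℕ → Forms R A) →ₗ[R] (ℕ → Forms R A) :=
  total (M := fun _ => Forms R A) (fun p => karoubiSum R A (p + 1) ∘ₗ deRham R A)
    (fun _ => formB R A)

variable (R A) in
/-- The homology of the reduced complex of forms with the differential `B + b`. -/
abbrev FormCyclicHomology (n : ℤ) : Type _ :=
  PerHomology (M := fun _ => Forms R A) (formsDeg R A) (groundForms R A) (formCyclicDiff R A) n

theorem formCyclicDiff_zero (f : ℕ → Forms R A) : formCyclicDiff R A f 0 = formB R A (f 1) :=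
  total_zero _ _ _

theorem formCyclicDiff_succ (f : ℕ → Forms R A) (p : ℕ) : formCyclicDiff R A f (p + 1) =
    karoubiSum R A (p + 1) (deRham R A (f p)) + formB R A (f (p + 2)) :=
  total_succ _ _ _ _

variable (k R A) in
/-- The harmonic operator followed by multiplication with `s p` in degree `p`. -/
def scaledHarmonic (s : ℕ → R) : (ℕ → Forms R A) →ₗ[R] (ℕ → Forms R A) :=
  LinearMap.pi fun p => s p • harmonic k R A p ∘ₗ LinearMap.proj p

theorem scaledHarmonic_apply (s : ℕ → R) (f : ℕ → Forms R A) (p : ℕ) :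
    scaledHarmonic k R A s f p = s p • harmonic k R A p (f p) := rfl

theorem scaledHarmonic_mem_families (s : ℕ → R) {n : ℤ} {f : ℕ → Forms R A}
    (hf : f ∈ families (M := fun _ => Forms R A) (formsDeg R A) n) :
    scaledHarmonic k R A s f ∈ families (M := fun _ => Forms R A) (formsDeg R A) n := by
  refine map_mem_families hf (fun p h => ?_) fun p h => ?_
  · rw [scaledHarmonic_apply, h, map_zero, smul_zero]
  · exact Submodule.smul_mem _ _ (harmonic_mem_formsDeg h)

variable [CharZero k]

theorem harmonic_deRham {n : ℕ} (w : Forms R A) :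
    harmonic k R A (n + 1) (deRham R A w) = karoubiMean k R A (n + 1) (deRham R A w) := by
  have h := LinearMap.congr_fun (harmonic_mul_deRham (k := k) (R := R) (A := A) (n := n + 1)
    (Nat.succ_ne_zero n)) w
  simpa only [Module.End.mul_apply] using h

theorem deRham_harmonic {n : ℕ} (w : Forms R A) :
    deRham R A (harmonic k R A n w) = karoubiMean k R A (n + 1) (deRham R A w) := by
  have h := LinearMap.congr_fun (deRham_mul_harmonic (k := k) (R := R) (A := A) n) w
  simpa only [Module.End.mul_apply] using h

theorem harmonic_formB {n : ℕ} (w : Forms R A) :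
    harmonic k R A n (formB R A w) = karoubiMean k R A (n + 1) (formB R A w) := by
  have h := LinearMap.congr_fun (harmonic_mul_formB (k := k) (R := R) (A := A) n) w
  simpa only [Module.End.mul_apply] using h

theorem formB_harmonic {n : ℕ} (w : Forms R A) :
    formB R A (harmonic k R A (n + 1) w) = karoubiMean k R A (n + 1) (formB R A w) := by
  have h := LinearMap.congr_fun (formB_mul_harmonic (k := k) (R := R) (A := A) (n := n + 1)
    (Nat.succ_ne_zero n)) w
  simpa only [Module.End.mul_apply] using h

theorem redContraction_eq {n : ℕ} {w : Forms R A} (hw : w ∈ formsDeg R A (n + 1)) :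
    redContraction R A (n + 1) w =
      -(((n + 1 : ℕ) : R) • karoubiMean k R A (n + 1) (formB R A w)) := by
  rw [redContraction_of_mem hw, ← karoubiSum_eq n.succ_ne_zero]
  have h := LinearMap.congr_fun (commute_karoubiSum_formB (R := R) (A := A) (n + 1)).eq w
  simp only [Module.End.mul_apply] at h
  rw [h]

/-- The harmonic operator intertwines `d + t ı_Δ` with `B + b` up to scalars. -/
theorem formCyclicDiff_scaledHarmonic {s s' : ℕ → R}
    (h1 : ∀ p, s (p + 1) = -((p + 1 : ℕ) : R) * s' p)
    (h2 : ∀ p, s' (p + 1) = ((p + 1 : ℕ) : R) * s p) {f : ℕ → Forms R A}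
    (hf : ∀ p, f p ∈ formsDeg R A p) :
    formCyclicDiff R A (scaledHarmonic k R A s f) =
      scaledHarmonic k R A s' (equivDiff R A f) := by
  have hb : ∀ p, formB R A (scaledHarmonic k R A s f (p + 1)) =
      s' p • harmonic k R A p (redContraction R A (p + 1) (f (p + 1))) := by
    intro p
    rw [scaledHarmonic_apply, map_smul, formB_harmonic, redContraction_eq (k := k) (hf (p + 1)),
      map_neg, map_smul, karoubiMean_formB _ (f (p + 1)), harmonic_formB,
      ← karoubiMean_formB, karoubiMean_karoubiMean p.succ_ne_zero (karoubi_pow_formB (hf (p + 1))), h1,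
      smul_neg, smul_smul, neg_mul, neg_smul, mul_comm]
  funext p
  cases p with
  | zero => rw [formCyclicDiff_zero, hb, scaledHarmonic_apply, equivDiff_zero]
  | succ p =>
    rw [formCyclicDiff_succ, hb, scaledHarmonic_apply, scaledHarmonic_apply, equivDiff_succ,
      map_add, smul_add, add_left_inj, map_smul, map_smul, deRham_harmonic,
      karoubiSum_eq (k := k) p.succ_ne_zero,
      karoubiMean_karoubiMean p.succ_ne_zero (karoubi_pow_deRham (hf p)), smul_smul,
      harmonic_deRham, h2, mul_comm]

/-- The harmonic operator intertwines `B + b` with `d + t ı_Δ` up to scalars. -/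
theorem equivDiff_scaledHarmonic {s s' : ℕ → R}
    (h1 : ∀ p, s' p = -((p + 1 : ℕ) : R) * s (p + 1))
    (h2 : ∀ p, s p = ((p + 1 : ℕ) : R) * s' (p + 1)) {f : ℕ → Forms R A}
    (hf : ∀ p, f p ∈ formsDeg R A p) :
    equivDiff R A (scaledHarmonic k R A s f) =
      scaledHarmonic k R A s' (formCyclicDiff R A f) := by
  have hb : ∀ p, redContraction R A (p + 1) (scaledHarmonic k R A s f (p + 1)) =
      s' p • harmonic k R A p (formB R A (f (p + 1))) := by
    intro p
    rw [scaledHarmonic_apply, map_smul,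
      redContraction_eq (k := k) (harmonic_mem_formsDeg (hf (p + 1))), formB_harmonic,
      karoubiMean_karoubiMean p.succ_ne_zero (karoubi_pow_formB (hf (p + 1))), harmonic_formB,
      h1, smul_neg, smul_smul, neg_mul, neg_smul, mul_comm]
  funext p
  cases p with
  | zero => rw [equivDiff_zero, hb, scaledHarmonic_apply, formCyclicDiff_zero]
  | succ p =>
    rw [equivDiff_succ, hb, scaledHarmonic_apply, scaledHarmonic_apply, formCyclicDiff_succ,
      map_add, smul_add, add_left_inj, map_smul, deRham_harmonic,
      karoubiSum_eq (k := k) p.succ_ne_zero, map_smul, karoubiMean_deRham _ (f p), harmonic_deRham,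
      ← karoubiMean_deRham, karoubiMean_karoubiMean p.succ_ne_zero (karoubi_pow_deRham (hf p)),
      smul_smul, h2, mul_comm]

end Harmonic

/-! ### The comparison isomorphism -/

section Comparison

variable {k R A : Type*} [Field k] [CommRing R] [Algebra k R] [Ring A] [Algebra R A]

theorem scaledHarmonic_mem_ground {n : ℤ} {z : ℕ → Forms R A} (s : ℕ → R)
    (hz : z ∈ families (M := fun _ => Forms R A) (fun p => formsDeg R A p ⊓ groundForms R A p) n) :
    scaledHarmonic k R A s z ∈
      families (M := fun _ => Forms R A) (fun p => formsDeg R A p ⊓ groundForms R A p) n := by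
  refine map_mem_families hz (fun p h => ?_) fun p h => ?_
  · rw [scaledHarmonic_apply, h, map_zero, smul_zero]
  · exact ⟨Submodule.smul_mem _ _ (harmonic_mem_formsDeg h.1),
      Submodule.smul_mem _ _ (harmonic_mem_groundForms h.2)⟩

theorem scaledHarmonic_mem_cycles {D D' : (ℕ → Forms R A) →ₗ[R] (ℕ → Forms R A)} {s s' : ℕ → R}
    (h : ∀ f : ℕ → Forms R A, (∀ p, f p ∈ formsDeg R A p) →
      D' (scaledHarmonic k R A s f) = scaledHarmonic k R A s' (D f)) {n : ℤ}
    {f : ℕ → Forms R A}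
    (hf : f ∈ cycles (M := fun _ => Forms R A) (formsDeg R A) (groundForms R A) D n) :
    scaledHarmonic k R A s f ∈
      cycles (M := fun _ => Forms R A) (formsDeg R A) (groundForms R A) D' n := by
  obtain ⟨hfam, hD⟩ := mem_cycles_iff.1 hf
  refine mem_cycles_iff.2 ⟨scaledHarmonic_mem_families s hfam, fun p => ?_⟩
  rw [h f (mem_of_mem_families hfam), scaledHarmonic_apply]
  exact Submodule.smul_mem _ _ (harmonic_mem_groundForms (hD p))

theorem scaledHarmonic_mem_boundaries {D D' : (ℕ → Forms R A) →ₗ[R] (ℕ → Forms R A)}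
    {s s' : ℕ → R}
    (h : ∀ f : ℕ → Forms R A, (∀ p, f p ∈ formsDeg R A p) →
      D' (scaledHarmonic k R A s f) = scaledHarmonic k R A s' (D f)) {n : ℤ}
    {f : ℕ → Forms R A}
    (hf : f ∈ boundaries (M := fun _ => Forms R A) (formsDeg R A) (groundForms R A) D n) :
    scaledHarmonic k R A s' f ∈
      boundaries (M := fun _ => Forms R A) (formsDeg R A) (groundForms R A) D' n := by
  obtain ⟨g, hg, z, hz, rfl⟩ := mem_boundaries_iff.1 hf
  refine mem_boundaries_iff.2 ⟨scaledHarmonic k R A s g, scaledHarmonic_mem_families s hg,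
    scaledHarmonic k R A s' z, scaledHarmonic_mem_ground s' hz, ?_⟩
  rw [h g (mem_of_mem_families hg), map_add]

theorem scaledHarmonic_scaledHarmonic {s t : ℕ → R} (h : ∀ p, s p * t p = 1)
    (f : ℕ → Forms R A) : scaledHarmonic k R A s (scaledHarmonic k R A t f) =
      scaledHarmonic k R A 1 (scaledHarmonic k R A 1 f) := by
  funext p
  simp only [scaledHarmonic_apply, map_smul, smul_smul, h, Pi.one_apply, one_smul]

variable [CharZero k]

/-- The sign `(-1)^⌊p/2⌋`. -/
def halfSign (p : ℕ) : ℤ := (-1) ^ (p / 2)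

theorem halfSign_add_two (p : ℕ) : halfSign (p + 2) = -halfSign p := by
  rw [halfSign, Nat.add_div_right _ two_pos, pow_succ, mul_neg_one, halfSign]

theorem halfSign_mul_self (p : ℕ) : halfSign p * halfSign p = 1 := by
  rw [halfSign, ← mul_pow]; simp

theorem natInv_factorial_succ (p : ℕ) :
    natInv k R p.factorial = ((p + 1 : ℕ) : R) * natInv k R (p + 1).factorial := by
  have h1 := natInv_mul (k := k) (R := R) p.factorial_ne_zero
  have h2 := natInv_mul (k := k) (R := R) (p + 1).factorial_ne_zero
  rw [Nat.factorial_succ, Nat.cast_mul] at h2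
  rw [Nat.factorial_succ]
  linear_combination (-natInv k R p.factorial) * h2 +
    ((p + 1 : ℕ) : R) * natInv k R ((p + 1) * p.factorial) * h1

variable (k) in
/-- The homotopy between the harmonic operator and the identity for `d + t ı_Δ`. -/
theorem sub_harmonic_equivDiff {f : ℕ → Forms R A} (hf : ∀ p, f p ∈ formsDeg R A p) (p : ℕ) :
    f p - harmonic k R A p (f p) =
      equivDiff R A (fun q => karoubiGreen k R A (q + 1) (formB R A (f (q + 1)))) p +
        karoubiGreen k R A (p + 1) (formB R A (equivDiff R A f (p + 1))) := by
  have hG : ∀ (m : ℕ) (w : Forms R A), karoubiGreen k R A m (formB R A w) =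
      formB R A (karoubiGreen k R A m w) := fun m =>
    LinearMap.congr_fun (commute_karoubiGreen_formB m).eq
  have hr : ∀ p, redContraction R A (p + 1)
      (karoubiGreen k R A (p + 2) (formB R A (f (p + 2)))) = 0 := by
    intro p
    rw [redContraction_eq (k := k)
      (karoubiGreen_mem_formsDeg (formB_mem_formsDeg (hf (p + 2))) _), hG, formB_formB]
    simp
  have hr' : formB R A (redContraction R A (p + 2) (f (p + 2))) = 0 := by
    rw [redContraction_eq (k := k) (hf (p + 2)), karoubiMean_formB, map_neg, map_smul,
      formB_formB]
    simp
  rw [harmonic_apply, sub_sub_cancel, equivDiff_succ, map_add, hr', add_zero, add_left_inj]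
  cases p with
  | zero => rw [equivDiff_zero, hr, karoubiGreen_zero]; simp
  | succ p => rw [equivDiff_succ, hr, add_zero]

variable (k) in
/-- The homotopy between the harmonic operator and the identity for `B + b`. -/
theorem sub_harmonic_formCyclicDiff (f : ℕ → Forms R A) (p : ℕ) :
    f p - harmonic k R A p (f p) =
      formCyclicDiff R A (fun q => karoubiGreen k R A q (deRham R A (f (q - 1)))) p +
        karoubiGreen k R A p (deRham R A (formCyclicDiff R A f (p - 1))) := by
  have hG : ∀ (m : ℕ) (w : Forms R A), karoubiGreen k R A m (deRham R A w) =
      deRham R A (karoubiGreen k R A m w) := fun m =>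
    LinearMap.congr_fun (commute_karoubiGreen_deRham m).eq
  have hG' : ∀ (m : ℕ) (w : Forms R A), karoubiGreen k R A m (formB R A w) =
      formB R A (karoubiGreen k R A m w) := fun m =>
    LinearMap.congr_fun (commute_karoubiGreen_formB m).eq
  have hS : ∀ (m : ℕ) (w : Forms R A), deRham R A (karoubiSum R A m (deRham R A w)) = 0 := by
    intro m w
    have h := LinearMap.congr_fun (commute_karoubiSum_deRham (R := R) (A := A) m).eq w
    simp only [Module.End.mul_apply] at h
    rw [h, deRham_deRham]
  have hd : ∀ q, deRham R A (formCyclicDiff R A f q) = deRham R A (formB R A (f (q + 1))) := by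
    intro q
    cases q with
    | zero => rw [formCyclicDiff_zero]
    | succ q => rw [formCyclicDiff_succ, map_add, hS, zero_add]
  rw [harmonic_apply, sub_sub_cancel, hd]
  cases p with
  | zero =>
    rw [formCyclicDiff_zero, karoubiGreen_zero, LinearMap.zero_apply, LinearMap.zero_apply,
      map_zero, zero_add, add_zero, hG']
  | succ p =>
    rw [formCyclicDiff_succ, hG p, deRham_deRham, map_zero, zero_add, add_comm, hG' (p + 1 + 1),
      hG (p + 1)]
    rfl

theorem boundary_equivDiff {n : ℤ} {f : ℕ → Forms R A} (hf : f ∈ formCycles R A n) :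
    f - scaledHarmonic k R A 1 f ∈ boundaries (M := fun _ => Forms R A) (formsDeg R A)
      (groundForms R A) (equivDiff R A) n := by
  obtain ⟨hfam, hD⟩ := mem_cycles_iff.1 hf
  refine mem_boundaries_iff.2
    ⟨fun q => karoubiGreen k R A (q + 1) (formB R A (f (q + 1))), ?_, 0, zero_mem _, ?_⟩
  · refine mem_families_iff.2 fun p => ⟨fun _ => ?_, fun hp => ?_⟩
    · exact karoubiGreen_mem_formsDeg (formB_mem_formsDeg (mem_of_mem_families hfam (p + 1))) _
    · rw [(mem_families_iff.1 hfam (p + 1)).2 fun h => hp (by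
        rw [even_succ_sub]; exact even_sub_succ.1 h), map_zero, map_zero]
  · funext p
    have h : equivDiff R A f (p + 1) = 0 := hD (p + 1)
    have h' := sub_harmonic_equivDiff k (mem_of_mem_families hfam) p
    rw [h, map_zero, map_zero, add_zero] at h'
    rw [add_zero, ← h', Pi.sub_apply, scaledHarmonic_apply, Pi.one_apply, one_smul]

theorem boundary_formCyclicDiff {n : ℤ} {f : ℕ → Forms R A}
    (hf : f ∈ cycles (M := fun _ => Forms R A) (formsDeg R A) (groundForms R A)
      (formCyclicDiff R A) n) :
    f - scaledHarmonic k R A 1 f ∈ boundaries (M := fun _ => Forms R A) (formsDeg R A)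
      (groundForms R A) (formCyclicDiff R A) n := by
  obtain ⟨hfam, hD⟩ := mem_cycles_iff.1 hf
  refine mem_boundaries_iff.2
    ⟨fun q => karoubiGreen k R A q (deRham R A (f (q - 1))), ?_, 0, zero_mem _, ?_⟩
  · refine mem_families_iff.2 fun p => ⟨fun _ => ?_, fun hp => ?_⟩
    · cases p with
      | zero => rw [karoubiGreen_zero]; exact zero_mem _
      | succ p =>
        exact karoubiGreen_mem_formsDeg (deRham_mem_formsDeg (mem_of_mem_families hfam p)) _
    · cases p with
      | zero => rw [karoubiGreen_zero]; rfl
      | succ p =>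
        rw [even_sub_succ, even_succ_sub, not_not] at hp
        rw [Nat.add_sub_cancel, (mem_families_iff.1 hfam p).2 hp, map_zero, map_zero]
  · funext p
    have h : deRham R A (formCyclicDiff R A f (p - 1)) = 0 := by
      have h1 := hD (p - 1)
      generalize p - 1 = q at h1
      cases q with
      | zero =>
        obtain ⟨r, hr⟩ := Submodule.mem_span_singleton.1 h1
        rw [← hr, map_smul, deRham_one, smul_zero]
      | succ q =>
        have h2 : formCyclicDiff R A f (q + 1) = 0 := h1
        rw [h2, map_zero]
    have h' := sub_harmonic_formCyclicDiff k f p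
    rw [h, map_zero, add_zero] at h'
    rw [add_zero, ← h', Pi.sub_apply, scaledHarmonic_apply, Pi.one_apply, one_smul]

variable (R) in
/-- The factor `(-1)^⌊p/2⌋ p!` of the comparison isomorphism. -/
def compScale (p : ℕ) : R := ((halfSign p * p.factorial : ℤ) : R)

variable (k R) in
/-- The inverse of `(-1)^⌊p/2⌋ p!`. -/
def compScaleInv (p : ℕ) : R := (halfSign p : R) * natInv k R p.factorial

theorem compScaleInv_mul (p : ℕ) : compScaleInv k R p * compScale R p = 1 := by
  have h1 := natInv_mul (k := k) (R := R) p.factorial_ne_zero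
  have h2 : (halfSign p : R) * halfSign p = 1 := by
    rw [← Int.cast_mul, halfSign_mul_self, Int.cast_one]
  rw [compScaleInv, compScale]
  push_cast
  linear_combination h1 * (halfSign p : R) * halfSign p + h2

variable (k) in
theorem compScale_cycles {f : ℕ → Forms R A} (hf : ∀ p, f p ∈ formsDeg R A p) :
    formCyclicDiff R A (scaledHarmonic k R A (compScale R) f) =
      scaledHarmonic k R A (fun p => -((halfSign (p + 1) * p.factorial : ℤ) : R))
        (equivDiff R A f) := by
  refine formCyclicDiff_scaledHarmonic (fun p => ?_) (fun p => ?_) hf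
  · rw [compScale, Nat.factorial_succ]; push_cast; ring
  · rw [compScale, halfSign_add_two, Nat.factorial_succ]; push_cast; ring

variable (k) in
theorem compScale_boundaries {f : ℕ → Forms R A} (hf : ∀ p, f p ∈ formsDeg R A p) :
    formCyclicDiff R A
        (scaledHarmonic k R A (fun p => ((halfSign (p + 1) * p.factorial : ℤ) : R)) f) =
      scaledHarmonic k R A (compScale R) (equivDiff R A f) := by
  refine formCyclicDiff_scaledHarmonic (fun p => ?_) (fun p => ?_) hf
  · rw [compScale, halfSign_add_two, Nat.factorial_succ]; push_cast; ring
  · rw [compScale, Nat.factorial_succ]; push_cast; ring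

theorem compScaleInv_cycles {f : ℕ → Forms R A} (hf : ∀ p, f p ∈ formsDeg R A p) :
    equivDiff R A (scaledHarmonic k R A (compScaleInv k R) f) =
      scaledHarmonic k R A (fun p => -((halfSign (p + 1) : R) * natInv k R p.factorial))
        (formCyclicDiff R A f) := by
  refine equivDiff_scaledHarmonic (fun p => ?_) (fun p => ?_) hf
  · rw [compScaleInv, natInv_factorial_succ p]; ring
  · rw [compScaleInv, natInv_factorial_succ p, halfSign_add_two]; push_cast; ring

theorem compScaleInv_boundaries {f : ℕ → Forms R A} (hf : ∀ p, f p ∈ formsDeg R A p) :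
    equivDiff R A
        (scaledHarmonic k R A (fun p => (halfSign (p + 1) : R) * natInv k R p.factorial) f) =
      scaledHarmonic k R A (compScaleInv k R) (formCyclicDiff R A f) := by
  refine equivDiff_scaledHarmonic (fun p => ?_) (fun p => ?_) hf
  · rw [compScaleInv, natInv_factorial_succ p, halfSign_add_two]; push_cast; ring
  · rw [compScaleInv, natInv_factorial_succ p]; ring

theorem scaledHarmonic_one_mem_formCycles {n : ℤ} {f : ℕ → Forms R A}
    (hf : f ∈ formCycles R A n) : scaledHarmonic k R A 1 f ∈ formCycles R A n := by
  obtain ⟨hfam, hD⟩ := mem_cycles_iff.1 hf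
  obtain ⟨h, hh, z, hz, he⟩ := mem_boundaries_iff.1 (boundary_equivDiff (k := k) hf)
  have e : scaledHarmonic k R A 1 f = f - equivDiff R A h - z := by
    rw [sub_sub, he, sub_sub_cancel]
  refine mem_cycles_iff.2 ⟨scaledHarmonic_mem_families 1 hfam, fun p => ?_⟩
  have hz0 : equivDiff R A z = 0 := by
    funext p
    have h1 : ∀ q, z (q + 1) = 0 := fun q => (mem_of_mem_families hz (q + 1)).2
    cases p with
    | zero => rw [equivDiff_zero, h1, map_zero]; rfl
    | succ p =>
      rw [equivDiff_succ, h1, map_zero, add_zero]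
      cases p with
      | zero =>
        obtain ⟨r, hr⟩ := Submodule.mem_span_singleton.1 (mem_of_mem_families hz 0).2
        rw [← hr, map_smul, deRham_one, smul_zero]; rfl
      | succ p => rw [h1, map_zero]; rfl
  rw [e, map_sub, map_sub, equivDiff_equivDiff (mem_of_mem_families hh), hz0, sub_zero, sub_zero]
  exact hD p

theorem formCyclicDiff_scaledHarmonic_one (f : ℕ → Forms R A) :
    formCyclicDiff R A (scaledHarmonic k R A 1 f) =
      scaledHarmonic k R A 1 (formCyclicDiff R A f) := by
  have hb : ∀ p, formB R A (scaledHarmonic k R A 1 f (p + 1)) =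
      harmonic k R A p (formB R A (f (p + 1))) := by
    intro p
    rw [scaledHarmonic_apply, Pi.one_apply, one_smul, formB_harmonic, harmonic_formB]
  funext p
  cases p with
  | zero => rw [formCyclicDiff_zero, hb, scaledHarmonic_apply, formCyclicDiff_zero]; simp
  | succ p =>
    rw [formCyclicDiff_succ, hb, scaledHarmonic_apply, scaledHarmonic_apply, Pi.one_apply,
      Pi.one_apply, one_smul, one_smul, formCyclicDiff_succ, map_add, add_left_inj,
      deRham_harmonic, karoubiSum_eq (k := k) p.succ_ne_zero, karoubiSum_eq (k := k) p.succ_ne_zero,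
      map_smul, karoubiMean_deRham _ (f p), harmonic_deRham]

variable (k R A) in
/-- The rescaled harmonic operator as an isomorphism from the homology of `d + t ı_Δ` to the
homology of `B + b` on forms. -/
def harmonicEquiv (n : ℤ) : FormHomology R A n ≃ₗ[R] FormCyclicHomology R A n :=
  LinearEquiv.ofLinearMap
    (PerHomology.map (scaledHarmonic k R A (compScale R))
      (fun _ hf => scaledHarmonic_mem_cycles (fun _ => compScale_cycles k) hf)
      (fun _ hf => scaledHarmonic_mem_boundaries (fun _ => compScale_boundaries k) hf))
    (PerHomology.map (scaledHarmonic k R A (compScaleInv k R))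
      (fun _ hf => scaledHarmonic_mem_cycles (fun _ => compScaleInv_cycles) hf)
      (fun _ hf => scaledHarmonic_mem_boundaries (fun _ => compScaleInv_boundaries) hf))
    (LinearMap.ext fun x => by
      induction x using PerHomology.ind with
      | h f hf =>
        rw [LinearMap.comp_apply, PerHomology.map_mk, PerHomology.map_mk, LinearMap.id_apply,
          PerHomology.mk_eq_iff, ← neg_mem_iff, neg_sub,
          scaledHarmonic_scaledHarmonic fun p => (mul_comm _ _).trans (compScaleInv_mul p),
          ← sub_add_sub_cancel f (scaledHarmonic k R A 1 f)]
        exact add_mem (boundary_formCyclicDiff hf) (boundary_formCyclicDiff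
          (scaledHarmonic_mem_cycles (fun f _ => formCyclicDiff_scaledHarmonic_one f) hf)))
    (LinearMap.ext fun x => by
      induction x using PerHomology.ind with
      | h f hf =>
        rw [LinearMap.comp_apply, PerHomology.map_mk, PerHomology.map_mk, LinearMap.id_apply,
          PerHomology.mk_eq_iff, ← neg_mem_iff, neg_sub,
          scaledHarmonic_scaledHarmonic fun p => compScaleInv_mul p,
          ← sub_add_sub_cancel f (scaledHarmonic k R A 1 f)]
        exact add_mem (boundary_equivDiff hf) (boundary_equivDiff
          (scaledHarmonic_one_mem_formCycles hf)))

theorem harmonicEquiv_mk {n : ℤ} {f : ℕ → Forms R A} (hf : f ∈ formCycles R A n) :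
    harmonicEquiv k R A n (PerHomology.mk f hf) =
      PerHomology.mk (scaledHarmonic k R A (compScale R) f)
        (scaledHarmonic_mem_cycles (fun _ => compScale_cycles k) hf) := rfl

end Comparison

section ChainHomology

variable (R A : Type*) [CommRing R] [Ring A] [Algebra R A]

/-- The map `a₀ ⊗ ⋯ ⊗ aₚ ↦ a₀ da₁ ⋯ daₚ` on families. -/
def chainFamilyToForm : (∀ p, Chains R A p) →ₗ[R] (ℕ → Forms R A) :=
  LinearMap.pi fun p => chainToForm R A p ∘ₗ LinearMap.proj p

variable {R A}

theorem chainFamilyToForm_apply (c : ∀ p, Chains R A p) (p : ℕ) :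
    chainFamilyToForm R A c p = chainToForm R A p (c p) := rfl

theorem chainFamilyToForm_cyclicDiff (c : ∀ p, Chains R A p) :
    chainFamilyToForm R A (cyclicDiff R A c) = formCyclicDiff R A (chainFamilyToForm R A c) := by
  funext p
  rw [chainFamilyToForm_apply]
  cases p with
  | zero =>
    rw [cyclicDiff, total_zero, chainToForm_hochschildB, formCyclicDiff_zero]; rfl
  | succ p =>
    rw [cyclicDiff, total_succ, map_add, chainToForm_hochschildB, chainToForm_connesB,
      formCyclicDiff_succ]; rfl

theorem chainFamilyToForm_mem_families {n : ℤ} {c : ∀ p, Chains R A p}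
    {G : ∀ p, Submodule R (Chains R A p)} (hc : c ∈ families G n) :
    chainFamilyToForm R A c ∈ families (M := fun _ => Forms R A) (formsDeg R A) n :=
  map_mem_families hc (fun p h => by rw [chainFamilyToForm_apply, h, map_zero])
    fun _ _ => chainToForm_mem _

theorem exists_chainFamilyToForm_eq {n : ℤ} {f : ℕ → Forms R A}
    (hf : f ∈ families (M := fun _ => Forms R A) (formsDeg R A) n) :
    ∃ c ∈ families (fun _ => (⊤ : Submodule R (Chains R A _))) n,
      chainFamilyToForm R A c = f := by
  choose c hc using fun p => exists_chainToForm_eq (mem_of_mem_families hf p)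
  classical
  refine ⟨fun p => if Even (n - (p : ℤ)) then c p else 0,
    mem_families_iff.2 fun p => ⟨fun _ => trivial, fun h => if_neg h⟩, funext fun p => ?_⟩
  rw [chainFamilyToForm_apply]
  split_ifs with h
  · exact hc p
  · rw [map_zero, (mem_families_iff.1 hf p).2 h]

theorem compScale_smul (p : ℕ) (w : Forms R A) :
    ((-1 : ℤ) ^ (p / 2) * (p.factorial : ℤ)) • w = compScale R p • w := by
  rw [compScale, Int.cast_smul_eq_zsmul]; rfl

variable [Module.Projective R (BarQuot R A)]

theorem chainFamilyToForm_mem_cycles_iff {n : ℤ} {c : ∀ p, Chains R A p}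
    (hc : c ∈ families (fun _ => (⊤ : Submodule R (Chains R A _))) n) :
    chainFamilyToForm R A c ∈ cycles (M := fun _ => Forms R A) (formsDeg R A) (groundForms R A)
      (formCyclicDiff R A) n ↔ c ∈ cyclicCycles R A n := by
  rw [cyclicCycles, mem_cycles_iff, mem_cycles_iff, ← chainFamilyToForm_cyclicDiff]
  simp only [chainFamilyToForm_apply, chainToForm_mem_ground_iff]
  exact and_congr_left fun _ => iff_of_true (chainFamilyToForm_mem_families hc) hc

theorem chainFamilyToForm_mem_cycles {n : ℤ} {c : ∀ p, Chains R A p}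
    (hc : c ∈ cyclicCycles R A n) :
    chainFamilyToForm R A c ∈ cycles (M := fun _ => Forms R A) (formsDeg R A) (groundForms R A)
      (formCyclicDiff R A) n :=
  (chainFamilyToForm_mem_cycles_iff (mem_cycles_iff.1 hc).1).2 hc

theorem chainFamilyToForm_mem_boundaries_iff {n : ℤ} {c : ∀ p, Chains R A p}
    (hc : c ∈ families (fun _ => (⊤ : Submodule R (Chains R A _))) n) :
    chainFamilyToForm R A c ∈ boundaries (M := fun _ => Forms R A) (formsDeg R A)
      (groundForms R A) (formCyclicDiff R A) n ↔
    c ∈ boundaries (fun _ => ⊤) (degenerate R A) (cyclicDiff R A) n := by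
  rw [mem_boundaries_iff, mem_boundaries_iff]
  constructor
  · rintro ⟨h', hh', z', hz', he⟩
    obtain ⟨h, hh, rfl⟩ := exists_chainFamilyToForm_eq hh'
    refine ⟨h, hh, c - cyclicDiff R A h, ?_, by abel⟩
    have hfam : c - cyclicDiff R A h ∈ families (fun _ => (⊤ : Submodule R (Chains R A _))) n :=
      sub_mem hc (total_mem_families hh fun _ => trivial)
    refine families_mono hfam fun p => ⟨trivial, (chainToForm_mem_ground_iff _).1 ?_⟩
    have : z' = chainFamilyToForm R A (c - cyclicDiff R A h) := by
      rw [map_sub, chainFamilyToForm_cyclicDiff, ← he, add_sub_cancel_left]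
    rw [← chainFamilyToForm_apply, ← this]
    exact (mem_of_mem_families hz' p).2
  · rintro ⟨h, hh, z, hz, rfl⟩
    refine ⟨_, chainFamilyToForm_mem_families hh, chainFamilyToForm R A z, ?_,
      by rw [map_add, chainFamilyToForm_cyclicDiff]⟩
    exact map_mem_families hz (fun p h => by rw [chainFamilyToForm_apply, h, map_zero])
      fun p h => ⟨chainToForm_mem _, chainToForm_degenerate h.2⟩

variable (R A) in
/-- Periodic cyclic homology, computed with forms. -/
def chainEquiv (n : ℤ) : HP R A n ≃ₗ[R] FormCyclicHomology R A n :=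
  LinearEquiv.ofBijective
    (PerHomology.map (chainFamilyToForm R A) (fun _ hc => chainFamilyToForm_mem_cycles hc)
      fun c hc => (chainFamilyToForm_mem_boundaries_iff (by
        obtain ⟨h, hh, z, hz, rfl⟩ := mem_boundaries_iff.1 hc
        exact add_mem (total_mem_families hh fun _ => trivial)
          (families_mono hz fun _ => trivial))).2 hc)
    (by
      constructor
      · rw [injective_iff_map_eq_zero]
        intro x
        induction x using PerHomology.ind with
        | h c hc =>
          rw [PerHomology.map_mk, PerHomology.mk_eq_zero_iff, PerHomology.mk_eq_zero_iff]
          exact (chainFamilyToForm_mem_boundaries_iff (mem_cycles_iff.1 hc).1).1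
      · intro x
        induction x using PerHomology.ind with
        | h f hf =>
          obtain ⟨c, hc, rfl⟩ := exists_chainFamilyToForm_eq (mem_cycles_iff.1 hf).1
          exact ⟨PerHomology.mk c ((chainFamilyToForm_mem_cycles_iff hc).1 hf), rfl⟩)

theorem chainEquiv_mk {n : ℤ} {c : ∀ p, Chains R A p} (hc : c ∈ cyclicCycles R A n) :
    chainEquiv R A n (PerHomology.mk c hc) =
      PerHomology.mk (chainFamilyToForm R A c) (chainFamilyToForm_mem_cycles hc) := rfl

variable (k : Type*) [Field k] [CharZero k] [Algebra k R]

variable (R A) in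
/-- The comparison between the homology of `d + t ı_Δ` and periodic cyclic homology. -/
def comparison (n : ℤ) : FormHomology R A n ≃ₗ[R] HP R A n :=
  harmonicEquiv k R A n ≪≫ₗ (chainEquiv R A n).symm

theorem isComparison_comparison : IsComparison (comparison R A k) := by
  intro n f hf c hc h
  rw [comparison, LinearEquiv.trans_apply, LinearEquiv.symm_apply_eq, chainEquiv_mk,
    harmonicEquiv_mk, PerHomology.mk_eq_iff, ← neg_mem_iff, neg_sub]
  have hq := chainFamilyToForm_mem_cycles hc
  rw [← sub_add_sub_cancel _ (scaledHarmonic k R A 1 (chainFamilyToForm R A c))]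
  refine add_mem (boundary_formCyclicDiff hq) (mem_boundaries_iff.2 ⟨0, zero_mem _, _, ?_, by
    rw [map_zero, zero_add]⟩)
  refine families_mono (sub_mem (scaledHarmonic_mem_families 1 (mem_cycles_iff.1 hq).1)
    (scaledHarmonic_mem_families _ (mem_cycles_iff.1 hf).1)) fun p => ⟨?_, ?_⟩
  · exact sub_mem (mem_of_mem_families (scaledHarmonic_mem_families 1 (mem_cycles_iff.1 hq).1) p)
      (mem_of_mem_families (scaledHarmonic_mem_families _ (mem_cycles_iff.1 hf).1) p)
  · rw [Pi.sub_apply, scaledHarmonic_apply, scaledHarmonic_apply, Pi.one_apply, one_smul,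
      ← map_smul, ← map_sub, ← compScale_smul]
    exact harmonic_mem_groundForms (h p)

theorem IsComparison.eq_comparison {Φ : ∀ n, FormHomology R A n ≃ₗ[R] HP R A n}
    (hΦ : IsComparison Φ) : Φ = comparison R A k := by
  funext n
  refine LinearEquiv.ext fun x => ?_
  induction x using PerHomology.ind with
  | h f hf =>
    -- a harmonic representative is a cycle for both differentials
    have hP := scaledHarmonic_one_mem_formCycles (k := k) hf
    have hcls : (PerHomology.mk f hf : FormHomology R A n) = PerHomology.mk _ hP :=
      (PerHomology.mk_eq_iff _ _).2 (boundary_equivDiff hf)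
    have hF := scaledHarmonic_mem_cycles (fun _ => compScale_cycles k) hf
    obtain ⟨c, hc, he⟩ := exists_chainFamilyToForm_eq (mem_cycles_iff.1 hF).1
    have hc' : c ∈ cyclicCycles R A n := (chainFamilyToForm_mem_cycles_iff hc).1 (he ▸ hF)
    have hg : ∀ p, chainToForm R A p (c p) - ((-1 : ℤ) ^ (p / 2) * (p.factorial : ℤ)) •
        scaledHarmonic k R A 1 f p ∈ groundForms R A p := by
      intro p
      rw [compScale_smul, ← chainFamilyToForm_apply, he, scaledHarmonic_apply,
        scaledHarmonic_apply, Pi.one_apply, one_smul, sub_self]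
      exact zero_mem _
    rw [hcls, hΦ n _ hP c hc' hg, isComparison_comparison k n _ hP c hc' hg]

end ChainHomology

/-! ### The projection to relative forms -/

section Relative

variable {k B A : Type*} [CommRing k] [CommRing B] [Ring A] [Algebra k B] [Algebra k A]
  [Algebra B A] [IsScalarTower k B A]

@[simp] theorem toRelative_incl (a : A) : toRelative k B A (incl k a) = incl B a :=
  liftForms_incl k _ _ _ _ _ a

@[simp] theorem toRelative_der (a : A) : toRelative k B A (der k a) = der B a :=
  liftForms_der k _ _ _ _ _ a

theorem toRelative_derProd (l : List A) : toRelative k B A (derProd k l) = derProd B l := by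
  induction l with
  | nil => simp
  | cons a l ih => rw [derProd_cons, map_mul, ih, toRelative_der, derProd_cons]

theorem toRelative_mem_formsDeg {n : ℕ} {w : Forms k A} (hw : w ∈ formsDeg k A n) :
    toRelative k B A w ∈ formsDeg B A n := by
  induction hw using formsDeg_induction with
  | word a l h =>
    rw [map_mul, toRelative_incl, toRelative_derProd, ← h]
    exact word_mem_formsDeg a l
  | add x y _ _ hx hy => rw [map_add]; exact add_mem hx hy

theorem exists_toRelative_eq {n : ℕ} {w : Forms B A} (hw : w ∈ formsDeg B A n) :
    ∃ v ∈ formsDeg k A n, toRelative k B A v = w := by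
  induction hw using formsDeg_induction with
  | word a l h =>
    exact ⟨_, h ▸ word_mem_formsDeg a l, by rw [map_mul, toRelative_incl, toRelative_derProd]⟩
  | add x y _ _ hx hy =>
    obtain ⟨v, hv, rfl⟩ := hx
    obtain ⟨v', hv', rfl⟩ := hy
    exact ⟨v + v', add_mem hv hv', map_add _ _ _⟩

theorem toRelative_parity (w : Forms k A) :
    toRelative k B A (parity k A w) = parity B A (toRelative k B A w) := by
  induction w using Forms.homogeneous_induction with
  | hom m w hw =>
    rw [parity_of_mem hw, parity_of_mem (toRelative_mem_formsDeg hw), map_zsmul]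
  | add x y hx hy => simp only [map_add, hx, hy]

theorem toRelative_deRham (w : Forms k A) :
    toRelative k B A (deRham k A w) = deRham B A (toRelative k B A w) := by
  induction w using Forms.word_induction with
  | word a l =>
    rw [deRham_word, toRelative_derProd, map_mul, toRelative_incl, toRelative_derProd, deRham_word]
  | add x y hx hy => simp only [map_add, hx, hy]

theorem toRelative_formB (w : Forms k A) :
    toRelative k B A (formB k A w) = formB B A (toRelative k B A w) := by
  induction w using Forms.right_induction with
  | hincl a => simp
  | mul_der w a =>
    rw [formB_mul_der, map_mul, toRelative_der, formB_mul_der]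
    simp [toRelative_parity]
  | add x y hx hy => simp only [map_add, hx, hy]

theorem toRelative_karoubi (w : Forms k A) :
    toRelative k B A (karoubi k A w) = karoubi B A (toRelative k B A w) := by
  have h1 := formB_deRham_add w
  have h2 := formB_deRham_add (toRelative k B A w)
  rw [← toRelative_formB, ← toRelative_deRham, ← toRelative_formB, ← toRelative_deRham, ← map_add,
    h1, map_sub, sub_right_inj] at h2
  exact h2

theorem toRelative_karoubi_pow (j : ℕ) (w : Forms k A) :
    toRelative k B A ((karoubi k A ^ j) w) = (karoubi B A ^ j) (toRelative k B A w) := by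
  induction j with
  | zero => rfl
  | succ j ih => rw [pow_succ', pow_succ', Module.End.mul_apply, toRelative_karoubi, ih]; rfl

theorem toRelative_redContraction {n : ℕ} {w : Forms k A} (hw : w ∈ formsDeg k A n) :
    toRelative k B A (redContraction k A n w) = redContraction B A n (toRelative k B A w) := by
  rw [redContraction_of_mem hw, redContraction_of_mem (toRelative_mem_formsDeg hw), map_neg,
    toRelative_formB, karoubiSum_apply, karoubiSum_apply, map_sum]
  simp only [toRelative_karoubi_pow]

theorem toRelative_equivDiff {f : ℕ → Forms k A} (hf : ∀ p, f p ∈ formsDeg k A p) (p : ℕ) :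
    toRelative k B A (equivDiff k A f p) = equivDiff B A (fun q => toRelative k B A (f q)) p := by
  cases p with
  | zero => rw [equivDiff_zero, equivDiff_zero, toRelative_redContraction (hf 1)]
  | succ p =>
    rw [equivDiff_succ, equivDiff_succ, map_add, toRelative_deRham,
      toRelative_redContraction (hf (p + 2))]

end Relative

/-! ### The ideal of super-commutators with the base -/

section SideIdeal

variable {k F : Type*} [CommRing k] [Ring F] [Algebra k F]

/-- The two-sided ideal generated by a submodule. -/
def sideIdeal (S : Submodule k F) : Ideal F where
  carrier := ((⊤ * S * ⊤ : Submodule k F) : Set F)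
  add_mem' := add_mem
  zero_mem' := zero_mem _
  smul_mem' w x hx := by
    have h : (⊤ : Submodule k F) * (⊤ * S * ⊤) ≤ ⊤ * S * ⊤ := by
      rw [← mul_assoc, ← mul_assoc]
      exact mul_le_mul' (mul_le_mul' le_top le_rfl) le_rfl
    exact h (Submodule.mul_mem_mul trivial hx)

theorem mem_sideIdeal {S : Submodule k F} {x : F} :
    x ∈ sideIdeal S ↔ x ∈ (⊤ * S * ⊤ : Submodule k F) := Iff.rfl

instance (S : Submodule k F) : (sideIdeal S).IsTwoSided where
  mul_mem_of_left {x} w hx := by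
    have h : (⊤ * S * ⊤ : Submodule k F) * ⊤ ≤ ⊤ * S * ⊤ := by
      rw [mul_assoc]
      exact mul_le_mul' le_rfl le_top
    exact h (Submodule.mul_mem_mul hx trivial)

theorem subset_sideIdeal {S : Submodule k F} {x : F} (hx : x ∈ S) : x ∈ sideIdeal S := by
  have h1 : (1 : F) ∈ (⊤ : Submodule k F) := Submodule.mem_top
  have := Submodule.mul_mem_mul (Submodule.mul_mem_mul h1 hx) h1
  rwa [one_mul, mul_one] at this

theorem sideIdeal_span_induction {s : Set F} {P : F → Prop}
    (mem : ∀ u, ∀ x ∈ s, ∀ v, P (u * x * v)) (zero : P 0) (add : ∀ x y, P x → P y → P (x + y))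
    {x : F} (hx : x ∈ sideIdeal (Submodule.span k s)) : P x := by
  refine Submodule.mul_induction_on (mem_sideIdeal.1 hx) (fun y hy v _ => ?_) add
  refine Submodule.mul_induction_on hy (fun u _ z hz => ?_)
    fun y y' h h' => by rw [add_mul]; exact add _ _ h h'
  refine Submodule.span_induction (p := fun z _ => ∀ r : k, P (u * (r • z) * v)) ?_ ?_ ?_ ?_ hz 1
    |> fun h => by rwa [one_smul] at h
  · intro z hz r
    rw [mul_smul_comm, ← smul_mul_assoc]
    exact mem _ z hz v
  · intro r; simpa using zero
  · intro y z _ _ hy hz r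
    rw [smul_add, mul_add, add_mul]; exact add _ _ (hy r) (hz r)
  · intro a y _ hy r
    rw [smul_smul]; exact hy _

end SideIdeal

section CommIdeal

variable {k B A : Type*} [CommRing k] [CommRing B] [Ring A] [Algebra k B] [Algebra k A]
  [Algebra B A] [IsScalarTower k B A]

variable (k) in
/-- The image of an element of the base in degree zero. -/
abbrev inclB (A : Type*) [Ring A] [Algebra k A] [Algebra B A] (b : B) : Forms k A :=
  incl k (algebraMap B A b)

variable (k) in
/-- The differential of an element of the base. -/
abbrev derB (A : Type*) [Ring A] [Algebra k A] [Algebra B A] (b : B) : Forms k A :=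
  der k (algebraMap B A b)

theorem inclB_mul_incl (b : B) (a : A) : inclB k A b * incl k a = incl k a * inclB k A b := by
  rw [← incl_mul, ← incl_mul, Algebra.commutes]

/-- A ring map supercommutes the forms on the base with all forms as soon as it does so for `da`
against `b` and `db`. -/
theorem map_commute_of_generators {T : Type*} [Ring T] {f : Forms k A →+* T}
    (h0 : ∀ (a : A) (b : B), f (der k a) * f (inclB k A b) = f (inclB k A b) * f (der k a))
    (h1 : ∀ (a : A) (b : B), f (der k a) * f (derB k A b) = -(f (derB k A b) * f (der k a)))
    (b : B) (w : Forms k A) :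
    f (inclB k A b) * f w = f w * f (inclB k A b) ∧
      f (derB k A b) * f w = f (parity k A w) * f (derB k A b) := by
  induction w using Forms.induction with
  | hincl a =>
    refine ⟨by rw [← map_mul f, inclB_mul_incl, map_mul f], ?_⟩
    have h := congrArg (fun x => f (der k x)) (Algebra.commutes b a)
    simp only [der_mul, map_add, map_mul] at h
    rw [← h0 a b, add_comm (f (incl k a) * _)] at h
    rw [parity_incl]
    exact add_left_cancel h
  | hder a =>
    refine ⟨(h0 a b).symm, ?_⟩
    rw [parity_der, map_neg, neg_mul, h1, neg_neg]
  | hmul x y hx hy =>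
    refine ⟨?_, ?_⟩
    · rw [map_mul, ← mul_assoc, hx.1, mul_assoc, hy.1, mul_assoc]
    · rw [map_mul, map_mul, map_mul, ← mul_assoc, hx.2, mul_assoc, hy.2, mul_assoc]
  | hadd x y hx hy =>
    refine ⟨?_, ?_⟩
    · rw [map_add, mul_add, add_mul, hx.1, hy.1]
    · rw [map_add, map_add, map_add, mul_add, add_mul, hx.2, hy.2]

theorem formsOn_range_induction {q : ℕ} {P : Forms k A → Prop} (zero : P 0)
    (word : ∀ (b : B) (l : List B), l.length = q →
      P (inclB k A b * derProd k (l.map (algebraMap B A))))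
    (add : ∀ x y, P x → P y → P (x + y)) {e : Forms k A}
    (he : e ∈ formsOn k (Set.range (algebraMap B A)) q) : P e := by
  refine Submodule.span_induction (p := fun x _ => ∀ r : k, P (r • x)) ?_ ?_ ?_ ?_ he 1
    |> fun h => by rwa [one_smul] at h
  · rintro _ ⟨a₀, a, ⟨b₀, rfl⟩, ha, rfl⟩ r
    choose b hb using ha
    have h1 : (List.ofFn fun i => der k (a i)).prod =
        derProd k ((List.ofFn b).map (algebraMap B A)) := by
      rw [derProd, List.map_ofFn, List.map_ofFn]
      congr 2
      funext i
      simp [hb]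
    have h2 : r • incl k (algebraMap B A b₀) = inclB k A (r • b₀) := by
      rw [inclB, Algebra.algebraMap_eq_smul_one (r • b₀), smul_assoc, map_smul,
        ← Algebra.algebraMap_eq_smul_one]
    rw [h1, ← smul_mul_assoc, h2]
    exact word _ _ (List.length_ofFn)
  · intro r; rwa [smul_zero]
  · intro x y _ _ hx hy r
    rw [smul_add]; exact add _ _ (hx r) (hy r)
  · intro a x _ hx r
    rw [smul_smul]; exact hx _

theorem map_eq_zero_of_mem_commIdeal {T : Type*} [Ring T] {f : Forms k A →+* T}
    (h0 : ∀ (a : A) (b : B), f (der k a) * f (inclB k A b) = f (inclB k A b) * f (der k a))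
    (h1 : ∀ (a : A) (b : B), f (der k a) * f (derB k A b) = -(f (derB k A b) * f (der k a)))
    {x : Forms k A} (hx : x ∈ commIdeal k B A) : f x = 0 := by
  refine sideIdeal_span_induction (P := fun x => f x = 0) ?_ (map_zero f)
    (fun x y hx hy => by rw [map_add, hx, hy, add_zero]) (mem_sideIdeal.2 hx)
  rintro u _ ⟨p, q, w, e, hw, he, rfl⟩ v
  have key : f w * f e = (-1 : ℤ) ^ (p * q) • (f e * f w) := by
    refine formsOn_range_induction (P := fun e => f w * f e = (-1 : ℤ) ^ (p * q) • (f e * f w))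
      (by simp) ?_ (fun x y hx hy => by rw [map_add, mul_add, add_mul, hx, hy, smul_add]) he
    rintro b l rfl
    clear he
    have hl : f w * f (derProd k (l.map (algebraMap B A))) = (-1 : ℤ) ^ (p * l.length) •
        (f (derProd k (l.map (algebraMap B A))) * f w) := by
      induction l with
      | nil => simp
      | cons c l ih =>
        have h := (map_commute_of_generators h0 h1 c w).2
        rw [parity_of_mem hw, map_zsmul, smul_mul_assoc] at h
        have h' : f w * f (derB k A c) = (-1 : ℤ) ^ p • (f (derB k A c) * f w) := by
          rw [h, smul_smul, ← mul_pow]; simp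
        rw [List.map_cons, derProd_cons, map_mul, ← mul_assoc, h', smul_mul_assoc, mul_assoc,
          ih, mul_smul_comm, smul_smul, ← pow_add, mul_assoc, List.length_cons, mul_add,
          mul_one, add_comm p]
    rw [map_mul, ← mul_assoc, ← (map_commute_of_generators h0 h1 b w).1, mul_assoc, hl,
      mul_smul_comm, mul_assoc]
  rw [map_mul, map_mul, map_sub, map_mul, map_zsmul, map_mul, key, sub_self, mul_zero, zero_mul]

end CommIdeal

section SuperQuotient

variable (k B A : Type*) [CommRing k] [CommRing B] [Ring A] [Algebra k B] [Algebra k A]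
  [Algebra B A] [IsScalarTower k B A]

/-- The submodule `commIdeal` of `Ω A` as an ideal. -/
def commutatorIdeal : Ideal (Forms k A) :=
  sideIdeal (Submodule.span k {x | ∃ (p q : ℕ) (w e : Forms k A), w ∈ formsDeg k A p ∧
    e ∈ formsOn k (Set.range (algebraMap B A)) q ∧ x = w * e - (-1 : ℤ) ^ (p * q) • (e * w)})

instance : (commutatorIdeal k B A).IsTwoSided :=
  inferInstanceAs (sideIdeal _).IsTwoSided

/-- The projection of `Ω A` onto `Ωᴮ A`. -/
def toSuper : Forms k A →+* Forms k A ⧸ commutatorIdeal k B A := Ideal.Quotient.mk _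

variable {k B A}

theorem toSuper_eq_zero_iff {x : Forms k A} : toSuper k B A x = 0 ↔ x ∈ commIdeal k B A :=
  Ideal.Quotient.eq_zero_iff_mem

theorem toSuper_eq_iff {x y : Forms k A} :
    toSuper k B A x = toSuper k B A y ↔ x - y ∈ commIdeal k B A := by
  rw [← toSuper_eq_zero_iff, map_sub, sub_eq_zero]

theorem commIdeal_mul_left (w : Forms k A) {x : Forms k A} (hx : x ∈ commIdeal k B A) :
    w * x ∈ commIdeal k B A := by
  rw [← toSuper_eq_zero_iff] at hx ⊢
  rw [map_mul, hx, mul_zero]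

theorem commIdeal_mul_right (w : Forms k A) {x : Forms k A} (hx : x ∈ commIdeal k B A) :
    x * w ∈ commIdeal k B A := by
  rw [← toSuper_eq_zero_iff] at hx ⊢
  rw [map_mul, hx, zero_mul]

theorem inclB_mem_formsOn (b : B) : inclB k A b ∈ formsOn k (Set.range (algebraMap B A)) 0 :=
  Submodule.subset_span ⟨algebraMap B A b, Fin.elim0, ⟨b, rfl⟩, fun i => i.elim0, by simp⟩

theorem derB_mem_formsOn (b : B) : derB k A b ∈ formsOn k (Set.range (algebraMap B A)) 1 :=
  Submodule.subset_span ⟨1, fun _ => algebraMap B A b, ⟨1, map_one _⟩, fun _ => ⟨b, rfl⟩, by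
    simp [incl_one]⟩

theorem toSuper_der_mul_inclB (a : A) (b : B) :
    toSuper k B A (der k a) * toSuper k B A (inclB k A b) =
      toSuper k B A (inclB k A b) * toSuper k B A (der k a) := by
  rw [← map_mul, ← map_mul, toSuper_eq_iff]
  exact subset_sideIdeal (Submodule.subset_span
    ⟨1, 0, _, _, der_mem_formsDeg a, inclB_mem_formsOn b, by simp⟩)

theorem toSuper_der_mul_derB (a : A) (b : B) :
    toSuper k B A (der k a) * toSuper k B A (derB k A b) =
      -(toSuper k B A (derB k A b) * toSuper k B A (der k a)) := by
  rw [← map_mul (toSuper k B A), ← map_mul (toSuper k B A), ← map_neg (toSuper k B A),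
    toSuper_eq_iff]
  exact subset_sideIdeal (Submodule.subset_span
    ⟨1, 1, _, _, der_mem_formsDeg a, derB_mem_formsOn b, by simp⟩)

theorem toSuper_inclB_mul (b : B) (w : Forms k A) :
    toSuper k B A (inclB k A b) * toSuper k B A w =
      toSuper k B A w * toSuper k B A (inclB k A b) :=
  (map_commute_of_generators toSuper_der_mul_inclB toSuper_der_mul_derB b w).1

theorem toSuper_derB_mul (b : B) (w : Forms k A) :
    toSuper k B A (derB k A b) * toSuper k B A w =
      toSuper k B A (parity k A w) * toSuper k B A (derB k A b) :=
  (map_commute_of_generators toSuper_der_mul_inclB toSuper_der_mul_derB b w).2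

theorem toSuper_mul_derB (b : B) (w : Forms k A) :
    toSuper k B A w * toSuper k B A (derB k A b) =
      toSuper k B A (derB k A b) * toSuper k B A (parity k A w) := by
  rw [toSuper_derB_mul, parity_parity]

theorem parity_mem_commIdeal {x : Forms k A} (hx : x ∈ commIdeal k B A) :
    parity k A x ∈ commIdeal k B A := by
  rw [← toSuper_eq_zero_iff]
  refine map_eq_zero_of_mem_commIdeal (f := (toSuper k B A).comp (parity k A).toRingHom)
    (fun a b => ?_) (fun a b => ?_) hx
  · simp [toSuper_der_mul_inclB]
  · simp [toSuper_der_mul_derB]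

theorem deRham_mem_commIdeal {x : Forms k A} (hx : x ∈ commIdeal k B A) :
    deRham k A x ∈ commIdeal k B A := by
  have h := map_eq_zero_of_mem_commIdeal (B := B)
    (f := (toSuper k B A).mapMatrix.comp (deRhamMatrix k A).toRingHom) (fun a b => ?_)
    (fun a b => ?_) hx
  · rw [← toSuper_eq_zero_iff]
    exact congrFun (congrFun h 0) 1
  · ext i j
    fin_cases i <;> fin_cases j <;>
      simp [deRhamMatrix_eq, Matrix.mul_apply, toSuper_der_mul_inclB, toSuper_der_mul_derB]
  · ext i j
    fin_cases i <;> fin_cases j <;>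
      simp [deRhamMatrix_eq, Matrix.mul_apply, toSuper_der_mul_derB]

/-- The ideal `commIdeal` is generated by the supercommutators of `da` with `b` and with `db`. -/
theorem commIdeal_induction {P : Forms k A → Prop} (zero : P 0)
    (add : ∀ x y, P x → P y → P (x + y))
    (comm : ∀ (p q : ℕ) (u v : Forms k A) (a : A) (b : B), u ∈ formsDeg k A p →
      v ∈ formsDeg k A q → P (u * (der k a * inclB k A b - inclB k A b * der k a) * v))
    (anti : ∀ (p q : ℕ) (u v : Forms k A) (a : A) (b : B), u ∈ formsDeg k A p →
      v ∈ formsDeg k A q → P (u * (der k a * derB k A b + derB k A b * der k a) * v))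
    {x : Forms k A} (hx : x ∈ commIdeal k B A) : P x := by
  set s : Set (Forms k A) :=
    {x | (∃ (a : A) (b : B), x = der k a * inclB k A b - inclB k A b * der k a) ∨
      ∃ (a : A) (b : B), x = der k a * derB k A b + derB k A b * der k a}
  have hxs : x ∈ sideIdeal (Submodule.span k s) := by
    rw [← Ideal.Quotient.eq_zero_iff_mem]
    refine map_eq_zero_of_mem_commIdeal (f := Ideal.Quotient.mk (sideIdeal (Submodule.span k s)))
      (fun a b => ?_) (fun a b => ?_) hx
    · rw [← map_mul, ← map_mul, Ideal.Quotient.eq]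
      exact subset_sideIdeal (Submodule.subset_span (Or.inl ⟨a, b, rfl⟩))
    · rw [← map_mul (Ideal.Quotient.mk _), ← map_mul (Ideal.Quotient.mk _),
        ← map_neg (Ideal.Quotient.mk _), Ideal.Quotient.eq, sub_neg_eq_add]
      exact subset_sideIdeal (Submodule.subset_span (Or.inr ⟨a, b, rfl⟩))
  refine sideIdeal_span_induction ?_ zero add hxs
  intro u y hy v
  induction u using Forms.homogeneous_induction with
  | hom p u hu =>
    induction v using Forms.homogeneous_induction with
    | hom q v hv =>
      obtain ⟨a, b, rfl⟩ | ⟨a, b, rfl⟩ := hy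
      · exact comm p q u v a b hu hv
      · exact anti p q u v a b hu hv
    | add v v' h h' => rw [mul_add]; exact add _ _ h h'
  | add u u' h h' => rw [add_mul, add_mul]; exact add _ _ h h'

theorem flipMul_mul_one_tmul_mem {n : ℕ} (z : Forms k A ⊗[k] Forms k A) {c : Forms k A}
    (hc : c ∈ commIdeal k B A) : flipMul k A n (z * (1 ⊗ₜ c)) ∈ commIdeal k B A := by
  induction z with
  | zero => simp
  | tmul x y =>
    rw [Algebra.TensorProduct.tmul_mul_tmul, flipMul_tmul]
    exact commIdeal_mul_right _ (commIdeal_mul_left _ hc)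
  | add x y hx hy => rw [add_mul, map_add]; exact add_mem hx hy

theorem parity_pow_of_mem {p : ℕ} {w : Forms k A} (hw : w ∈ formsDeg k A p) (n : ℕ) :
    (parity k A ^ n) w = (-1 : ℤ) ^ (n * p) • w := by
  induction n with
  | zero => simp
  | succ n ih =>
    rw [pow_succ', AlgHom.mul_apply, ih, map_zsmul, parity_of_mem hw, smul_smul, ← pow_add,
      Nat.succ_mul]

theorem parity_pow_mem_commIdeal (n : ℕ) {c : Forms k A} (hc : c ∈ commIdeal k B A) :
    (parity k A ^ n) c ∈ commIdeal k B A := by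
  induction n with
  | zero => exact hc
  | succ n ih => rw [pow_succ']; exact parity_mem_commIdeal ih

theorem flipMul_tmul_one_mul_mem {n : ℕ} (z : Forms k A ⊗[k] Forms k A) {c : Forms k A}
    (hc : c ∈ commIdeal k B A) : flipMul k A n ((c ⊗ₜ 1) * z) ∈ commIdeal k B A := by
  induction z with
  | zero => simp
  | tmul x y =>
    rw [Algebra.TensorProduct.tmul_mul_tmul, flipMul_tmul, map_mul]
    exact commIdeal_mul_left _ (commIdeal_mul_right _ (parity_pow_mem_commIdeal n hc))
  | add x y hx hy => rw [mul_add, map_add]; exact add_mem hx hy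

/-- Modulo supercommutators the reduced contraction of `u X v`, for `X` a supercommutator, is
given by the contraction of `X` alone. -/
theorem redContraction_mul_mul_sub_mem {n : ℕ} (u v : Forms k A) {X : Forms k A}
    (hX : X ∈ commIdeal k B A) :
    redContraction k A n (u * X * v) -
      flipMul k A n ((parity k A u ⊗ₜ 1) * doubleContraction k A X * (1 ⊗ₜ v)) ∈
        commIdeal k B A := by
  rw [redContraction_apply, doubleContraction_mul, doubleContraction_mul, add_mul, mul_assoc,
    Algebra.TensorProduct.tmul_mul_tmul, one_mul, map_add, map_add]
  have h1 := flipMul_mul_one_tmul_mem (n := n) (doubleContraction k A u) (commIdeal_mul_right v hX)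
  have h2 := flipMul_tmul_one_mul_mem (n := n) (doubleContraction k A v)
    (parity_mem_commIdeal (commIdeal_mul_left u hX))
  convert add_mem h1 h2 using 1
  abel

theorem toSuper_inclB_mul_mul (b : B) (x w : Forms k A) :
    toSuper k B A (inclB k A b) * (toSuper k B A x * toSuper k B A w) =
      toSuper k B A x * (toSuper k B A (inclB k A b) * toSuper k B A w) := by
  rw [← mul_assoc, toSuper_inclB_mul, mul_assoc]

theorem toSuper_redContraction_commutator {n : ℕ} (u v : Forms k A) (a : A) (b : B) :
    toSuper k B A (redContraction k A n
      (u * (der k a * inclB k A b - inclB k A b * der k a) * v)) = 0 := by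
  have hX : der k a * inclB k A b - inclB k A b * der k a ∈ commIdeal k B A := by
    rw [← toSuper_eq_zero_iff, map_sub, map_mul, map_mul, toSuper_der_mul_inclB, sub_self]
  rw [toSuper_eq_iff.2 (redContraction_mul_mul_sub_mem u v hX)]
  have hp : ∀ a : A, (parity k A ^ n) (incl k a) = incl k a := fun a => by
    rw [parity_pow_of_mem (incl_mem_formsDeg a)]; simp
  simp only [map_sub, doubleContraction_mul, doubleContraction_incl, doubleContraction_der,
    zero_mul, zero_add, mul_zero, add_zero, sub_mul, mul_sub, parity_incl,
    Algebra.TensorProduct.tmul_mul_tmul, one_mul, mul_one, flipMul_tmul, map_mul, hp]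
  have h := toSuper_inclB_mul b (v * (parity k A ^ n) (parity k A u))
  rw [map_mul] at h
  linear_combination (norm := noncomm_ring)
    toSuper k B A (incl k a) * h - h * toSuper k B A (incl k a)

/-- The hypothesis `hw` says that `v u` has the parity of `n`. It holds when `u X v` is of degree `n`,
as `X` is even. -/
theorem toSuper_redContraction_anticommutator {n : ℕ} (u v : Forms k A) (a : A) (b : B)
    (hw : parity k A (v * (parity k A ^ n) (parity k A u)) =
      (-1 : ℤ) ^ n • (v * (parity k A ^ n) (parity k A u))) :
    toSuper k B A (redContraction k A n
      (u * (der k a * derB k A b + derB k A b * der k a) * v)) = 0 := by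
  have hX : der k a * derB k A b + derB k A b * der k a ∈ commIdeal k B A := by
    rw [← toSuper_eq_zero_iff, map_add, map_mul, map_mul, toSuper_der_mul_derB, neg_add_cancel]
  rw [toSuper_eq_iff.2 (redContraction_mul_mul_sub_mem u v hX)]
  have hp : ∀ a : A, (parity k A ^ n) (incl k a) = incl k a := fun a => by
    rw [parity_pow_of_mem (incl_mem_formsDeg a)]; simp
  have hd : ∀ a : A, (parity k A ^ n) (der k a) = (-1 : ℤ) ^ n • der k a := fun a => by
    rw [parity_pow_of_mem (der_mem_formsDeg a)]; simp
  simp only [map_add, map_sub, doubleContraction_mul, doubleContraction_der, add_mul, mul_add,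
    sub_mul, mul_sub, parity_der, Algebra.TensorProduct.tmul_mul_tmul, one_mul, mul_one,
    flipMul_tmul, map_mul, hp, map_neg, hd, map_zsmul]
  have h1 := toSuper_derB_mul b (v * (parity k A ^ n) (parity k A u))
  rw [hw, map_zsmul, map_mul, smul_mul_assoc] at h1
  have h2 := toSuper_inclB_mul b (v * (parity k A ^ n) (parity k A u))
  rw [map_mul] at h2
  have h3 := toSuper_inclB_mul b (der k a)
  generalize toSuper k B A v = V at *
  generalize toSuper k B A ((parity k A ^ n) (parity k A u)) = U at *
  generalize toSuper k B A (der k a) = D at *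
  generalize toSuper k B A (incl k a) = α at *
  generalize hs : ((-1 : ℤ) ^ n) = s at *
  linear_combination (norm := skip) α * h1 - h1 * α + h3 * (V * U) + D * h2
    - s * (h2 * D + (V * U) * h3)
  obtain rfl | rfl : s = 1 ∨ s = -1 := hs ▸ neg_one_pow_eq_or ℤ n
  · simp only [Int.cast_one]; noncomm_ring
  · simp only [Int.cast_one, Int.cast_neg]; noncomm_ring

theorem commutator_mem_formsDeg (a : A) (b : B) :
    der k a * inclB k A b - inclB k A b * der k a ∈ formsDeg k A 1 :=
      sub_mem
        (by have h := mul_mem_formsDeg (der_mem_formsDeg (R := k) a)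
              (incl_mem_formsDeg (R := k) (algebraMap B A b))
            rwa [add_zero] at h)
        (by have h := mul_mem_formsDeg (incl_mem_formsDeg (R := k) (algebraMap B A b))
              (der_mem_formsDeg (R := k) a)
            rwa [zero_add] at h)

theorem anticommutator_mem_formsDeg (a : A) (b : B) :
    der k a * derB k A b + derB k A b * der k a ∈ formsDeg k A 2 :=
      add_mem
        (by have h := mul_mem_formsDeg (der_mem_formsDeg (R := k) a)
              (der_mem_formsDeg (R := k) (algebraMap B A b))
            rwa [one_add_one_eq_two] at h)
        (by have h := mul_mem_formsDeg (der_mem_formsDeg (R := k) (algebraMap B A b))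
              (der_mem_formsDeg (R := k) a)
            rwa [one_add_one_eq_two] at h)

theorem redContraction_projDeg_mem_commIdeal (n : ℕ) {c : Forms k A} (hc : c ∈ commIdeal k B A) :
    redContraction k A n (projDeg k A n c) ∈ commIdeal k B A := by
  refine commIdeal_induction (P := fun c => redContraction k A n (projDeg k A n c) ∈
    commIdeal k B A) ?_ ?_ ?_ ?_ hc
  · rw [map_zero, map_zero]; exact zero_mem _
  · intro x y hx hy
    rw [map_add, map_add]; exact add_mem hx hy
  · intro p q u v a b hu hv
    rw [projDeg_of_mem (mul_mem_formsDeg (mul_mem_formsDeg hu (commutator_mem_formsDeg a b)) hv)]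
    split_ifs with h
    · exact toSuper_eq_zero_iff.1 (toSuper_redContraction_commutator u v a b)
    · rw [map_zero]; exact zero_mem _
  · intro p q u v a b hu hv
    rw [projDeg_of_mem (mul_mem_formsDeg (mul_mem_formsDeg hu (anticommutator_mem_formsDeg a b)) hv)]
    split_ifs with h
    · refine toSuper_eq_zero_iff.1 (toSuper_redContraction_anticommutator u v a b ?_)
      have hu' : parity k A u ∈ formsDeg k A p := by
        rw [parity_of_mem hu]; exact zsmul_mem hu _
      have hu'' : (parity k A ^ n) (parity k A u) ∈ formsDeg k A p := by
        rw [parity_pow_of_mem hu']; exact zsmul_mem hu' _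
      have hs : (-1 : ℤ) ^ n = (-1) ^ (q + p) := by
        rw [← h, show p + 2 + q = q + p + 2 by ring, pow_add _ (q + p) 2, neg_one_sq, mul_one]
      rw [parity_of_mem (mul_mem_formsDeg hv hu''), hs]
    · rw [map_zero]; exact zero_mem _

/-- The reduced contraction descends to `Ωᴮ A`. -/
theorem redContraction_mem_commIdeal {n : ℕ} {c : Forms k A} (hc : c ∈ commIdeal k B A)
    (hn : c ∈ formsDeg k A n) : redContraction k A n c ∈ commIdeal k B A := by
  have h := redContraction_projDeg_mem_commIdeal n hc
  rwa [projDeg_self hn] at h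

theorem projDeg_mem_commIdeal (n : ℕ) {c : Forms k A} (hc : c ∈ commIdeal k B A) :
    projDeg k A n c ∈ commIdeal k B A := by
  have hcomm : ∀ (a : A) (b : B), der k a * inclB k A b - inclB k A b * der k a ∈ commIdeal k B A :=
    fun a b => by
      rw [← toSuper_eq_zero_iff, map_sub, map_mul, map_mul, toSuper_der_mul_inclB, sub_self]
  have hanti : ∀ (a : A) (b : B), der k a * derB k A b + derB k A b * der k a ∈ commIdeal k B A :=
    fun a b => by
      rw [← toSuper_eq_zero_iff, map_add, map_mul, map_mul, toSuper_der_mul_derB, neg_add_cancel]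
  refine commIdeal_induction (P := fun c => projDeg k A n c ∈ commIdeal k B A) ?_ ?_ ?_ ?_ hc
  · rw [map_zero]; exact zero_mem _
  · intro x y hx hy
    rw [map_add]; exact add_mem hx hy
  · intro p q u v a b hu hv
    have h := commIdeal_mul_right v (commIdeal_mul_left u (hcomm a b))
    rw [projDeg_of_mem (mul_mem_formsDeg (mul_mem_formsDeg hu (commutator_mem_formsDeg a b)) hv)]
    split_ifs
    exacts [h, zero_mem _]
  · intro p q u v a b hu hv
    have h := commIdeal_mul_right v (commIdeal_mul_left u (hanti a b))
    rw [projDeg_of_mem (mul_mem_formsDeg (mul_mem_formsDeg hu (anticommutator_mem_formsDeg a b)) hv)]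
    split_ifs
    exacts [h, zero_mem _]

/-- On `Ωᴮ A` the reduced contraction is linear over the base. -/
theorem toSuper_redContraction_inclB_mul (n : ℕ) (b : B) (y : Forms k A) :
    toSuper k B A (redContraction k A n (inclB k A b * y)) =
      toSuper k B A (inclB k A b) * toSuper k B A (redContraction k A n y) := by
  rw [redContraction_apply, redContraction_apply, doubleContraction_mul, doubleContraction_incl,
    zero_mul, zero_add, parity_incl]
  induction doubleContraction k A y with
  | zero => simp
  | tmul x z =>
    rw [Algebra.TensorProduct.tmul_mul_tmul, one_mul, flipMul_tmul, flipMul_tmul, map_mul, map_mul,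
      map_mul, map_mul, parity_pow_of_mem (incl_mem_formsDeg _), mul_zero, pow_zero, one_smul,
      toSuper_inclB_mul_mul]
  | add x z hx hz => simp only [mul_add, map_add, hx, hz]

/-- On `Ωᴮ A` the reduced contraction anticommutes with multiplication by `db`, and so it preserves
the filtration. -/
theorem toSuper_redContraction_derB_mul {n : ℕ} (b : B) {y : Forms k A}
    (hy : y ∈ formsDeg k A n) :
    toSuper k B A (redContraction k A (n + 1) (derB k A b * y)) =
      -(toSuper k B A (derB k A b) * toSuper k B A (redContraction k A n y)) := by
  have key : ∀ z : Forms k A ⊗[k] Forms k A,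
      toSuper k B A (flipMul k A (n + 1) ((derB k A b ⊗ₜ 1) * z)) = (-1 : ℤ) ^ (n + 1) •
        (toSuper k B A (derB k A b) * toSuper k B A (parity k A (flipMul k A n z))) := by
    intro z
    induction z with
    | zero => simp
    | tmul x z =>
      rw [Algebra.TensorProduct.tmul_mul_tmul, one_mul, flipMul_tmul, flipMul_tmul, map_mul,
        map_mul (parity k A ^ (n + 1)), parity_pow_of_mem (der_mem_formsDeg _), mul_one,
        smul_mul_assoc, map_zsmul, mul_smul_comm,
        map_mul (toSuper k B A), ← mul_assoc, toSuper_mul_derB, map_mul, map_mul, mul_assoc,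
        pow_succ' (parity k A), AlgHom.mul_apply]
    | add x z hx hz => simp only [mul_add, map_add, hx, hz, smul_add]
  have hpar : parity k A (redContraction k A n y) = (-1 : ℤ) ^ (n + 1) • redContraction k A n y := by
    cases n with
    | zero =>
      obtain ⟨a, rfl⟩ := formsDeg_zero hy
      simp [redContraction_apply, doubleContraction_incl]
    | succ n =>
      rw [parity_of_mem (redContraction_mem_formsDeg hy), pow_add _ n 2, neg_one_sq, mul_one]
  have h0 : flipMul k A (n + 1) ((1 ⊗ₜ inclB k A b - inclB k A b ⊗ₜ 1) * (1 ⊗ₜ y)) =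
      inclB k A b * y - y * inclB k A b := by
    rw [sub_mul, Algebra.TensorProduct.tmul_mul_tmul, Algebra.TensorProduct.tmul_mul_tmul, map_sub,
      flipMul_tmul, flipMul_tmul, one_mul, one_mul, mul_one, map_one, mul_one,
      parity_pow_of_mem (incl_mem_formsDeg _), mul_zero, pow_zero, one_smul]
  rw [redContraction_apply, doubleContraction_mul, doubleContraction_der, map_add, h0, parity_der,
    TensorProduct.neg_tmul, neg_mul, map_neg, map_add, map_neg, key, ← redContraction_apply, hpar,
    map_sub, map_mul, map_mul, toSuper_inclB_mul, sub_self, zero_add, map_zsmul, mul_smul_comm,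
    smul_smul, ← mul_pow]
  simp

end SuperQuotient

/-! ### The first steps of the filtration -/

section FirstFiltration

variable {k B A : Type*} [CommRing k] [CommRing B] [Ring A] [Algebra k B] [Algebra k A]
  [Algebra B A] [IsScalarTower k B A]

theorem filtration_one : filtration k B A 1 = commIdeal k B A ⊔ diffIdeal k B A := by
  rw [filtration, zero_add, pow_one]

theorem toRelative_inclB (b : B) : toRelative k B A (inclB k A b) = algebraMap B _ b := by
  rw [inclB, toRelative_incl, incl_algebraMap]

theorem toRelative_derB (b : B) : toRelative k B A (derB k A b) = 0 := by
  rw [derB, toRelative_der, der_algebraMap]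

theorem toRelative_inclB_mul (b : B) (w : Forms k A) :
    toRelative k B A (inclB k A b * w) = b • toRelative k B A w := by
  rw [map_mul, toRelative_inclB, Algebra.smul_def]

theorem toRelative_eq_zero_of_mem_commIdeal {x : Forms k A} (hx : x ∈ commIdeal k B A) :
    toRelative k B A x = 0 :=
  map_eq_zero_of_mem_commIdeal (B := B) (f := (toRelative k B A).toRingHom)
    (fun a b => by
      change toRelative k B A _ * toRelative k B A _ = toRelative k B A _ * toRelative k B A _
      rw [toRelative_inclB, Algebra.commutes])
    (fun a b => by
      change toRelative k B A _ * toRelative k B A _ = -(toRelative k B A _ * toRelative k B A _)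
      rw [toRelative_derB, mul_zero, zero_mul, neg_zero]) hx

theorem toRelative_eq_zero_of_mem_diffIdeal {x : Forms k A} (hx : x ∈ diffIdeal k B A) :
    toRelative k B A x = 0 := by
  refine sideIdeal_span_induction (P := fun x => toRelative k B A x = 0) ?_ (map_zero _)
    (fun x y hx hy => by rw [map_add, hx, hy, add_zero]) (mem_sideIdeal.2 hx)
  rintro u _ ⟨b, rfl⟩ v
  rw [map_mul, map_mul]
  change _ * toRelative k B A (derB k A b) * _ = _
  rw [toRelative_derB, mul_zero, zero_mul]

/-- The kernel of the projection to relative forms: over the quotient by the two ideals the base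
is central and `d` is linear over it, so that relative forms map back to it. -/
theorem toRelative_eq_zero_iff {x : Forms k A} :
    toRelative k B A x = 0 ↔ x ∈ filtration k B A 1 := by
  rw [filtration_one]
  refine ⟨fun hx => ?_, fun hx => ?_⟩
  swap
  · obtain ⟨c, hc, y, hy, rfl⟩ := Submodule.mem_sup.1 hx
    rw [map_add, toRelative_eq_zero_of_mem_commIdeal hc, toRelative_eq_zero_of_mem_diffIdeal hy,
      add_zero]
  set S : Submodule k (Forms k A) := Submodule.span k {x | ∃ (p q : ℕ) (w e : Forms k A),
    w ∈ formsDeg k A p ∧ e ∈ formsOn k (Set.range (algebraMap B A)) q ∧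
      x = w * e - (-1 : ℤ) ^ (p * q) • (e * w)} with hS
  set S' : Submodule k (Forms k A) :=
    Submodule.span k (Set.range fun b : B => der k (algebraMap B A b)) with hS'
  have hI : commIdeal k B A ⊔ diffIdeal k B A = ⊤ * (S ⊔ S') * ⊤ := by
    rw [Submodule.mul_sup, Submodule.sup_mul]; rfl
  rw [hI, ← mem_sideIdeal, ← Ideal.Quotient.eq_zero_iff_mem]
  set π : Forms k A →+* Forms k A ⧸ sideIdeal (S ⊔ S') := Ideal.Quotient.mk _ with hπ
  have hcomm : ∀ y ∈ commIdeal k B A, π y = 0 := fun y hy =>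
    Ideal.Quotient.eq_zero_iff_mem.2 (by rw [mem_sideIdeal, ← hI]; exact Submodule.mem_sup_left hy)
  have hder : ∀ b : B, π (derB k A b) = 0 := fun b =>
    Ideal.Quotient.eq_zero_iff_mem.2
      (subset_sideIdeal (Submodule.mem_sup_right (Submodule.subset_span ⟨b, rfl⟩)))
  have hcent : ∀ (b : B) (w : Forms k A), π (inclB k A b) * π w = π w * π (inclB k A b) :=
    fun b w => by
      have h := toSuper_inclB_mul b w
      rw [← map_mul, ← map_mul, toSuper_eq_iff] at h
      rw [← sub_eq_zero, ← map_mul, ← map_mul, ← map_sub]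
      exact hcomm _ h
  let i : B →+* Forms k A ⧸ sideIdeal (S ⊔ S') :=
    { toFun := fun b => π (inclB k A b)
      map_one' := by rw [inclB, map_one, incl_one, map_one]
      map_mul' := fun b c => by rw [inclB, map_mul, incl_mul, map_mul]
      map_zero' := by rw [inclB, map_zero, map_zero, map_zero]
      map_add' := fun b c => by rw [inclB, map_add, map_add, map_add] }
  let _ : Algebra B (Forms k A ⧸ sideIdeal (S ⊔ S')) := i.toAlgebra' fun b w => by
    obtain ⟨w, rfl⟩ := Ideal.Quotient.mk_surjective w
    exact hcent b w
  have hsmul : ∀ (b : B) (w : Forms k A), b • π w = π (inclB k A b * w) := fun b w => by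
    rw [Algebra.smul_def, map_mul]; rfl
  let f : A →ₗ[B] Forms k A ⧸ sideIdeal (S ⊔ S') :=
    { toFun := fun a => π (incl k a)
      map_add' := fun a b => by rw [map_add, map_add]
      map_smul' := fun b a => by
        rw [Algebra.smul_def, incl_mul, RingHom.id_apply, hsmul] }
  let δ : A →ₗ[B] Forms k A ⧸ sideIdeal (S ⊔ S') :=
    { toFun := fun a => π (der k a)
      map_add' := fun a b => by rw [map_add, map_add]
      map_smul' := fun b a => by
        rw [Algebra.smul_def, der_mul, RingHom.id_apply, hsmul, map_add, map_mul π (der k _)]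
        change _ + π (derB k A b) * _ = _
        rw [hder, zero_mul, add_zero] }
  let g := liftForms B f δ (by change π _ = 1; rw [incl_one, map_one])
    (fun a b => by change π _ = π _ * π _; rw [incl_mul, map_mul])
    (fun a b => by
      change π _ = π _ * π _ + π _ * π _
      rw [der_mul, map_add, map_mul, map_mul])
  have hg : ∀ w, g (toRelative k B A w) = π w := fun w => by
    induction w using Forms.induction with
    | hincl a => rw [toRelative_incl]; exact liftForms_incl B f δ _ _ _ a
    | hder a => rw [toRelative_der]; exact liftForms_der B f δ _ _ _ a
    | hmul x y hx hy => rw [map_mul, map_mul, hx, hy, map_mul]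
    | hadd x y hx hy => rw [map_add, map_add, hx, hy, map_add]
  rw [← hg, hx, map_zero]

variable (k B A) in
/-- The linear map `b ⊗ y ↦ db · y`. -/
def mulDer : B ⊗[k] Forms k A →ₗ[k] Forms k A :=
  TensorProduct.lift (LinearMap.mul k (Forms k A) ∘ₗ der k ∘ₗ
    (IsScalarTower.toAlgHom k B A).toLinearMap)

variable (A) in
/-- The linear map `b ⊗ y ↦ θ(b) y`, the contraction of `db · y` with `θ`. -/
def mulDerivation (θ : Derivation k B B) : B ⊗[k] Forms k A →ₗ[k] Forms k A :=
  TensorProduct.lift (LinearMap.mul k (Forms k A) ∘ₗ incl k ∘ₗ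
    (IsScalarTower.toAlgHom k B A).toLinearMap ∘ₗ θ.toLinearMap)

theorem mulDer_tmul (b : B) (y : Forms k A) : mulDer k B A (b ⊗ₜ y) = derB k A b * y := rfl

theorem mulDerivation_tmul (θ : Derivation k B B) (b : B) (y : Forms k A) :
    mulDerivation A θ (b ⊗ₜ y) = inclB k A (θ b) * y := rfl

theorem mulDerivation_add (θ η : Derivation k B B) (T : B ⊗[k] Forms k A) :
    mulDerivation A (θ + η) T = mulDerivation A θ T + mulDerivation A η T := by
  induction T with
  | zero => simp
  | tmul b y =>
    simp only [mulDerivation_tmul, Derivation.add_apply, inclB, map_add, add_mul]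
  | add x y hx hy => simp only [map_add, hx, hy]; abel

theorem mulDerivation_smul (c : B) (θ : Derivation k B B) (T : B ⊗[k] Forms k A) :
    mulDerivation A (c • θ) T = inclB k A c * mulDerivation A θ T := by
  induction T with
  | zero => simp
  | tmul b y =>
    simp only [mulDerivation_tmul, Derivation.smul_apply, inclB, smul_eq_mul, map_mul, incl_mul,
      mul_assoc]
  | add x y hx hy => simp only [map_add, hx, hy, mul_add]

/-- Modulo supercommutators every form in the ideal of `dB` is a sum of products `db · y`. -/
theorem exists_sub_mulDer_mem {x : Forms k A} (hx : x ∈ filtration k B A 1) :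
    ∃ T, x - mulDer k B A T ∈ commIdeal k B A := by
  rw [filtration_one] at hx
  obtain ⟨c, hc, y, hy, rfl⟩ := Submodule.mem_sup.1 hx
  suffices h : ∃ T, y - mulDer k B A T ∈ commIdeal k B A by
    obtain ⟨T, hT⟩ := h
    exact ⟨T, by rw [add_sub_assoc]; exact add_mem hc hT⟩
  refine sideIdeal_span_induction (P := fun y => ∃ T, y - mulDer k B A T ∈ commIdeal k B A) ?_
    ⟨0, by simp⟩ ?_ (mem_sideIdeal.2 hy)
  · rintro u _ ⟨b, rfl⟩ v
    refine ⟨b ⊗ₜ (parity k A u * v), ?_⟩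
    rw [mulDer_tmul, ← toSuper_eq_iff, map_mul, map_mul]
    change toSuper k B A u * toSuper k B A (derB k A b) * _ = _
    rw [toSuper_mul_derB, map_mul, map_mul, mul_assoc]
  · rintro x y ⟨T, hT⟩ ⟨T', hT'⟩
    refine ⟨T + T', ?_⟩
    rw [map_add, add_sub_add_comm]; exact add_mem hT hT'

theorem mulDer_lTensor_projDeg (p : ℕ) (T : B ⊗[k] Forms k A) :
    mulDer k B A ((projDeg k A p).lTensor B T) = projDeg k A (p + 1) (mulDer k B A T) := by
  induction T with
  | zero => simp
  | tmul b y =>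
    rw [LinearMap.lTensor_tmul, mulDer_tmul, mulDer_tmul, add_comm p,
      projDeg_mul_of_mem (der_mem_formsDeg _)]
  | add x y hx hy => simp only [map_add, hx, hy]

theorem mulDerivation_lTensor_projDeg (θ : Derivation k B B) (p : ℕ) (T : B ⊗[k] Forms k A) :
    mulDerivation A θ ((projDeg k A p).lTensor B T) = projDeg k A p (mulDerivation A θ T) := by
  induction T with
  | zero => simp
  | tmul b y =>
    have h := projDeg_mul_of_mem (n := p) (y := y) (incl_mem_formsDeg (R := k)
      (algebraMap B A (θ b)))
    rw [zero_add] at h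
    rw [LinearMap.lTensor_tmul, mulDerivation_tmul, mulDerivation_tmul, ← h]
  | add x y hx hy => simp only [map_add, hx, hy]

theorem lTensor_projDeg_self (p : ℕ) (T : B ⊗[k] Forms k A) :
    (projDeg k A p).lTensor B ((projDeg k A p).lTensor B T) = (projDeg k A p).lTensor B T := by
  rw [← LinearMap.comp_apply, ← LinearMap.lTensor_comp]
  congr 2
  ext w
  exact projDeg_self (projDeg_mem p w)

theorem exists_sub_mulDer_mem_of_mem_formsDeg {p : ℕ} {x : Forms k A}
    (hx : x ∈ filtration k B A 1) (hp : x ∈ formsDeg k A (p + 1)) :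
    ∃ T, (projDeg k A p).lTensor B T = T ∧ x - mulDer k B A T ∈ commIdeal k B A := by
  obtain ⟨T, hT⟩ := exists_sub_mulDer_mem hx
  refine ⟨_, lTensor_projDeg_self p T, ?_⟩
  have h := projDeg_mem_commIdeal (p + 1) hT
  rwa [map_sub, projDeg_self hp, ← mulDer_lTensor_projDeg] at h

theorem toRelative_baseForms {x : Forms k A} (hx : x ∈ baseForms k B A) :
    toRelative k B A x ∈ Submodule.span B {1} := by
  refine Submodule.iSup_induction _ (motive := fun x => toRelative k B A x ∈ Submodule.span B {1})
    hx (fun q x hx => ?_) (by rw [map_zero]; exact zero_mem _)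
    (fun x y hx hy => by rw [map_add]; exact add_mem hx hy)
  refine formsOn_range_induction (P := fun x => toRelative k B A x ∈ Submodule.span B {1})
    (by rw [map_zero]; exact zero_mem _) ?_
    (fun x y hx hy => by rw [map_add]; exact add_mem hx hy) hx
  rintro b l -
  rw [toRelative_inclB_mul]
  refine Submodule.smul_mem _ _ ?_
  cases l with
  | nil => simp
  | cons c l =>
    rw [List.map_cons, derProd_cons, map_mul]
    change toRelative k B A (derB k A c) * _ ∈ _
    rw [toRelative_derB, zero_mul]
    exact zero_mem _

end FirstFiltration

/-! ### Contraction with derivations of the base -/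

section Contraction

variable {k B A : Type*} [CommRing k] [CommRing B] [Ring A] [Algebra k B] [Algebra k A]
  [Algebra B A] [IsScalarTower k B A]

/-- A contraction of `Ωᴮ A` with the derivation `θ` of the base: a linear map to relative forms
which on the ideal of `dB` is given by `db · y ↦ θ(b) y`. -/
structure IsContraction (θ : Derivation k B B) (C : Forms k A →ₗ[k] Forms B A) : Prop where
  commIdeal : ∀ x ∈ commIdeal k B A, C x = 0
  derB_mul : ∀ (b : B) (y : Forms k A), C (derB k A b * y) = θ b • toRelative k B A y
  inclB_mul : ∀ (b : B) (y : Forms k A), C (inclB k A b * y) = b • C y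
  one : C 1 = 0

namespace IsContraction

variable {θ : Derivation k B B} {C : Forms k A →ₗ[k] Forms B A}

theorem congr (hC : IsContraction θ C) {x y : Forms k A} (h : x - y ∈ NCGM.commIdeal k B A) :
    C x = C y := by
  rw [← sub_eq_zero, ← map_sub, hC.commIdeal _ h]

theorem mulDer (hC : IsContraction θ C) (T : B ⊗[k] Forms k A) :
    C (NCGM.mulDer k B A T) = toRelative k B A (mulDerivation A θ T) := by
  induction T with
  | zero => simp
  | tmul b y => rw [mulDer_tmul, hC.derB_mul, mulDerivation_tmul, toRelative_inclB_mul]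
  | add x y hx hy => simp only [map_add, hx, hy]

theorem eq_of_sub_mulDer_mem (hC : IsContraction θ C) {x : Forms k A} {T : B ⊗[k] Forms k A}
    (h : x - NCGM.mulDer k B A T ∈ NCGM.commIdeal k B A) :
    C x = toRelative k B A (mulDerivation A θ T) := by
  rw [hC.congr h, hC.mulDer]

/-- A contraction kills `F²`. -/
theorem filtration_two (hC : IsContraction θ C) {x : Forms k A} (hx : x ∈ filtration k B A 2) :
    C x = 0 := by
  rw [filtration, one_add_one_eq_two, pow_two] at hx
  obtain ⟨c, hc, y, hy, rfl⟩ := Submodule.mem_sup.1 hx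
  rw [map_add, hC.commIdeal c hc, zero_add]
  refine Submodule.mul_induction_on hy (fun u hu v hv => ?_)
    fun x y hx hy => by rw [map_add, hx, hy, add_zero]
  obtain ⟨T, hT⟩ := exists_sub_mulDer_mem (k := k) (B := B) (x := u)
    (by rw [filtration_one]; exact Submodule.mem_sup_right hu)
  have h := commIdeal_mul_right v hT
  rw [sub_mul] at h
  rw [hC.congr h]
  clear h hT
  induction T with
  | zero => simp
  | tmul b y =>
    rw [mulDer_tmul, mul_assoc, hC.derB_mul, map_mul, toRelative_eq_zero_of_mem_diffIdeal hv,
      mul_zero, smul_zero]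
  | add x y hx hy => rw [map_add, add_mul, map_add, hx, hy, add_zero]

theorem baseForms (hC : IsContraction θ C) {x : Forms k A} (hx : x ∈ NCGM.baseForms k B A) :
    C x ∈ Submodule.span B {1} := by
  refine Submodule.iSup_induction _ (motive := fun x => C x ∈ Submodule.span B {1})
    hx (fun q x hx => ?_) (by rw [map_zero]; exact zero_mem _)
    (fun x y hx hy => by rw [map_add]; exact add_mem hx hy)
  refine formsOn_range_induction (P := fun x => C x ∈ Submodule.span B {1})
    (by rw [map_zero]; exact zero_mem _) ?_
    (fun x y hx hy => by rw [map_add]; exact add_mem hx hy) hx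
  rintro b l -
  rw [hC.inclB_mul]
  refine Submodule.smul_mem _ _ ?_
  cases l with
  | nil =>
    rw [List.map_nil, derProd_nil, hC.one]; exact zero_mem _
  | cons c l =>
    rw [List.map_cons, derProd_cons, ← derB, hC.derB_mul]
    refine Submodule.smul_mem _ _ (toRelative_baseForms ?_)
    refine Submodule.mem_iSup_of_mem l.length (Submodule.subset_span
      ⟨1, fun i => algebraMap B A (l.get i), ⟨1, map_one _⟩, fun i => ⟨_, rfl⟩, ?_⟩)
    rw [incl_one, one_mul, derProd, List.map_map]
    congr 1
    exact (List.ofFn_getElem_eq_map l _).symm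

theorem sub_mem_of_mem_contractionRel (hC : IsContraction θ C) {x y : Forms k A}
    (h : (x, y) ∈ contractionRel k B A θ) : C x - toRelative k B A y ∈ Submodule.span B {1} := by
  obtain ⟨z, hz, w, hw, hzw⟩ := Submodule.mem_sup.1 h
  have h1 : C z.1 - toRelative k B A z.2 = 0 := by
    refine Submodule.span_induction (p := fun z _ => C z.1 - toRelative k B A z.2 = 0)
      ?_ ?_ ?_ ?_ hz
    · rintro _ ⟨b, y, rfl⟩
      change C (derB k A b * y) - toRelative k B A (inclB k A (θ b) * y) = 0
      rw [hC.derB_mul, toRelative_inclB_mul, sub_self]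
    · simp
    · intro z z' _ _ h h'
      rw [Prod.fst_add, Prod.snd_add, map_add, map_add, add_sub_add_comm, h, h', add_zero]
    · intro r z _ h
      rw [Prod.smul_fst, Prod.smul_snd, map_smul, map_smul, ← smul_sub, h, smul_zero]
  obtain ⟨hw1, hw2⟩ := Submodule.mem_prod.1 hw
  have h2 : C w.1 ∈ Submodule.span B {1} := by
    obtain ⟨u, hu, v, hv, huv⟩ := Submodule.mem_sup.1 hw1
    rw [← huv, map_add, hC.filtration_two hu, zero_add]
    exact hC.baseForms hv
  have h3 : toRelative k B A w.2 ∈ Submodule.span B {1} := by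
    obtain ⟨u, hu, v, hv, huv⟩ := Submodule.mem_sup.1 hw2
    rw [← huv, map_add, toRelative_eq_zero_iff.2 hu, zero_add]
    exact toRelative_baseForms hv
  have hx : x = z.1 + w.1 := (congrArg Prod.fst hzw).symm
  have hy : y = z.2 + w.2 := (congrArg Prod.snd hzw).symm
  rw [hx, hy, map_add, map_add, add_sub_add_comm, h1, zero_add]
  exact sub_mem h2 h3

end IsContraction

end Contraction

/-! ### Existence of contractions -/

section Connection

variable {k B : Type*} [CommRing k] [CommRing B] [Algebra k B]

/-- A projective module carries a covariant derivative along every derivation of the base. -/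
theorem exists_covariantDerivative (W : Type*) [AddCommGroup W] [Module B W] [Module k W]
    [IsScalarTower k B W] [Module.Projective B W] (θ : Derivation k B B) :
    ∃ L : W →ₗ[k] W, ∀ (b : B) (w : W), L (b • w) = b • L w + θ b • w := by
  obtain ⟨s, hs⟩ := (Module.projective_def (R := B) (P := W)).1 inferInstance
  let D : (W →₀ B) →ₗ[k] (W →₀ B) := Finsupp.mapRange.linearMap θ.toLinearMap
  have hD : ∀ (b : B) (v : W →₀ B), D (b • v) = b • D v + θ b • v := fun b v => by
    ext i
    change θ (b * v i) = b * θ (v i) + θ b * v i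
    rw [Derivation.leibniz, smul_eq_mul, smul_eq_mul, mul_comm (v i)]
  refine ⟨((Finsupp.linearCombination B id).restrictScalars k) ∘ₗ D ∘ₗ s.restrictScalars k,
    fun b w => ?_⟩
  change Finsupp.linearCombination B id (D (s (b • w))) =
    b • Finsupp.linearCombination B id (D (s w)) + θ b • w
  rw [map_smul, hD, map_add, map_smul, map_smul, hs w]

end Connection

section Superconnection

section Matrix

variable {E : Type*} [Ring E]

/-- The scalar matrix by which forms of degree zero act. -/
def superDiag (x : E) : Matrix (Fin 4) (Fin 4) E :=
  !![x, 0, 0, 0; 0, x, 0, 0; 0, 0, x, 0; 0, 0, 0, x]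

/-- The matrix by which `da` acts, with `x` and `d` standing for multiplication by `a` and
by `da`. -/
def superDer (L₁ L₂ x d : E) : Matrix (Fin 4) (Fin 4) E :=
  !![d, 0, 0, 0;
    L₁ * x - x * L₁, -d, 0, 0;
    L₂ * x - x * L₂, 0, -d, 0;
    0, -(L₂ * x - x * L₂), L₁ * x - x * L₁, d]

theorem superDiag_add (x y : E) : superDiag (x + y) = superDiag x + superDiag y := by
  ext i j
  fin_cases i <;> fin_cases j <;> simp [superDiag]

theorem superDer_add (L₁ L₂ x y d e : E) :
    superDer L₁ L₂ (x + y) (d + e) = superDer L₁ L₂ x d + superDer L₁ L₂ y e := by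
  ext i j
  fin_cases i <;> fin_cases j <;> simp [superDer] <;> first | noncomm_ring | abel

theorem superDiag_smul {k : Type*} [CommRing k] [Algebra k E] (r : k) (x : E) :
    superDiag (r • x) = r • superDiag x := by
  ext i j
  fin_cases i <;> fin_cases j <;> simp [superDiag]

theorem superDer_smul {k : Type*} [CommRing k] [Algebra k E] (r : k) (L₁ L₂ x d : E) :
    superDer L₁ L₂ (r • x) (r • d) = r • superDer L₁ L₂ x d := by
  ext i j
  fin_cases i <;> fin_cases j <;> simp [superDer, smul_sub]

theorem superDiag_one : superDiag (1 : E) = 1 := by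
  ext i j
  fin_cases i <;> fin_cases j <;> simp [superDiag]

theorem commutator_mul_comm {L x b t : E} (hx : x * b = b * x) (h : L * b = b * L + t)
    (ht : x * t = t * x) : (L * x - x * L) * b = b * (L * x - x * L) := by
  linear_combination (norm := noncomm_ring) L * hx + h * x - x * h - hx * L - ht

theorem superDiag_mul (x y : E) : superDiag (x * y) = superDiag x * superDiag y := by
  ext i j
  fin_cases i <;> fin_cases j <;> simp [superDiag, Matrix.mul_apply, Fin.sum_univ_four]

theorem superDer_leibniz (L₁ L₂ x y d e : E) :
    superDer L₁ L₂ (x * y) (x * e + d * y) =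
      superDiag x * superDer L₁ L₂ y e + superDer L₁ L₂ x d * superDiag y := by
  ext i j
  fin_cases i <;> fin_cases j <;>
    simp [superDiag, superDer] <;>
      first | noncomm_ring | abel

/-- The matrices of `da` and `b` commute. -/
theorem superDer_mul_superDiag {L₁ L₂ x d b t₁ t₂ : E} (hx : x * b = b * x) (hd : d * b = b * d)
    (h₁ : L₁ * b = b * L₁ + t₁) (h₂ : L₂ * b = b * L₂ + t₂) (hx₁ : x * t₁ = t₁ * x)
    (hx₂ : x * t₂ = t₂ * x) :
    superDer L₁ L₂ x d * superDiag b = superDiag b * superDer L₁ L₂ x d := by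
  have e₁ := commutator_mul_comm hx h₁ hx₁
  have e₂ := commutator_mul_comm hx h₂ hx₂
  have e₃ : (x * L₂ - L₂ * x) * b = b * (x * L₂ - L₂ * x) := by
    rw [← neg_sub, neg_mul, e₂, mul_neg]
  ext i j
  fin_cases i <;> fin_cases j <;>
    simp [superDiag, superDer, Matrix.mul_apply, Fin.sum_univ_four, hd, e₁, e₂, e₃]

/-- The matrices of `da` and `db` anticommute. Here `x` and `b` stand for multiplication by `a` and by
`b`, and `d` for multiplication by `da`, while `db` is zero in relative forms. -/
theorem superDer_mul_superDer {L₁ L₂ x d b t₁ t₂ : E} (h₁ : L₁ * b = b * L₁ + t₁)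
    (h₂ : L₂ * b = b * L₂ + t₂) (hd₁ : d * t₁ = t₁ * d)
    (hd₂ : d * t₂ = t₂ * d) (hc₁ : (L₁ * x - x * L₁) * t₂ = t₂ * (L₁ * x - x * L₁))
    (hc₂ : (L₂ * x - x * L₂) * t₁ = t₁ * (L₂ * x - x * L₂)) :
    superDer L₁ L₂ x d * superDer L₁ L₂ b 0 = -(superDer L₁ L₂ b 0 * superDer L₁ L₂ x d) := by
  have e₁ : L₁ * b - b * L₁ = t₁ := by rw [h₁]; abel
  have e₂ : L₂ * b - b * L₂ = t₂ := by rw [h₂]; abel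
  have e₃ : (x * L₂ - L₂ * x) * t₁ = t₁ * (x * L₂ - L₂ * x) := by
    rw [← neg_sub, neg_mul, hc₂, mul_neg]
  ext i j
  fin_cases i <;> fin_cases j <;>
    simp [superDer, Matrix.mul_apply, Fin.sum_univ_four, e₁, e₂, hd₁, hd₂, hc₁]
  rw [e₃, ← mul_neg, neg_sub]

end Matrix

variable {k B A : Type*} [CommRing k] [CommRing B] [Ring A] [Algebra k B] [Algebra k A]
  [Algebra B A] [IsScalarTower k B A]

variable (k) in
/-- Left multiplication by relative forms as a `k`-linear operator. -/
def leftMul (w : Forms B A) : Module.End k (Forms B A) := LinearMap.mulLeft k w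

theorem leftMul_apply (v w : Forms B A) : leftMul k v w = v * w := rfl

theorem leftMul_mul (v w : Forms B A) : leftMul k (v * w) = leftMul k v * leftMul k w :=
  LinearMap.ext fun x => mul_assoc v w x

theorem leftMul_add (v w : Forms B A) : leftMul k (v + w) = leftMul k v + leftMul k w :=
  LinearMap.ext fun x => add_mul v w x

theorem leftMul_smul (r : k) (w : Forms B A) : leftMul k (r • w) = r • leftMul k w :=
  LinearMap.ext fun x => smul_mul_assoc r w x

/-- The action of `Ω A` on four copies of relative forms attached to two operators `L₁`, `L₂`:
forms of degree zero act diagonally, and `da` acts by `da` up to signs plus the commutators of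
`L₁` and `L₂` with `a`. If `L₁`, `L₂` are covariant derivatives along `θ` and `η`, then the four
components of the orbit of `(1, 0, 0, 0)` are the projection to relative forms, the contractions
with `θ` and with `η`, and the contraction with both. -/
def superAction (L₁ L₂ : Module.End k (Forms B A)) :
    Forms k A →ₐ[k] Matrix (Fin 4) (Fin 4) (Module.End k (Forms B A)) :=
  liftForms k
    { toFun := fun a => superDiag (leftMul k (incl B a))
      map_add' := fun a b => by rw [map_add, leftMul_add, superDiag_add]
      map_smul' := fun r a => by
        rw [← algebraMap_smul B r a, map_smul, algebraMap_smul, leftMul_smul]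
        exact superDiag_smul r _ }
    { toFun := fun a => superDer L₁ L₂ (leftMul k (incl B a)) (leftMul k (der B a))
      map_add' := fun a b => by rw [map_add, map_add, leftMul_add, leftMul_add, superDer_add]
      map_smul' := fun r a => by
        rw [← algebraMap_smul B r a, map_smul, map_smul, algebraMap_smul, algebraMap_smul,
          leftMul_smul, leftMul_smul]
        exact superDer_smul r _ _ _ _ }
    (by
      change superDiag (leftMul k (incl B 1)) = 1
      rw [incl_one, show leftMul k (1 : Forms B A) = 1 from LinearMap.ext one_mul, superDiag_one])
    (fun a b => by
      change superDiag (leftMul k (incl B (a * b))) = _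
      rw [incl_mul, leftMul_mul, superDiag_mul]; rfl)
    (fun a b => by
      change superDer L₁ L₂ (leftMul k (incl B (a * b))) (leftMul k (der B (a * b))) = _
      rw [incl_mul, der_mul, leftMul_add, leftMul_mul, leftMul_mul, leftMul_mul, superDer_leibniz]
      rfl)

variable {L₁ L₂ : Module.End k (Forms B A)}

theorem superAction_incl (a : A) :
    superAction L₁ L₂ (incl k a) = superDiag (leftMul k (incl B a)) :=
  liftForms_incl k _ _ _ _ _ a

theorem superAction_der (a : A) :
    superAction L₁ L₂ (der k a) =
      superDer L₁ L₂ (leftMul k (incl B a)) (leftMul k (der B a)) :=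
  liftForms_der k _ _ _ _ _ a

theorem leftMul_comm_base (w : Forms B A) (b : B) :
    leftMul k w * leftMul k (algebraMap B _ b) = leftMul k (algebraMap B _ b) * leftMul k w := by
  rw [← leftMul_mul, ← leftMul_mul, Algebra.commutes]

theorem covariant_mul_leftMul {θ : Derivation k B B}
    (h : ∀ (b : B) (w : Forms B A), L₁ (b • w) = b • L₁ w + θ b • w) (b : B) :
    L₁ * leftMul k (algebraMap B _ b) =
      leftMul k (algebraMap B _ b) * L₁ + leftMul k (algebraMap B _ (θ b)) := by
  ext w
  simp only [Module.End.mul_apply, LinearMap.add_apply, leftMul_apply, ← Algebra.smul_def, h]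

theorem commutator_comm_base {θ : Derivation k B B}
    (h : ∀ (b : B) (w : Forms B A), L₁ (b • w) = b • L₁ w + θ b • w) (w : Forms B A) (b : B) :
    (L₁ * leftMul k w - leftMul k w * L₁) * leftMul k (algebraMap B _ b) =
      leftMul k (algebraMap B _ b) * (L₁ * leftMul k w - leftMul k w * L₁) := by
  exact commutator_mul_comm (leftMul_comm_base w b) (covariant_mul_leftMul h b)
    (leftMul_comm_base w (θ b))

/-- The contractions with two derivations and their composite. The composite is read off from the
same action, so that it vanishes on `commIdeal` as well. -/
theorem exists_contractions [Module.Projective B (Forms B A)] (θ η : Derivation k B B) :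
    ∃ C₁ C₂ C₁₂ : Forms k A →ₗ[k] Forms B A, IsContraction θ C₁ ∧ IsContraction η C₂ ∧
      (∀ x ∈ commIdeal k B A, C₁₂ x = 0) ∧
      ∀ (b : B) (y : Forms k A), C₁₂ (derB k A b * y) = θ b • C₂ y - η b • C₁ y := by
  obtain ⟨L₁, h₁⟩ := exists_covariantDerivative (k := k) (Forms B A) θ
  obtain ⟨L₂, h₂⟩ := exists_covariantDerivative (k := k) (Forms B A) η
  let ρ := superAction L₁ L₂
  let C : Fin 4 → Forms k A →ₗ[k] Forms B A := fun i =>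
    { toFun := fun w => ρ w i 0 1
      map_add' := fun x y => by simp
      map_smul' := fun r x => by simp }
  have hC : ∀ i w, C i w = ρ w i 0 1 := fun _ _ => rfl
  have hbase : ∀ b : B, ρ (inclB k A b) = superDiag (leftMul k (algebraMap B _ b)) := fun b => by
    rw [← incl_algebraMap]; exact superAction_incl _
  have hdbase : ∀ b : B, ρ (derB k A b) = superDer L₁ L₂ (leftMul k (algebraMap B _ b)) 0 :=
    fun b => by
      refine (superAction_der _).trans ?_
      rw [incl_algebraMap, der_algebraMap]
      congr 1
      exact LinearMap.ext zero_mul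
  have hcomm : ∀ x ∈ commIdeal k B A, ρ x = 0 := fun x hx => by
    refine map_eq_zero_of_mem_commIdeal (B := B) (f := ρ.toRingHom) (fun a b => ?_) (fun a b => ?_)
      hx
    · change ρ _ * ρ _ = ρ _ * ρ _
      rw [hbase, show ρ (der k a) = _ from superAction_der a]
      exact superDer_mul_superDiag (leftMul_comm_base _ b) (leftMul_comm_base _ b)
        (covariant_mul_leftMul h₁ b) (covariant_mul_leftMul h₂ b) (leftMul_comm_base _ _)
        (leftMul_comm_base _ _)
    · change ρ _ * ρ _ = -(ρ _ * ρ _)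
      rw [hdbase, show ρ (der k a) = _ from superAction_der a]
      exact superDer_mul_superDer
        (covariant_mul_leftMul h₁ b) (covariant_mul_leftMul h₂ b) (leftMul_comm_base _ _)
        (leftMul_comm_base _ _) (commutator_comm_base h₁ _ _) (commutator_comm_base h₂ _ _)
  have hC' : ∀ i, ∀ x ∈ commIdeal k B A, C i x = 0 := fun i x hx => by
    rw [hC, hcomm x hx]; rfl
  have hrow : ∀ y, ρ y 0 0 = leftMul k (toRelative k B A y) ∧
      ρ y 0 1 = 0 ∧ ρ y 0 2 = 0 ∧ ρ y 0 3 = 0 := fun y => by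
    induction y using Forms.induction with
    | hincl a =>
      rw [show ρ (incl k a) = _ from superAction_incl a, toRelative_incl]
      exact ⟨rfl, rfl, rfl, rfl⟩
    | hder a =>
      rw [show ρ (der k a) = _ from superAction_der a, toRelative_der]
      exact ⟨rfl, rfl, rfl, rfl⟩
    | hmul x y hx hy =>
      simp only [map_mul, Matrix.mul_apply, Fin.sum_univ_four, hx.1, hx.2.1, hx.2.2.1, hx.2.2.2,
        hy.1, hy.2.1, hy.2.2.1, hy.2.2.2, zero_mul, mul_zero, add_zero, leftMul_mul, and_self]
    | hadd x y hx hy =>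
      simp only [map_add, Matrix.add_apply, hx.1, hx.2.1, hx.2.2.1, hx.2.2.2, hy.1, hy.2.1,
        hy.2.2.1, hy.2.2.2, add_zero, leftMul_add, and_self]
  have h0 : ∀ y, C 0 y = toRelative k B A y := fun y => by
    rw [hC, (hrow y).1, leftMul_apply, mul_one]
  have hmul : ∀ (b : B) y i, C i (inclB k A b * y) = b • C i y := fun b y i => by
    rw [hC, map_mul, hbase, Matrix.mul_apply]
    fin_cases i <;> simp [superDiag, Fin.sum_univ_four, leftMul_apply, Algebra.smul_def, hC]
  have hd₁ : ∀ b : B, L₁ * leftMul k (algebraMap B (Forms B A) b) -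
      leftMul k (algebraMap B (Forms B A) b) * L₁ = leftMul k (algebraMap B _ (θ b)) := fun b => by
    rw [covariant_mul_leftMul h₁]; abel
  have hd₂ : ∀ b : B, L₂ * leftMul k (algebraMap B (Forms B A) b) -
      leftMul k (algebraMap B (Forms B A) b) * L₂ = leftMul k (algebraMap B _ (η b)) := fun b => by
    rw [covariant_mul_leftMul h₂]; abel
  refine ⟨C 1, C 2, C 3, ⟨hC' 1, fun b y => ?_, fun b y => hmul b y 1, ?_⟩,
    ⟨hC' 2, fun b y => ?_, fun b y => hmul b y 2, ?_⟩, hC' 3, fun b y => ?_⟩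
  · rw [hC, map_mul, hdbase, Matrix.mul_apply, ← h0]
    simp [superDer, Fin.sum_univ_four, hd₁, leftMul_apply, Algebra.smul_def, hC]
  · simp [hC]
  · rw [hC, map_mul, hdbase, Matrix.mul_apply, ← h0]
    simp [superDer, Fin.sum_univ_four, hd₂, leftMul_apply, Algebra.smul_def, hC]
  · simp [hC]
  · rw [hC, map_mul, hdbase, Matrix.mul_apply]
    simp [superDer, Fin.sum_univ_four, hd₁, hd₂, leftMul_apply, Algebra.smul_def, hC]
    abel

end Superconnection

/-! ### Covariant derivatives on the homology of forms -/

section ContractionComplex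

variable {k B A : Type*} [CommRing k] [CommRing B] [Ring A] [Algebra k B] [Algebra k A]
  [Algebra B A] [IsScalarTower k B A]

theorem equivDiff_mem_formsDeg {f : ℕ → Forms k A} (hf : ∀ p, f p ∈ formsDeg k A p) (p : ℕ) :
    equivDiff k A f p ∈ formsDeg k A p := by
  cases p with
  | zero => rw [equivDiff_zero]; exact redContraction_mem_formsDeg (hf 1)
  | succ p =>
    rw [equivDiff_succ]
    exact add_mem (deRham_mem_formsDeg (hf p)) (redContraction_mem_formsDeg (hf (p + 2)))

theorem groundForms_le_formsDeg (p : ℕ) : groundForms B A p ≤ formsDeg B A p := by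
  cases p with
  | zero => exact Submodule.span_le.2 (Set.singleton_subset_iff.2 one_mem_formsDeg)
  | succ p => exact bot_le

/-- An element of degree `p` of the span of `1` vanishes in the reduced forms. -/
theorem mem_groundForms_of_mem_span {p : ℕ} {w : Forms B A} (hw : w ∈ Submodule.span B {1})
    (hp : w ∈ formsDeg B A p) : w ∈ groundForms B A p := by
  cases p with
  | zero => exact hw
  | succ p =>
    have h := projDeg_of_mem (groundForms_le_formsDeg (B := B) (A := A) 0 hw) (p + 1)
    rw [projDeg_self hp, if_neg (Nat.succ_ne_zero p).symm] at h
    exact h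

theorem exists_lift_family {n : ℤ} {h : ℕ → Forms B A}
    (hh : h ∈ families (M := fun _ => Forms B A) (formsDeg B A) n) :
    ∃ f ∈ families (M := fun _ => Forms k A) (formsDeg k A) n,
      ∀ p, toRelative k B A (f p) = h p := by
  have hp : ∀ p, ∃ w ∈ formsDeg k A p, toRelative k B A w = h p ∧
      (¬Even (n - (p : ℤ)) → w = 0) := fun p => by
    by_cases hn : Even (n - (p : ℤ))
    · obtain ⟨w, hw, hw'⟩ := exists_toRelative_eq (k := k) ((mem_families_iff.1 hh p).1 hn)
      exact ⟨w, hw, hw', fun h => absurd hn h⟩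
    · exact ⟨0, zero_mem _, by rw [map_zero, (mem_families_iff.1 hh p).2 hn], fun _ => rfl⟩
  choose f hf hf' hf0 using hp
  exact ⟨f, mem_families_iff.2 fun p => ⟨fun _ => hf p, hf0 p⟩, hf'⟩

theorem mem_commIdeal_of_mem_formsDeg_zero {x : Forms k A} (hx : x ∈ filtration k B A 1)
    (h0 : x ∈ formsDeg k A 0) : x ∈ commIdeal k B A := by
  obtain ⟨T, hT⟩ := exists_sub_mulDer_mem hx
  have h := projDeg_mem_commIdeal 0 hT
  suffices h' : projDeg k A 0 (mulDer k B A T) = 0 by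
    rwa [map_sub, projDeg_self h0, h', sub_zero] at h
  clear hT h
  induction T with
  | zero => simp
  | tmul b y =>
    induction y using Forms.homogeneous_induction with
    | hom p y hy =>
      rw [mulDer_tmul, projDeg_of_mem (mul_mem_formsDeg (der_mem_formsDeg _) hy), if_neg (by omega)]
    | add y y' hy hy' => rw [TensorProduct.tmul_add, map_add, map_add, hy, hy', add_zero]
  | add x y hx hy => rw [map_add, map_add, hx, hy, add_zero]

namespace IsContraction

variable {θ : Derivation k B B} {C : Forms k A →ₗ[k] Forms B A}

theorem mem_formsDeg (hC : IsContraction θ C) {p : ℕ} {x : Forms k A}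
    (hx : x ∈ filtration k B A 1) (hp : x ∈ formsDeg k A (p + 1)) : C x ∈ formsDeg B A p := by
  obtain ⟨T, hT, h⟩ := exists_sub_mulDer_mem_of_mem_formsDeg hx hp
  rw [hC.eq_of_sub_mulDer_mem h, ← hT, mulDerivation_lTensor_projDeg]
  exact toRelative_mem_formsDeg (projDeg_mem p _)

theorem deRham (hC : IsContraction θ C) {x : Forms k A} (hx : x ∈ filtration k B A 1) :
    C (deRham k A x) = -NCGM.deRham B A (C x) := by
  obtain ⟨T, hT⟩ := exists_sub_mulDer_mem hx
  have h := deRham_mem_commIdeal hT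
  rw [map_sub] at h
  rw [hC.congr h, hC.congr hT]
  clear hT h
  induction T with
  | zero => simp
  | tmul b y =>
    have h : NCGM.deRham k A (derB k A b * y) = -(derB k A b * NCGM.deRham k A y) := by
      rw [deRham_mul, derB, deRham_der, parity_der, zero_mul, zero_add, neg_mul]
    rw [mulDer_tmul, h, map_neg, hC.derB_mul, hC.derB_mul, map_smul, toRelative_deRham]
  | add x y hx hy => simp only [map_add, hx, hy, neg_add]

theorem redContraction (hC : IsContraction θ C) {p : ℕ} {x : Forms k A}
    (hx : x ∈ filtration k B A 1) (hp : x ∈ formsDeg k A (p + 1)) :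
    C (redContraction k A (p + 1) x) = -NCGM.redContraction B A p (C x) := by
  obtain ⟨T, hT, h⟩ := exists_sub_mulDer_mem_of_mem_formsDeg hx hp
  have hdeg : NCGM.mulDer k B A T ∈ formsDeg k A (p + 1) := by
    rw [← hT, mulDer_lTensor_projDeg]; exact projDeg_mem _ _
  have h' := redContraction_mem_commIdeal h (sub_mem hp hdeg)
  rw [map_sub] at h'
  rw [hC.congr h', hC.congr h, ← hT]
  clear h h' hdeg hT
  induction T with
  | zero => simp
  | tmul b y =>
    have h := toSuper_redContraction_derB_mul b (projDeg_mem p y)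
    rw [← map_mul, ← map_neg, toSuper_eq_iff] at h
    rw [LinearMap.lTensor_tmul, mulDer_tmul, hC.congr h, map_neg, hC.derB_mul, hC.derB_mul,
      map_smul, toRelative_redContraction (projDeg_mem p y)]
  | add x y hx hy => simp only [map_add, hx, hy, neg_add]

/-- On families that vanish in reduced relative forms, the contraction anticommutes with
`d + t ı_Δ`. -/
theorem equivDiff (hC : IsContraction θ C) {x : ℕ → Forms k A} (hx : ∀ p, x p ∈ formsDeg k A p)
    (hx0 : ∀ p, toRelative k B A (x p) ∈ groundForms B A p) (p : ℕ) :
    C (equivDiff k A x (p + 1)) + NCGM.equivDiff B A (fun q => C (x (q + 1))) p ∈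
      groundForms B A p := by
  have hF : ∀ p, x (p + 1) ∈ filtration k B A 1 := fun p => toRelative_eq_zero_iff.1 (hx0 (p + 1))
  rw [equivDiff_succ, map_add, hC.redContraction (hF (p + 1)) (hx (p + 2))]
  cases p with
  | succ p =>
    rw [equivDiff_succ, hC.deRham (hF p)]
    convert zero_mem (groundForms B A (p + 1)) using 1
    abel
  | zero =>
    rw [equivDiff_zero]
    obtain ⟨β, hβ⟩ := Submodule.mem_span_singleton.1 (hx0 0)
    have h0 : x 0 - inclB k A β ∈ NCGM.commIdeal k B A := by
      refine mem_commIdeal_of_mem_formsDeg_zero (toRelative_eq_zero_iff.1 ?_)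
        (sub_mem (hx 0) (incl_mem_formsDeg _))
      rw [map_sub, ← hβ, toRelative_inclB, Algebra.algebraMap_eq_smul_one, sub_self]
    have h1 := deRham_mem_commIdeal h0
    rw [map_sub, inclB, deRham_incl] at h1
    have h2 := hC.derB_mul β 1
    rw [mul_one, map_one] at h2
    rw [hC.congr h1, h2, neg_add_cancel_right]
    exact Submodule.smul_mem _ _ (Submodule.mem_span_singleton_self 1)

end IsContraction

end ContractionComplex

section Lifts

variable {k B A : Type*} [CommRing k] [CommRing B] [Ring A] [Algebra k B] [Algebra k A]
  [Algebra B A] [IsScalarTower k B A] {n : ℤ} {f g : ℕ → Forms k A}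

theorem IsLift.mem_formsDeg (hf : IsLift k B A n f) (p : ℕ) : f p ∈ formsDeg k A p :=
  mem_of_mem_families hf.mem p

theorem IsLift.equivDiff_mem_groundForms (hf : IsLift k B A n f) (p : ℕ) :
    toRelative k B A (equivDiff k A f p) ∈ groundForms B A p := by
  rw [toRelative_equivDiff hf.mem_formsDeg]
  exact (mem_cycles_iff.1 hf.cycle).2 p

theorem IsLift.equivDiff_mem_filtration (hf : IsLift k B A n f) (p : ℕ) :
    equivDiff k A f (p + 1) ∈ filtration k B A 1 :=
  toRelative_eq_zero_iff.1 (hf.equivDiff_mem_groundForms (p + 1))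

theorem equivDiff_succ_eq_zero (hf : f ∈ families (M := fun _ => Forms k A) (formsDeg k A) n)
    {p : ℕ} (hp : ¬Even (n - (p : ℤ))) : equivDiff k A f (p + 1) = 0 := by
  refine total_eq_zero (n := n - 1) (G := formsDeg k A) (by rwa [sub_add_cancel]) (p + 1)
    fun h => hp ?_
  have h2 : n - (p : ℤ) = n - 1 - ((p + 1 : ℕ) : ℤ) + 2 := by push_cast; ring
  rw [h2]
  exact h.add even_two

/-- A family is a lift as soon as its image in relative forms is a cycle. -/
theorem IsLift.of_family {h : ℕ → Forms B A} (hh : h ∈ formCycles B A n)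
    (hf : f ∈ families (M := fun _ => Forms k A) (formsDeg k A) n)
    (hfh : ∀ p, toRelative k B A (f p) = h p) : IsLift k B A n f :=
  ⟨hf, by rwa [funext hfh]⟩

theorem IsLift.add (hf : IsLift k B A n f) (hg : IsLift k B A n g) : IsLift k B A n (f + g) :=
  .of_family (add_mem hf.cycle hg.cycle) (add_mem hf.mem hg.mem) fun _ => map_add _ _ _

theorem IsLift.neg (hf : IsLift k B A n f) : IsLift k B A n (-f) :=
  .of_family (neg_mem hf.cycle) (neg_mem hf.mem) fun _ => map_neg _ _

theorem IsLift.zero : IsLift k B A n 0 :=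
  .of_family (zero_mem _) (zero_mem _) fun _ => map_zero _

theorem IsLift.inclB_mul (hf : IsLift k B A n f) (b : B) :
    IsLift k B A n (fun p => inclB k A b * f p) :=
  .of_family (Submodule.smul_mem _ b hf.cycle)
    (map_mem_families hf.mem (fun p h => by rw [h, mul_zero]) fun p h => by
      have h' := mul_mem_formsDeg (incl_mem_formsDeg (R := k) (algebraMap B A b)) h
      rwa [zero_add] at h') fun p => toRelative_inclB_mul _ _

theorem IsLift.cls_congr (hf : IsLift k B A n f) (hg : IsLift k B A n g)
    (h : ∀ p, toRelative k B A (f p) - toRelative k B A (g p) ∈ groundForms B A p) :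
    hf.cls = hg.cls := by
  refine (PerHomology.mk_eq_iff _ _).2 (mem_boundaries_iff.2 ⟨0, zero_mem _, _, ?_, by
    rw [map_zero, zero_add]⟩)
  exact families_mono (sub_mem (mem_cycles_iff.1 hf.cycle).1 (mem_cycles_iff.1 hg.cycle).1)
    fun p => ⟨groundForms_le_formsDeg p (h p), h p⟩

theorem IsLift.cls_add (hf : IsLift k B A n f) (hg : IsLift k B A n g) :
    (hf.add hg).cls = hf.cls + hg.cls :=
  (PerHomology.mk_congr (funext fun _ => map_add _ _ _) _ _).trans
    (PerHomology.mk_add hf.cycle hg.cycle)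

theorem exists_isLift_cls_eq (x : FormHomology B A n) :
    ∃ (f : ℕ → Forms k A) (hf : IsLift k B A n f), hf.cls = x := by
  induction x using PerHomology.ind with
  | h h hh =>
    obtain ⟨f, hf, hfh⟩ := exists_lift_family (k := k) (mem_cycles_iff.1 hh).1
    refine ⟨f, .of_family hh hf hfh, ?_⟩
    have := funext hfh
    subst this
    rfl

variable {θ : Derivation k B B} {C : Forms k A →ₗ[k] Forms B A}

theorem IsContraction.mem_formCycles (hC : IsContraction θ C) (hf : IsLift k B A n f) :
    (fun p => C (NCGM.equivDiff k A f (p + 1))) ∈ formCycles B A n := by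
  refine mem_cycles_iff.2 ⟨mem_families_iff.2 fun p => ⟨fun _ => ?_, fun hp => ?_⟩, fun p => ?_⟩
  · exact hC.mem_formsDeg (hf.equivDiff_mem_filtration p)
      (equivDiff_mem_formsDeg hf.mem_formsDeg (p + 1))
  · rw [equivDiff_succ_eq_zero hf.mem hp, map_zero]
  · have h := hC.equivDiff (equivDiff_mem_formsDeg hf.mem_formsDeg) hf.equivDiff_mem_groundForms p
    rw [equivDiff_equivDiff hf.mem_formsDeg, Pi.zero_apply, map_zero, zero_add] at h
    exact h

/-- The contraction of `(d + t ı_Δ) f` is a boundary when `f` lifts a boundary. -/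
theorem IsContraction.mk_eq_zero (hC : IsContraction θ C) (hf : IsLift k B A n f)
    (h0 : hf.cls = 0) :
    (PerHomology.mk _ (hC.mem_formCycles hf) : FormHomology B A n) = 0 := by
  obtain ⟨h', hh', z, hz, hzf⟩ := mem_boundaries_iff.1 ((PerHomology.mk_eq_zero_iff _).1 h0)
  obtain ⟨h, hh, hhh⟩ := exists_lift_family (k := k) hh'
  have hdeg := mem_of_mem_families hh
  have hDh : NCGM.equivDiff k A h ∈ families (M := fun _ => Forms k A) (formsDeg k A) n :=
    total_mem_families hh (equivDiff_mem_formsDeg hdeg)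
  set x := f - NCGM.equivDiff k A h with hx
  have hxn : x ∈ families (M := fun _ => Forms k A) (formsDeg k A) n := sub_mem hf.mem hDh
  have hx0 : ∀ p, toRelative k B A (x p) ∈ groundForms B A p := fun p => by
    have e : toRelative k B A (x p) = z p := by
      rw [hx, Pi.sub_apply, map_sub, toRelative_equivDiff hdeg, funext hhh, ← congrFun hzf p,
        Pi.add_apply, add_sub_cancel_left]
    rw [e]
    exact (mem_of_mem_families hz p).2
  have hDx : NCGM.equivDiff k A x = NCGM.equivDiff k A f := by
    rw [hx, map_sub, equivDiff_equivDiff hdeg, sub_zero]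
  have key := hC.equivDiff (mem_of_mem_families hxn) hx0
  rw [hDx] at key
  have hCx : (fun p => C (x (p + 1))) ∈
      families (M := fun _ => Forms B A) (formsDeg B A) (n + 1) := by
    refine mem_families_iff.2 fun p => ⟨fun _ => ?_, fun hp => ?_⟩
    · exact hC.mem_formsDeg (toRelative_eq_zero_iff.1 (hx0 (p + 1)))
        (mem_of_mem_families hxn (p + 1))
    · rw [(mem_families_iff.1 hxn (p + 1)).2 fun h => ?_, map_zero]
      rw [even_sub_succ, ← even_succ_sub] at h
      exact hp h
  refine (PerHomology.mk_eq_zero_iff _).2 (mem_boundaries_iff.2 ⟨_, neg_mem hCx,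
    (fun p => C (NCGM.equivDiff k A f (p + 1))) + NCGM.equivDiff B A (fun p => C (x (p + 1))),
    families_mono (add_mem (mem_cycles_iff.1 (hC.mem_formCycles hf)).1
      (total_mem_families hCx (equivDiff_mem_formsDeg (mem_of_mem_families hCx))))
      fun p => ⟨groundForms_le_formsDeg p (key p), key p⟩, ?_⟩)
  rw [map_neg]
  abel

/-- The lifts of cycles. -/
def liftCycles (k B A : Type*) [CommRing k] [CommRing B] [Ring A] [Algebra k B] [Algebra k A]
    [Algebra B A] [IsScalarTower k B A] (n : ℤ) : AddSubgroup (ℕ → Forms k A) where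
  carrier := {f | IsLift k B A n f}
  add_mem' hf hg := IsLift.add hf hg
  zero_mem' := IsLift.zero
  neg_mem' hf := IsLift.neg hf

/-- The class of a lift, as a homomorphism. -/
def clsHom (k B A : Type*) [CommRing k] [CommRing B] [Ring A] [Algebra k B] [Algebra k A]
    [Algebra B A] [IsScalarTower k B A] (n : ℤ) : liftCycles k B A n →+ FormHomology B A n :=
  AddMonoidHom.mk' (fun f => IsLift.cls f.2) fun f g => IsLift.cls_add f.2 g.2

theorem clsHom_surjective : Function.Surjective (clsHom k B A n) := fun x =>
  let ⟨f, hf, h⟩ := exists_isLift_cls_eq (k := k) x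
  ⟨⟨f, hf⟩, h⟩

/-- The class of the contraction of `(d + t ı_Δ) f`, as a homomorphism. -/
def IsContraction.hom (hC : IsContraction θ C) (n : ℤ) : liftCycles k B A n →+ FormHomology B A n :=
  AddMonoidHom.mk' (fun f => PerHomology.mk _ (hC.mem_formCycles f.2)) fun f g =>
    (PerHomology.mk_congr (funext fun p => by
      rw [AddSubgroup.coe_add, map_add]; exact map_add C _ _) _ _).trans
      (PerHomology.mk_add (hC.mem_formCycles f.2) (hC.mem_formCycles g.2))

/-- The operator on homology that sends the class of `f` to that of the contraction of
`(d + t ı_Δ) f`. -/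
def IsContraction.covariantDerivative (hC : IsContraction θ C) (n : ℤ) :
    FormHomology B A n →+ FormHomology B A n :=
  AddMonoidHom.liftOfSurjective (clsHom k B A n) clsHom_surjective
    ⟨hC.hom n, fun f hf => hC.mk_eq_zero f.2 hf⟩

theorem IsContraction.covariantDerivative_cls (hC : IsContraction θ C) (hf : IsLift k B A n f) :
    hC.covariantDerivative n hf.cls = PerHomology.mk _ (hC.mem_formCycles hf) :=
  AddMonoidHom.liftOfRightInverse_comp_apply _ _ _ _ (⟨f, hf⟩ : liftCycles k B A n)

/-- The covariant derivative is determined by the contraction relation. -/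
theorem IsContraction.covariantDerivative_cls_eq (hC : IsContraction θ C) (hf : IsLift k B A n f)
    (hg : IsLift k B A n g)
    (h : ∀ p, (NCGM.equivDiff k A f (p + 1), g p) ∈ contractionRel k B A θ) :
    hC.covariantDerivative n hf.cls = hg.cls := by
  rw [hC.covariantDerivative_cls hf]
  refine (PerHomology.mk_eq_iff _ _).2 (mem_boundaries_iff.2 ⟨0, zero_mem _, _, ?_, by
    rw [map_zero, zero_add]⟩)
  have hmem := sub_mem (mem_cycles_iff.1 (hC.mem_formCycles hf)).1 (mem_cycles_iff.1 hg.cycle).1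
  exact families_mono hmem fun p => ⟨mem_of_mem_families hmem p,
    mem_groundForms_of_mem_span (hC.sub_mem_of_mem_contractionRel (h p))
      (mem_of_mem_families hmem p)⟩

end Lifts

/-! ### Flatness -/

section Flatness

variable {k B A : Type*} [CommRing k] [CommRing B] [Ring A] [Algebra k B] [Algebra k A]
  [Algebra B A] [IsScalarTower k B A] {n : ℤ} {f : ℕ → Forms k A}

theorem IsLift.cls_smul (hf : IsLift k B A n f) (b : B) :
    (hf.inclB_mul b).cls = b • hf.cls :=
  (PerHomology.mk_congr (funext fun _ => toRelative_inclB_mul _ _) _ _).trans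
    (PerHomology.mk_smul hf.cycle b)

/-- The family `T` expands `(d + t ı_Δ) f` into sums of products `db · y`, degree by degree and
modulo supercommutators. -/
structure IsExpansion (n : ℤ) (f : ℕ → Forms k A) (T : ℕ → B ⊗[k] Forms k A) : Prop where
  homogeneous : ∀ p, (projDeg k A p).lTensor B (T p) = T p
  sub_mem : ∀ p, equivDiff k A f (p + 1) - mulDer k B A (T p) ∈ commIdeal k B A
  eq_zero : ∀ p : ℕ, ¬Even (n - (p : ℤ)) → T p = 0

theorem IsLift.exists_isExpansion (hf : IsLift k B A n f) :
    ∃ T : ℕ → B ⊗[k] Forms k A, IsExpansion n f T := by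
  have h : ∀ p : ℕ, ∃ T : B ⊗[k] Forms k A, (projDeg k A p).lTensor B T = T ∧
      equivDiff k A f (p + 1) - mulDer k B A T ∈ commIdeal k B A ∧
      (¬Even (n - (p : ℤ)) → T = 0) := fun p => by
    by_cases hp : Even (n - (p : ℤ))
    · obtain ⟨T, hT, hT'⟩ := exists_sub_mulDer_mem_of_mem_formsDeg
        (hf.equivDiff_mem_filtration p) (equivDiff_mem_formsDeg hf.mem_formsDeg (p + 1))
      exact ⟨T, hT, hT', fun h => absurd hp h⟩
    · refine ⟨0, map_zero _, ?_, fun _ => rfl⟩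
      rw [equivDiff_succ_eq_zero hf.mem hp, map_zero, sub_zero]
      exact zero_mem _
  choose T h1 h2 h3 using h
  exact ⟨T, h1, h2, h3⟩

namespace IsExpansion

variable {T : ℕ → B ⊗[k] Forms k A} {θ η : Derivation k B B} {C : Forms k A →ₗ[k] Forms B A}

theorem toRelative_mulDerivation (hT : IsExpansion n f T) (hC : IsContraction θ C) (p : ℕ) :
    toRelative k B A (mulDerivation A θ (T p)) = C (equivDiff k A f (p + 1)) :=
  (hC.eq_of_sub_mulDer_mem (hT.sub_mem p)).symm

theorem isLift (hT : IsExpansion n f T) (hf : IsLift k B A n f) (hC : IsContraction θ C) :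
    IsLift k B A n (fun p => mulDerivation A θ (T p)) :=
  .of_family (hC.mem_formCycles hf) (mem_families_iff.2 fun p => ⟨fun _ => by
      rw [← hT.homogeneous p, mulDerivation_lTensor_projDeg]; exact projDeg_mem _ _,
    fun hp => by rw [hT.eq_zero p hp, map_zero]⟩) (hT.toRelative_mulDerivation hC)

theorem covariantDerivative_cls (hT : IsExpansion n f T) (hf : IsLift k B A n f)
    (hC : IsContraction θ C) :
    hC.covariantDerivative n hf.cls = (hT.isLift hf hC).cls :=
  (hC.covariantDerivative_cls hf).trans
    (PerHomology.mk_congr (funext fun p => (hT.toRelative_mulDerivation hC p).symm) _ _)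

theorem mem_contractionRel (hT : IsExpansion n f T) (θ : Derivation k B B) (p : ℕ) :
    (equivDiff k A f (p + 1), mulDerivation A θ (T p)) ∈ contractionRel k B A θ := by
  have h1 : (mulDer k B A (T p), mulDerivation A θ (T p)) ∈ contractionRel k B A θ := by
    induction T p with
    | zero => rw [map_zero, map_zero]; exact zero_mem _
    | tmul b y => exact Submodule.mem_sup_left (Submodule.subset_span ⟨b, y, rfl⟩)
    | add x y hx hy => rw [map_add, map_add, ← Prod.mk_add_mk]; exact add_mem hx hy
  have h2 : (equivDiff k A f (p + 1) - mulDer k B A (T p), (0 : Forms k A)) ∈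
      contractionRel k B A θ :=
    Submodule.mem_sup_right (Submodule.mem_prod.2
      ⟨Submodule.mem_sup_left (Submodule.mem_sup_left (hT.sub_mem p)), zero_mem _⟩)
  simpa using add_mem h2 h1

end IsExpansion

/-- The covariant derivative does not depend on the contraction. -/
theorem IsContraction.covariantDerivative_eq {θ : Derivation k B B}
    {C C' : Forms k A →ₗ[k] Forms B A} (hC : IsContraction θ C) (hC' : IsContraction θ C')
    (x : FormHomology B A n) : hC.covariantDerivative n x = hC'.covariantDerivative n x := by
  obtain ⟨f, hf, rfl⟩ := exists_isLift_cls_eq (k := k) x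
  obtain ⟨T, hT⟩ := hf.exists_isExpansion
  rw [hT.covariantDerivative_cls hf hC, hT.covariantDerivative_cls hf hC']

theorem mulDer_lTensor_deRham (S : B ⊗[k] Forms k A) :
    mulDer k B A ((deRham k A).lTensor B S) = -deRham k A (mulDer k B A S) := by
  induction S with
  | zero => simp
  | tmul b y =>
    rw [LinearMap.lTensor_tmul, mulDer_tmul, mulDer_tmul, deRham_mul, derB, deRham_der,
      parity_der, zero_mul, zero_add, neg_mul, neg_neg]
  | add x y hx hy => simp only [map_add, hx, hy, neg_add]

theorem mulDer_lTensor_redContraction_add_mem {m : ℕ} {S : B ⊗[k] Forms k A}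
    (hS : (projDeg k A m).lTensor B S = S) :
    mulDer k B A ((redContraction k A m).lTensor B S) +
      redContraction k A (m + 1) (mulDer k B A S) ∈ commIdeal k B A := by
  rw [← hS]
  clear hS
  induction S with
  | zero => simp only [map_zero, add_zero]; exact zero_mem _
  | tmul b y =>
    have h := toSuper_redContraction_derB_mul b (projDeg_mem m y)
    rw [LinearMap.lTensor_tmul, LinearMap.lTensor_tmul, mulDer_tmul, mulDer_tmul,
      ← toSuper_eq_zero_iff, map_add, h, map_mul, add_neg_cancel]
  | add x y hx hy =>
    simp only [map_add] at hx hy ⊢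
    rw [add_add_add_comm]
    exact add_mem hx hy

section Pair

variable {θ η : Derivation k B B} {C₁ C₂ C₁₂ : Forms k A →ₗ[k] Forms B A}
  (h₁ : IsContraction θ C₁) (h₂ : IsContraction η C₂)
  (h₁₂ : ∀ (b : B) (y : Forms k A), C₁₂ (derB k A b * y) = θ b • C₂ y - η b • C₁ y)
include h₁ h₂ h₁₂

/-- For `db · y` the left side is `d(η(b)) · y` contracted with `θ` minus `d(θ(b)) · y` contracted
with `η`, plus the terms with `dy`. -/
theorem contraction_deRham_mulDerivation_sub (S : B ⊗[k] Forms k A) :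
    C₁ (deRham k A (mulDerivation A η S)) - C₂ (deRham k A (mulDerivation A θ S)) =
      toRelative k B A (mulDerivation A ⁅θ, η⁆ S) -
        C₁₂ (mulDer k B A ((deRham k A).lTensor B S)) := by
  induction S with
  | zero => simp
  | tmul b y =>
    have hd : ∀ c : B, deRham k A (inclB k A c * y) = derB k A c * y + inclB k A c * deRham k A y :=
      fun c => by rw [deRham_mul, inclB, deRham_incl, parity_incl]
    rw [mulDerivation_tmul, mulDerivation_tmul, mulDerivation_tmul, LinearMap.lTensor_tmul,
      mulDer_tmul, h₁₂, hd, hd, map_add, map_add, h₁.derB_mul, h₂.derB_mul, h₁.inclB_mul,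
      h₂.inclB_mul, toRelative_inclB_mul, Derivation.commutator_apply, sub_smul]
    abel
  | add x y hx hy =>
    simp only [map_add]
    rw [add_sub_add_comm, hx, hy]
    abel

theorem contraction_redContraction_mulDerivation_sub (m : ℕ) (S : B ⊗[k] Forms k A) :
    C₁ (redContraction k A m (mulDerivation A η S)) -
        C₂ (redContraction k A m (mulDerivation A θ S)) =
      -C₁₂ (mulDer k B A ((redContraction k A m).lTensor B S)) := by
  induction S with
  | zero => simp
  | tmul b y =>
    have hd : ∀ c : B, redContraction k A m (inclB k A c * y) -
        inclB k A c * redContraction k A m y ∈ commIdeal k B A := fun c => by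
      rw [← toSuper_eq_iff, toSuper_redContraction_inclB_mul, map_mul]
    rw [mulDerivation_tmul, mulDerivation_tmul, LinearMap.lTensor_tmul, mulDer_tmul, h₁₂,
      h₁.congr (hd _), h₂.congr (hd _), h₁.inclB_mul, h₂.inclB_mul, neg_sub]
  | add x y hx hy =>
    simp only [map_add]
    rw [add_sub_add_comm, hx, hy, neg_add]

/-- The curvature identity. The defect is the double contraction of `(d + t ı_Δ)² f`. -/
theorem contraction_equivDiff_sub (h₀ : ∀ x ∈ commIdeal k B A, C₁₂ x = 0)
    {T : ℕ → B ⊗[k] Forms k A} (hf : IsLift k B A n f) (hT : IsExpansion n f T) (p : ℕ) :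
    C₁ (equivDiff k A (fun p => mulDerivation A η (T p)) (p + 1)) -
        C₂ (equivDiff k A (fun p => mulDerivation A θ (T p)) (p + 1)) =
      toRelative k B A (mulDerivation A ⁅θ, η⁆ (T p)) := by
  have hdeg : ∀ p, mulDer k B A (T p) ∈ formsDeg k A (p + 1) := fun p => by
    rw [← hT.homogeneous p, mulDer_lTensor_projDeg]; exact projDeg_mem _ _
  have e : mulDer k B A ((deRham k A).lTensor B (T p)) +
      mulDer k B A ((redContraction k A (p + 2)).lTensor B (T (p + 2))) ∈ commIdeal k B A := by
    have e1 := mulDer_lTensor_redContraction_add_mem (hT.homogeneous (p + 2))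
    have e2 := deRham_mem_commIdeal (hT.sub_mem p)
    have e3 := redContraction_mem_commIdeal (hT.sub_mem (p + 2))
      (_root_.sub_mem (equivDiff_mem_formsDeg hf.mem_formsDeg (p + 3)) (hdeg (p + 2)))
    have e4 := congrFun (equivDiff_equivDiff hf.mem_formsDeg) (p + 2)
    rw [equivDiff_succ, Pi.zero_apply] at e4
    rw [map_sub] at e2 e3
    rw [mulDer_lTensor_deRham]
    convert add_mem e1 (add_mem e2 e3) using 1
    rw [eq_neg_of_add_eq_zero_left e4]
    abel
  have e' := h₀ _ e
  rw [map_add] at e'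
  rw [equivDiff_succ, equivDiff_succ, map_add, map_add, add_sub_add_comm,
    contraction_deRham_mulDerivation_sub h₁ h₂ h₁₂,
    contraction_redContraction_mulDerivation_sub h₁ h₂ h₁₂, ← sub_eq_add_neg, sub_sub, e',
    sub_zero]

end Pair

variable [Module.Projective B (Forms B A)]

theorem exists_isContraction (θ : Derivation k B B) :
    ∃ C : Forms k A →ₗ[k] Forms B A, IsContraction θ C :=
  let ⟨C, _, _, h, _⟩ := exists_contractions θ θ
  ⟨C, h⟩

/-- The Gauss–Manin covariant derivative along `θ`. -/
def gaussManin (n : ℤ) (θ : Derivation k B B) : FormHomology B A n →+ FormHomology B A n :=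
  (exists_isContraction θ).choose_spec.covariantDerivative n

theorem IsContraction.gaussManin_eq {θ : Derivation k B B} {C : Forms k A →ₗ[k] Forms B A}
    (hC : IsContraction θ C) (x : FormHomology B A n) :
    gaussManin n θ x = hC.covariantDerivative n x :=
  covariantDerivative_eq _ hC x

theorem IsExpansion.isLift_mulDerivation {T : ℕ → B ⊗[k] Forms k A} (hT : IsExpansion n f T)
    (hf : IsLift k B A n f) (θ : Derivation k B B) :
    IsLift k B A n (fun p => mulDerivation A θ (T p)) :=
  hT.isLift hf (exists_isContraction θ).choose_spec

/-- On classes the covariant derivative replaces every `db · y` in an expansion of `(d + t ı_Δ) f`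
by `θ(b) y`. -/
theorem IsExpansion.gaussManin_cls {T : ℕ → B ⊗[k] Forms k A} (hT : IsExpansion n f T)
    (hf : IsLift k B A n f) (θ : Derivation k B B) :
    gaussManin n θ hf.cls = (hT.isLift_mulDerivation hf θ).cls :=
  hT.covariantDerivative_cls hf _

theorem gaussManin_cls_eq {θ : Derivation k B B} {g : ℕ → Forms k A} (hf : IsLift k B A n f)
    (hg : IsLift k B A n g)
    (h : ∀ p, (equivDiff k A f (p + 1), g p) ∈ contractionRel k B A θ) :
    gaussManin n θ hf.cls = hg.cls :=
  IsContraction.covariantDerivative_cls_eq _ hf hg h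

theorem gaussManin_add (θ η : Derivation k B B) (x : FormHomology B A n) :
    gaussManin n (θ + η) x = gaussManin n θ x + gaussManin n η x := by
  obtain ⟨f, hf, rfl⟩ := exists_isLift_cls_eq (k := k) x
  obtain ⟨T, hT⟩ := hf.exists_isExpansion
  rw [hT.gaussManin_cls, hT.gaussManin_cls, hT.gaussManin_cls, ← IsLift.cls_add]
  refine IsLift.cls_congr _ _ fun p => ?_
  rw [mulDerivation_add, Pi.add_apply, sub_self]
  exact zero_mem _

theorem gaussManin_smul (b : B) (θ : Derivation k B B) (x : FormHomology B A n) :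
    gaussManin n (b • θ) x = b • gaussManin n θ x := by
  obtain ⟨f, hf, rfl⟩ := exists_isLift_cls_eq (k := k) x
  obtain ⟨T, hT⟩ := hf.exists_isExpansion
  rw [hT.gaussManin_cls, hT.gaussManin_cls, ← IsLift.cls_smul]
  refine IsLift.cls_congr _ _ fun p => ?_
  rw [mulDerivation_smul, sub_self]
  exact zero_mem _

theorem gaussManin_leibniz (θ : Derivation k B B) (b : B) (x : FormHomology B A n) :
    gaussManin n θ (b • x) = b • gaussManin n θ x + θ b • x := by
  obtain ⟨f, hf, rfl⟩ := exists_isLift_cls_eq (k := k) x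
  obtain ⟨C, hC⟩ := exists_isContraction (A := A) θ
  rw [hC.gaussManin_eq, hC.gaussManin_eq, ← IsLift.cls_smul, hC.covariantDerivative_cls,
    hC.covariantDerivative_cls]
  refine (PerHomology.mk_congr (funext fun p => ?_) _ (add_mem
    (Submodule.smul_mem _ b (hC.mem_formCycles hf)) (Submodule.smul_mem _ (θ b) hf.cycle)))
  have hi : redContraction k A (p + 2) (inclB k A b * f (p + 2)) -
      inclB k A b * redContraction k A (p + 2) (f (p + 2)) ∈ commIdeal k B A := by
    rw [← toSuper_eq_iff, toSuper_redContraction_inclB_mul, map_mul]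
  simp only [Pi.add_apply, Pi.smul_apply]
  rw [equivDiff_succ, equivDiff_succ, map_add, map_add, hC.congr hi, deRham_mul, inclB, deRham_incl,
    parity_incl, map_add, hC.derB_mul, hC.inclB_mul, hC.inclB_mul, smul_add]
  abel

theorem gaussManin_lie (θ η : Derivation k B B) (x : FormHomology B A n) :
    gaussManin n ⁅θ, η⁆ x =
      gaussManin n θ (gaussManin n η x) - gaussManin n η (gaussManin n θ x) := by
  obtain ⟨f, hf, rfl⟩ := exists_isLift_cls_eq (k := k) x
  obtain ⟨T, hT⟩ := hf.exists_isExpansion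
  obtain ⟨C₁, C₂, C₁₂, h₁, h₂, h₀, h₁₂⟩ := exists_contractions (A := A) θ η
  rw [hT.gaussManin_cls, hT.gaussManin_cls, hT.gaussManin_cls, h₁.gaussManin_eq, h₂.gaussManin_eq,
    h₁.covariantDerivative_cls, h₂.covariantDerivative_cls]
  exact (PerHomology.mk_congr (funext fun p =>
    (contraction_equivDiff_sub h₁ h₂ h₁₂ h₀ hf hT p).symm) _ _).trans
      (PerHomology.mk_sub (h₁.mem_formCycles (hT.isLift_mulDerivation hf η))
        (h₂.mem_formCycles (hT.isLift_mulDerivation hf θ)))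

end Flatness

/-! ### The exterior derivative of Kähler differentials -/

section ExteriorDerivative

variable {k B : Type*} [CommRing k] [CommRing B] [Algebra k B]

open KaehlerDifferential

theorem wedgeRight_apply (ω η : Ω[B⁄k]) :
    wedgeRight k B ω η = exteriorPower.ιMulti B 2 ![η, ω] := by
  rw [wedgeRight, MultilinearMap.toLinearMap_apply]
  have e : Function.update ![0, ω] 0 η = ![η, ω] := by
    ext i; fin_cases i <;> simp
  rw [e]
  rfl

theorem wedgeRight_add (ω ω' η : Ω[B⁄k]) :
    wedgeRight k B (ω + ω') η = wedgeRight k B ω η + wedgeRight k B ω' η := by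
  have h := (exteriorPower.ιMulti B 2 (M := Ω[B⁄k])).map_update_add ![η, 0] 1 ω ω'
  have e : ∀ x : Ω[B⁄k], Function.update ![η, 0] 1 x = ![η, x] := fun x => by
    ext i; fin_cases i <;> simp
  rwa [e, e, e, ← wedgeRight_apply, ← wedgeRight_apply, ← wedgeRight_apply] at h

theorem wedgeRight_smul (b : B) (ω η : Ω[B⁄k]) :
    wedgeRight k B (b • ω) η = b • wedgeRight k B ω η := by
  have h := (exteriorPower.ιMulti B 2 (M := Ω[B⁄k])).map_update_smul ![η, 0] 1 b ω
  have e : ∀ x : Ω[B⁄k], Function.update ![η, 0] 1 x = ![η, x] := fun x => by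
    ext i; fin_cases i <;> simp
  rwa [e, e, ← wedgeRight_apply, ← wedgeRight_apply] at h

theorem wedgeRight_self (ω : Ω[B⁄k]) : wedgeRight k B ω ω = 0 := by
  rw [wedgeRight_apply]
  exact (exteriorPower.ιMulti B 2).map_eq_zero_of_eq _ (i := 0) (j := 1) rfl (by decide)

theorem wedgeRight_add_swap (ω η : Ω[B⁄k]) : wedgeRight k B ω η + wedgeRight k B η ω = 0 := by
  have h := wedgeRight_self (ω + η)
  rwa [map_add, wedgeRight_add, wedgeRight_add, wedgeRight_self, wedgeRight_self, zero_add,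
    add_zero, add_comm] at h

theorem wedgeRight_zero (η : Ω[B⁄k]) : wedgeRight k B 0 η = 0 := by
  rw [← zero_smul B (0 : Ω[B⁄k]), wedgeRight_smul, zero_smul]

variable (k B) in
/-- The wedge product as a bilinear map, with the arguments in reverse order. -/
def wedge : Ω[B⁄k] →ₗ[B] Ω[B⁄k] →ₗ[B] ⋀[B]^2 Ω[B⁄k] where
  toFun := wedgeRight k B
  map_add' ω ω' := LinearMap.ext (wedgeRight_add ω ω')
  map_smul' b ω := LinearMap.ext (wedgeRight_smul b ω)

variable (k B) in
/-- The exterior derivative `s dc ↦ ds ∧ dc` on the free module on the symbols `dc`. -/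
def freeExteriorDerivative : (B →₀ B) →+ ⋀[B]^2 Ω[B⁄k] :=
  Finsupp.liftAddHom fun c =>
    (wedgeRight k B (D k B c)).toAddMonoidHom.comp (D k B).toLinearMap.toAddMonoidHom

theorem freeExteriorDerivative_single (c s : B) :
    freeExteriorDerivative k B (Finsupp.single c s) = wedgeRight k B (D k B c) (D k B s) :=
  Finsupp.liftAddHom_apply_single _ _ _

theorem freeExteriorDerivative_smul (s : B) (u : B →₀ B) :
    freeExteriorDerivative k B (s • u) =
      wedgeRight k B (Finsupp.linearCombination B (D k B) u) (D k B s) +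
        s • freeExteriorDerivative k B u := by
  induction u using Finsupp.induction_linear with
  | zero => simp [wedgeRight_zero]
  | add u v hu hv => rw [smul_add, map_add, hu, hv, map_add, wedgeRight_add, map_add, smul_add]; abel
  | single c r =>
    rw [Finsupp.smul_single, freeExteriorDerivative_single, freeExteriorDerivative_single,
      Finsupp.linearCombination_single, smul_eq_mul, Derivation.leibniz, map_add, map_smul,
      map_smul, wedgeRight_smul, add_comm]

/-- The relations between the symbols `dc` are those of additivity, of the product rule and of
the constants. -/
theorem freeExteriorDerivative_eq_zero {u : B →₀ B}
    (hu : Finsupp.linearCombination B (D k B) u = 0) : freeExteriorDerivative k B u = 0 := by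
  have hu' : u ∈ kerTotal k B := by rwa [← kerTotal_eq]
  clear hu
  rw [kerTotal] at hu'
  induction hu' using Submodule.span_induction with
  | zero => exact map_zero _
  | add x y hx hy h h' => rw [map_add, h, h', add_zero]
  | smul s x hx h =>
    have hx0 : Finsupp.linearCombination B (D k B) x = 0 := by
      rwa [← kerTotal, ← kerTotal_eq] at hx
    rw [freeExteriorDerivative_smul, h, hx0, wedgeRight_zero, smul_zero, add_zero]
  | mem x hx =>
    obtain (⟨⟨x, y⟩, rfl⟩ | ⟨⟨x, y⟩, rfl⟩) | ⟨x, rfl⟩ := hx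
    · simp only [map_add, map_sub, freeExteriorDerivative_single, Derivation.map_one_eq_zero,
        map_zero, add_zero, sub_zero]
    · simp only [map_add, map_sub, freeExteriorDerivative_single, Derivation.map_one_eq_zero,
        map_zero, sub_zero]
      exact wedgeRight_add_swap _ _
    · rw [freeExteriorDerivative_single, Derivation.map_one_eq_zero, map_zero]

variable (k B) in
/-- The exterior derivative from Kähler differentials to Kähler two-forms. -/
def exteriorDerivative : Ω[B⁄k] →+ ⋀[B]^2 Ω[B⁄k] :=
  AddMonoidHom.liftOfSurjective (Finsupp.linearCombination B (D k B)).toAddMonoidHom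
    (linearCombination_surjective k B)
    ⟨freeExteriorDerivative k B, fun _ hu => freeExteriorDerivative_eq_zero hu⟩

theorem exteriorDerivative_linearCombination (u : B →₀ B) :
    exteriorDerivative k B (Finsupp.linearCombination B (D k B) u) =
      freeExteriorDerivative k B u :=
  AddMonoidHom.liftOfRightInverse_comp_apply _ _ _ _ u

theorem exteriorDerivative_smul (b : B) (ω : Ω[B⁄k]) :
    exteriorDerivative k B (b • ω) =
      wedgeRight k B ω (D k B b) + b • exteriorDerivative k B ω := by
  obtain ⟨u, rfl⟩ := linearCombination_surjective k B ω
  rw [← map_smul, exteriorDerivative_linearCombination, exteriorDerivative_linearCombination,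
    freeExteriorDerivative_smul]

theorem exteriorDerivative_D (b : B) : exteriorDerivative k B (D k B b) = 0 := by
  have h := exteriorDerivative_linearCombination (k := k) (Finsupp.single b (1 : B))
  rwa [Finsupp.linearCombination_single, one_smul, freeExteriorDerivative_single,
    Derivation.map_one_eq_zero, map_zero] at h

theorem exteriorDerivative_smul_D (b c : B) :
    exteriorDerivative k B (b • D k B c) = wedgeRight k B (D k B c) (D k B b) := by
  rw [exteriorDerivative_smul, exteriorDerivative_D, smul_zero, add_zero]

/-- Coordinates on Kähler differentials: derivations `θⱼ` and elements `bⱼ` with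
`dc = ∑ⱼ θⱼ(c) dbⱼ`. -/
def IsCoordinates {m : ℕ} (b : Fin m → B) (θ : Fin m → Derivation k B B) : Prop :=
  ∀ c, D k B c = ∑ j, θ j c • D k B (b j)

/-- A section of the surjection `Bᵐ → Ω` given by generators of the form `dbⱼ` consists of
derivations. -/
theorem exists_isCoordinates [Module.Finite B Ω[B⁄k]] [Module.Projective B Ω[B⁄k]] :
    ∃ (m : ℕ) (b : Fin m → B) (θ : Fin m → Derivation k B B), IsCoordinates b θ := by
  obtain ⟨s, hs, hspan⟩ := (Submodule.fg_span_iff_fg_span_finset_subset (R := B)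
    (Set.range (D k B))).1 (by rw [span_range_derivation]; exact Module.Finite.fg_top)
  rw [span_range_derivation] at hspan
  let e := s.equivFin.symm
  have hb : ∀ j, ∃ b, D k B b = (e j : Ω[B⁄k]) := fun j => hs (e j).2
  choose b hb using hb
  have hrange : Set.range (fun j => D k B (b j)) = s := by
    ext x
    constructor
    · rintro ⟨j, rfl⟩
      change D k B (b j) ∈ _
      rw [hb]; exact (e j).2
    · intro hx
      exact ⟨e.symm ⟨x, hx⟩, by change D k B _ = x; rw [hb, Equiv.apply_symm_apply]⟩
  let f : (Fin s.card → B) →ₗ[B] Ω[B⁄k] := Fintype.linearCombination B fun j => D k B (b j)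
  have hf : Function.Surjective f := by
    rw [← LinearMap.range_eq_top, Fintype.range_linearCombination, hrange, ← hspan]
  obtain ⟨g, hg⟩ := Module.projective_lifting_property f LinearMap.id hf
  refine ⟨s.card, b, fun j => (LinearMap.proj j ∘ₗ g).compDer (D k B), fun c => ?_⟩
  have h := LinearMap.congr_fun hg (D k B c)
  rw [LinearMap.comp_apply, Fintype.linearCombination_apply] at h
  exact h.symm

variable {m : ℕ} {b : Fin m → B} {θ : Fin m → Derivation k B B}

theorem IsCoordinates.derivation_eq (h : IsCoordinates b θ) (η : Derivation k B B) :
    η = ∑ j, η (b j) • θ j := by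
  ext c
  have hc := congrArg η.liftKaehlerDifferential (h c)
  rw [Derivation.liftKaehlerDifferential_comp_D, map_sum] at hc
  rw [hc, show (∑ j, η (b j) • θ j) c = ∑ j, (η (b j) • θ j) c from
    (congrFun (map_sum (Derivation.coeFnAddMonoidHom : Derivation k B B →+ B → B) _ _) c).trans
      (Finset.sum_apply _ _ _)]
  refine Finset.sum_congr rfl fun j _ => ?_
  rw [map_smul, Derivation.liftKaehlerDifferential_comp_D, Derivation.smul_apply, smul_eq_mul,
    smul_eq_mul, mul_comm]

theorem IsCoordinates.sum_wedge_eq_zero (h : IsCoordinates b θ) (c : B) :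
    ∑ j, wedgeRight k B (D k B (b j)) (D k B (θ j c)) = 0 := by
  have hc := congrArg (exteriorDerivative k B) (h c)
  rw [exteriorDerivative_D, map_sum] at hc
  simpa only [exteriorDerivative_smul_D] using hc.symm

end ExteriorDerivative

/-! ### Connections from covariant derivatives -/

section GlobalConnection

variable {k B : Type*} [Field k] [CharZero k] [CommRing B] [Algebra k B] {H : Type*}
  [AddCommGroup H] [Module B H] {nabla : Derivation k B B → H →+ H}
  {m : ℕ} {b : Fin m → B} {θ : Fin m → Derivation k B B}

open KaehlerDifferential

variable (nabla b θ) in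
/-- The connection `x ↦ ∑ⱼ ∇_θⱼ x ⊗ dbⱼ`. -/
def connectionOfAction : H →+ H ⊗[B] Ω[B⁄k] where
  toFun x := ∑ j, nabla (θ j) x ⊗ₜ D k B (b j)
  map_zero' := by simp
  map_add' x y := by simp [TensorProduct.add_tmul, Finset.sum_add_distrib]

theorem connectionOfAction_apply (x : H) :
    connectionOfAction nabla b θ x = ∑ j, nabla (θ j) x ⊗ₜ D k B (b j) := rfl

variable (h : IsFlatAction nabla) (hθ : IsCoordinates b θ)
include h hθ

theorem connectionOfAction_smul (c : B) (x : H) :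
    connectionOfAction nabla b θ (c • x) =
      c • connectionOfAction nabla b θ x + x ⊗ₜ[B] D k B c := by
  simp only [connectionOfAction_apply]
  conv_rhs => rw [hθ c]
  rw [TensorProduct.tmul_sum, Finset.smul_sum, ← Finset.sum_add_distrib]
  refine Finset.sum_congr rfl fun j _ => ?_
  rw [h.leibniz, TensorProduct.add_tmul, ← TensorProduct.smul_tmul', TensorProduct.smul_tmul (θ j c)]

theorem IsFlatAction.eq_sum (η : Derivation k B B) (x : H) :
    nabla η x = ∑ j, η (b j) • nabla (θ j) x := by
  have key : ∀ s : Finset (Fin m), nabla (∑ j ∈ s, η (b j) • θ j) x =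
      ∑ j ∈ s, η (b j) • nabla (θ j) x := fun s => by
    induction s using Finset.induction_on with
    | empty =>
      have h0 := h.smul 0 0 x
      rwa [zero_smul, zero_smul] at h0
    | insert j s hj ih => rw [Finset.sum_insert hj, Finset.sum_insert hj, h.add, h.smul, ih]
  rw [← key, ← hθ.derivation_eq]

/-- The curvature of `x ↦ ∑ⱼ ∇_θⱼ x ⊗ dbⱼ` vanishes: twice the curvature is
`∑ ∇_[θᵢ, θⱼ] x ⊗ dbᵢ ∧ dbⱼ`, and `∑ⱼ d(θⱼ c) ∧ dbⱼ = d²c = 0`. -/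
theorem sum_sum_nabla_wedge_eq_zero (x : H) :
    ∑ j, ∑ i, nabla (θ i) (nabla (θ j) x) ⊗ₜ[B] wedgeRight k B (D k B (b j)) (D k B (b i)) = 0 := by
  set W : Fin m → Fin m → ⋀[B]^2 Ω[B⁄k] := fun i j => wedgeRight k B (D k B (b j)) (D k B (b i))
  set Z := ∑ j, ∑ i, nabla (θ i) (nabla (θ j) x) ⊗ₜ[B] W i j
  have hW : ∀ i j, W j i = -W i j := fun i j => by
    rw [eq_neg_iff_add_eq_zero]; exact wedgeRight_add_swap _ _
  have h1 : Z = ∑ j, ∑ i, -(nabla (θ j) (nabla (θ i) x) ⊗ₜ[B] W i j) := by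
    rw [Finset.sum_comm]
    refine Finset.sum_congr rfl fun j _ => Finset.sum_congr rfl fun i _ => ?_
    rw [hW, TensorProduct.tmul_neg]
  have h2 : Z + Z = ∑ j, ∑ i, ∑ l, nabla (θ l) x ⊗ₜ[B] (⁅θ i, θ j⁆ (b l) • W i j) := by
    nth_rewrite 2 [h1]
    rw [← Finset.sum_add_distrib]
    refine Finset.sum_congr rfl fun j _ => ?_
    rw [← Finset.sum_add_distrib]
    refine Finset.sum_congr rfl fun i _ => ?_
    rw [← sub_eq_add_neg, ← TensorProduct.sub_tmul, ← h.flat, h.eq_sum hθ, TensorProduct.sum_tmul]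
    refine Finset.sum_congr rfl fun l _ => ?_
    rw [TensorProduct.smul_tmul]
  have h3 : ∀ l, ∑ j, ∑ i, ⁅θ i, θ j⁆ (b l) • W i j = 0 := fun l => by
    have e1 : ∀ j c, ∑ i, θ i c • W i j = wedgeRight k B (D k B (b j)) (D k B c) := fun j c => by
      rw [hθ c, map_sum]
      exact Finset.sum_congr rfl fun i _ => (map_smul _ _ _).symm
    have e2 : ∑ j, ∑ i, θ i (θ j (b l)) • W i j = 0 := by
      rw [Finset.sum_congr rfl fun j _ => e1 j _]
      exact hθ.sum_wedge_eq_zero _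
    have e3 : ∑ j, ∑ i, θ j (θ i (b l)) • W i j = 0 := by
      rw [Finset.sum_comm, ← neg_eq_zero, ← Finset.sum_neg_distrib, ← e2]
      refine Finset.sum_congr rfl fun j _ => ?_
      rw [← Finset.sum_neg_distrib]
      refine Finset.sum_congr rfl fun i _ => ?_
      rw [hW, smul_neg, neg_neg]
    have e4 : ∀ i j, ⁅θ i, θ j⁆ (b l) • W i j =
        θ i (θ j (b l)) • W i j - θ j (θ i (b l)) • W i j := fun i j => by
      rw [Derivation.commutator_apply, eq_sub_iff_add_eq, ← add_smul, sub_add_cancel]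
    simp only [e4, Finset.sum_sub_distrib]
    rw [e2, e3, sub_zero]
  have h4 : Z + Z = 0 := by
    rw [h2]
    have e : ∀ j, ∑ i, ∑ l, nabla (θ l) x ⊗ₜ[B] (⁅θ i, θ j⁆ (b l) • W i j) =
        ∑ l, ∑ i, nabla (θ l) x ⊗ₜ[B] (⁅θ i, θ j⁆ (b l) • W i j) := fun j => Finset.sum_comm
    rw [Finset.sum_congr rfl fun j _ => e j, Finset.sum_comm]
    refine Finset.sum_eq_zero fun l _ => ?_
    simp only [← TensorProduct.tmul_sum]
    rw [h3, TensorProduct.tmul_zero]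
  have h5 : (2 : B) • Z = 0 := by rw [two_smul, h4]
  have h6 : algebraMap k B 2⁻¹ * 2 = 1 := by
    rw [← map_ofNat (algebraMap k B) 2, ← map_mul, inv_mul_cancel₀ two_ne_zero, map_one]
  rw [← one_smul B Z, ← h6, mul_smul, h5, smul_zero]

theorem isFlatConnection_connectionOfAction :
    IsFlatConnection (k := k) (B := B) (connectionOfAction nabla b θ) := by
  refine ⟨connectionOfAction_smul h hθ, ?_⟩
  set N := connectionOfAction nabla b θ with hN
  let F : H →+ Ω[B⁄k] →+ H ⊗[B] (⋀[B]^2 Ω[B⁄k]) := AddMonoidHom.mk' (fun x =>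
    AddMonoidHom.mk' (fun ω => (wedgeRight k B ω).lTensor H (N x) +
      x ⊗ₜ exteriorDerivative k B ω) fun ω ω' => by
        have e : wedgeRight k B (ω + ω') = wedgeRight k B ω + wedgeRight k B ω' :=
          map_add (wedge k B) ω ω'
        rw [e, LinearMap.lTensor_add, LinearMap.add_apply, map_add, TensorProduct.tmul_add]
        abel) fun x y => by
      ext ω
      simp only [AddMonoidHom.add_apply, AddMonoidHom.mk'_apply, map_add, TensorProduct.add_tmul]
      abel
  have hF : ∀ x ω, F x ω = (wedgeRight k B ω).lTensor H (N x) + x ⊗ₜ exteriorDerivative k B ω :=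
    fun _ _ => rfl
  have hbal : ∀ (c : B) (x : H) (ω : Ω[B⁄k]), F (c • x) ω = F x (c • ω) := fun c x ω => by
    have e : wedgeRight k B (c • ω) = c • wedgeRight k B ω := map_smul (wedge k B) c ω
    rw [hF, hF, connectionOfAction_smul h hθ, map_add, map_smul, LinearMap.lTensor_tmul, e,
      LinearMap.lTensor_smul, LinearMap.smul_apply, exteriorDerivative_smul,
      TensorProduct.tmul_add, TensorProduct.smul_tmul]
    abel
  refine ⟨TensorProduct.liftAddHom F hbal, fun x c c' => ?_, fun x => ?_⟩
  · rw [TensorProduct.liftAddHom_tmul, hF, exteriorDerivative_smul_D]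
  · rw [hN, connectionOfAction_apply, map_sum, ← sum_sum_nabla_wedge_eq_zero h hθ x]
    refine Finset.sum_congr rfl fun j _ => ?_
    rw [TensorProduct.liftAddHom_tmul, hF, exteriorDerivative_D, TensorProduct.tmul_zero, add_zero,
      hN, connectionOfAction_apply, map_sum]
    rfl

end GlobalConnection

/-! ### The Gauss–Manin connection -/

section GaussManin

variable {k B A : Type*} [CommRing k] [CommRing B] [Ring A] [Algebra k B] [Algebra k A]
  [Algebra B A] [IsScalarTower k B A] {n : ℤ} {f : ℕ → Forms k A}

open KaehlerDifferential

theorem inclB_smul (r : k) (b : B) : inclB k A (r • b) = r • inclB k A b := by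
  rw [inclB, Algebra.algebraMap_eq_smul_one (r • b), smul_assoc, map_smul,
    ← Algebra.algebraMap_eq_smul_one]

theorem derB_smul (r : k) (b : B) : derB k A (r • b) = r • derB k A b := by
  rw [derB, Algebra.algebraMap_eq_smul_one (r • b), smul_assoc, map_smul,
    ← Algebra.algebraMap_eq_smul_one]

/-- Modulo supercommutators `b ↦ db` is a derivation of the base, so that relations between
Kähler differentials hold in `Ωᴮ A`. -/
theorem IsCoordinates.toSuper_derB {m : ℕ} {b : Fin m → B} {θ : Fin m → Derivation k B B}
    (h : IsCoordinates b θ) (c : B) :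
    toSuper k B A (derB k A c) =
      ∑ j, toSuper k B A (inclB k A (θ j c)) * toSuper k B A (derB k A (b j)) := by
  let i : B →+* Forms k A ⧸ commutatorIdeal k B A :=
    { toFun := fun b => toSuper k B A (inclB k A b)
      map_one' := by rw [inclB, map_one, incl_one, map_one]
      map_mul' := fun b c => by rw [inclB, map_mul, incl_mul, map_mul]
      map_zero' := by rw [inclB, map_zero, map_zero, map_zero]
      map_add' := fun b c => by rw [inclB, map_add, map_add, map_add] }
  let _ : Module B (Forms k A ⧸ commutatorIdeal k B A) := Module.compHom _ i
  have hk : ∀ (r : k) (w : Forms k A), toSuper k B A (r • w) = r • toSuper k B A w := fun _ _ => rfl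
  have hsmul : ∀ (b : B) (x : Forms k A ⧸ commutatorIdeal k B A),
      b • x = toSuper k B A (inclB k A b) * x := fun _ _ => rfl
  have : IsScalarTower k B (Forms k A ⧸ commutatorIdeal k B A) := ⟨fun r b x => by
    rw [hsmul, hsmul, inclB_smul, hk, smul_mul_assoc]⟩
  let δ : Derivation k B (Forms k A ⧸ commutatorIdeal k B A) :=
    { toFun := fun b => toSuper k B A (derB k A b)
      map_add' := fun b c => by rw [derB, map_add, map_add, map_add]
      map_smul' := fun r b => by rw [derB_smul, hk, RingHom.id_apply]
      map_one_eq_zero' := by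
        change toSuper k B A (derB k A 1) = 0
        rw [derB, map_one, der_one, map_zero]
      leibniz' := fun b c => by
        change toSuper k B A (derB k A (b * c)) = _
        rw [hsmul, hsmul, derB, map_mul, der_mul, map_add, map_mul, map_mul]
        exact congrArg _ (toSuper_inclB_mul c (derB k A b)).symm }
  have hc := congrArg δ.liftKaehlerDifferential (h c)
  rw [Derivation.liftKaehlerDifferential_comp_D, map_sum] at hc
  refine hc.trans (Finset.sum_congr rfl fun j _ => ?_)
  rw [map_smul, Derivation.liftKaehlerDifferential_comp_D]
  rfl

theorem IsCoordinates.mulDer_sub_mem {m : ℕ} {b : Fin m → B} {θ : Fin m → Derivation k B B}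
    (h : IsCoordinates b θ) (S : B ⊗[k] Forms k A) :
    mulDer k B A S - ∑ j, derB k A (b j) * mulDerivation A (θ j) S ∈ commIdeal k B A := by
  induction S with
  | zero => simp
  | tmul c y =>
    rw [← toSuper_eq_iff, mulDer_tmul, map_mul, h.toSuper_derB, map_sum, Finset.sum_mul]
    refine Finset.sum_congr rfl fun j _ => ?_
    rw [mulDerivation_tmul, map_mul, map_mul, toSuper_inclB_mul, mul_assoc]
  | add x y hx hy =>
    simp only [map_add, mul_add, Finset.sum_add_distrib]
    rw [add_sub_add_comm]
    exact add_mem hx hy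

theorem IsExpansion.sub_sum_mem_redFiltration {T : ℕ → B ⊗[k] Forms k A} (hT : IsExpansion n f T)
    {m : ℕ} {b : Fin m → B} {θ : Fin m → Derivation k B B} (h : IsCoordinates b θ) (p : ℕ) :
    equivDiff k A f (p + 1) - ∑ j, der k (algebraMap B A (b j)) * mulDerivation A (θ j) (T p) ∈
      redFiltration k B A 2 := by
  have h1 := add_mem (hT.sub_mem p) (h.mulDer_sub_mem (T p))
  rw [sub_add_sub_cancel] at h1
  exact Submodule.mem_sup_left (Submodule.mem_sup_left h1)

theorem mem_contractionRel_of_sub_mem {x : Forms k A} {m : ℕ} {b : Fin m → B}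
    {g : Fin m → Forms k A}
    (h : x - ∑ j, der k (algebraMap B A (b j)) * g j ∈ redFiltration k B A 2)
    (θ : Derivation k B B) :
    (x, ∑ j, inclB k A (θ (b j)) * g j) ∈ contractionRel k B A θ := by
  have h1 : (x - ∑ j, der k (algebraMap B A (b j)) * g j, (0 : Forms k A)) ∈
      contractionRel k B A θ :=
    Submodule.mem_sup_right (Submodule.mem_prod.2 ⟨h, zero_mem _⟩)
  have h2 : ∑ j, (der k (algebraMap B A (b j)) * g j, inclB k A (θ (b j)) * g j) ∈
      contractionRel k B A θ :=
    sum_mem fun j _ => Submodule.mem_sup_left (Submodule.subset_span ⟨b j, g j, rfl⟩)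
  have h3 := add_mem h1 h2
  have h4 : ∑ j, (der k (algebraMap B A (b j)) * g j, inclB k A (θ (b j)) * g j) =
      (∑ j, der k (algebraMap B A (b j)) * g j, ∑ j, inclB k A (θ (b j)) * g j) :=
    Prod.ext Prod.fst_sum Prod.snd_sum
  rwa [h4, Prod.mk_add_mk, sub_add_cancel, zero_add] at h3

theorem exists_isLift_sum {m : ℕ} (c : Fin m → B) {g : Fin m → ℕ → Forms k A}
    (hg : ∀ j, IsLift k B A n (g j)) :
    ∃ h : IsLift k B A n (fun p => ∑ j, inclB k A (c j) * g j p),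
      h.cls = ∑ j, c j • (hg j).cls := by
  have key : ∀ s : Finset (Fin m), ∃ h : IsLift k B A n (fun p => ∑ j ∈ s, inclB k A (c j) * g j p),
      h.cls = ∑ j ∈ s, c j • (hg j).cls := fun s => by
    induction s using Finset.induction_on with
    | empty =>
      refine ⟨IsLift.zero, (PerHomology.mk_eq_zero_iff _).2 ?_⟩
      rw [show (fun p => toRelative k B A (∑ j ∈ (∅ : Finset (Fin m)), inclB k A (c j) * g j p)) = 0
        from funext fun p => map_zero _]
      exact Submodule.zero_mem _
    | insert j s hj ih =>
      obtain ⟨h, hs⟩ := ih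
      simp only [Finset.sum_insert hj]
      refine ⟨((hg j).inclB_mul (c j)).add h, ?_⟩
      rw [← hs, ← IsLift.cls_smul]
      exact IsLift.cls_add _ _
  exact key _

end GaussManin

end NCGM

theorem theorem4 {k B A : Type*} [Field k] [CharZero k] [CommRing B] [Algebra k B]
    [Ring A] [Algebra k A] [Algebra B A] [IsScalarTower k B A]
    (hinj : Function.Injective (algebraMap B A))
    (hfree : Module.Free B (A ⧸ LinearMap.range (Algebra.linearMap B A))) :
    ∃ Φ : ∀ n : ℤ, NCGM.FormHomology B A n ≃ₗ[B] NCGM.HP B A n,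
      NCGM.IsComparison Φ ∧ (∀ Φ', NCGM.IsComparison Φ' → Φ' = Φ) ∧
      (∃ nabla : ∀ n : ℤ, Derivation k B B → NCGM.HP B A n →+ NCGM.HP B A n,
        NCGM.IsGaussManinAction Φ nabla ∧
        (∀ nabla', NCGM.IsGaussManinAction Φ nabla' → nabla' = nabla) ∧
        ∀ n, NCGM.IsFlatAction (nabla n)) ∧
      (Module.Finite B Ω[B⁄k] → Module.Projective B Ω[B⁄k] →
        ∃ nabla : ∀ n : ℤ, NCGM.HP B A n →+ NCGM.HP B A n ⊗[B] Ω[B⁄k],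
          NCGM.IsGaussManin Φ nabla ∧
          (∀ nabla', NCGM.IsGaussManin Φ nabla' → nabla' = nabla) ∧
          ∀ n, NCGM.IsFlatConnection (nabla n)) := by
  have : Module.Free B (NCGM.BarQuot B A) := hfree
  have : Module.Projective B (NCGM.Forms B A) := NCGM.projective_forms hinj
  refine ⟨NCGM.comparison B A k, NCGM.isComparison_comparison k,
    fun Φ' h => NCGM.IsComparison.eq_comparison k h, ?_⟩
  generalize NCGM.comparison B A k = Φ
  let N : ∀ n : ℤ, Derivation k B B → NCGM.HP B A n →+ NCGM.HP B A n := fun n θ =>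
    (Φ n).toAddEquiv.toAddMonoidHom.comp
      ((NCGM.gaussManin n θ).comp (Φ n).symm.toAddEquiv.toAddMonoidHom)
  have hN : ∀ n θ x, N n θ (Φ n x) = Φ n (NCGM.gaussManin n θ x) := fun n θ x =>
    congrArg (fun y => Φ n (NCGM.gaussManin n θ y)) ((Φ n).symm_apply_apply x)
  have hrep : ∀ n (x : NCGM.HP B A n), ∃ (f : ℕ → NCGM.Forms k A) (hf : NCGM.IsLift k B A n f),
      Φ n hf.cls = x := fun n x => by
    obtain ⟨f, hf, h⟩ := NCGM.exists_isLift_cls_eq (k := k) ((Φ n).symm x)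
    exact ⟨f, hf, by rw [h, LinearEquiv.apply_symm_apply]⟩
  have hflat : ∀ n, NCGM.IsFlatAction (N n) := fun n =>
    { add := fun θ η x => by
        obtain ⟨x, rfl⟩ := (Φ n).surjective x
        rw [hN, hN, hN, NCGM.gaussManin_add, map_add]
      smul := fun b θ x => by
        obtain ⟨x, rfl⟩ := (Φ n).surjective x
        rw [hN, hN, NCGM.gaussManin_smul, map_smul]
      leibniz := fun θ b x => by
        obtain ⟨x, rfl⟩ := (Φ n).surjective x
        rw [hN, ← map_smul, hN, NCGM.gaussManin_leibniz, map_add, map_smul, map_smul]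
      flat := fun θ η x => by
        obtain ⟨x, rfl⟩ := (Φ n).surjective x
        rw [hN, hN, hN, hN, hN, NCGM.gaussManin_lie, map_sub] }
  refine ⟨⟨N, fun n θ f g hf hg h => ?_, fun N' hN' => ?_, hflat⟩, fun _ _ => ?_⟩
  · rw [hN, NCGM.gaussManin_cls_eq hf hg h]
  · funext n θ
    ext x
    obtain ⟨f, hf, rfl⟩ := hrep n x
    obtain ⟨T, hT⟩ := hf.exists_isExpansion
    rw [hN' n θ f _ hf (hT.isLift_mulDerivation hf θ) (hT.mem_contractionRel θ), hN,
      hT.gaussManin_cls hf]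
  · obtain ⟨m, b, θ, hθ⟩ := NCGM.exists_isCoordinates (k := k) (B := B)
    have hGM : NCGM.IsGaussManin Φ fun n => NCGM.connectionOfAction (N n) b θ := by
      intro n f hf m' b' g hg h
      have hη : ∀ η : Derivation k B B, N n η (Φ n hf.cls) = ∑ j, η (b' j) • Φ n (hg j).cls :=
        fun η => by
          obtain ⟨hs, hs'⟩ := NCGM.exists_isLift_sum (fun j => η (b' j)) hg
          rw [hN, NCGM.gaussManin_cls_eq hf hs fun p =>
            NCGM.mem_contractionRel_of_sub_mem (h p) η, hs', map_sum]
          simp only [map_smul]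
      rw [NCGM.connectionOfAction_apply]
      have e : ∀ i, N n (θ i) (Φ n hf.cls) ⊗ₜ[B] KaehlerDifferential.D k B (b i) =
          ∑ j, Φ n (hg j).cls ⊗ₜ[B] (θ i (b' j) • KaehlerDifferential.D k B (b i)) := fun i => by
        rw [hη, TensorProduct.sum_tmul]
        exact Finset.sum_congr rfl fun j _ => TensorProduct.smul_tmul _ _ _
      rw [Finset.sum_congr rfl fun i _ => e i, Finset.sum_comm]
      refine Finset.sum_congr rfl fun j _ => ?_
      rw [← TensorProduct.tmul_sum, ← hθ]
    refine ⟨_, hGM, fun N' hN' => ?_,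
      fun n => NCGM.isFlatConnection_connectionOfAction (hflat n) hθ⟩
    funext n
    ext x
    obtain ⟨f, hf, rfl⟩ := hrep n x
    obtain ⟨T, hT⟩ := hf.exists_isExpansion
    have hp := hT.sub_sum_mem_redFiltration hθ
    rw [hN' n f hf m b _ (fun j => hT.isLift_mulDerivation hf (θ j)) hp,
      hGM n f hf m b _ (fun j => hT.isLift_mulDerivation hf (θ j)) hp]
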